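/- Let $\mathbb K$ be a field of characteristic $0$, $n\ge 0$, and let $\mathbb K[A]$ be the polynomial ring in variables $a_{i,j}$, $i+j\le n$, the coefficients of the generic ternary form $\sum_{i+j\le n}\frac{n!}{i!\,j!\,(n-(i+j))!}a_{i,j}x_1^{n-(i+j)}x_2^ix_3^j$; write $\mathbb K[A,X,U]$ for $\mathbb K[A,x_1,x_2,x_3,u_1,u_2,u_3]$, the ring of polynomial functions on $T_n\oplus\mathbb K^3\oplus(\mathbb K^3)^*$, where $T_n$ is the space of ternary forms of degree $n$, with its natural $SL_3$-action by substitutions and the corresponding $sl_3$-action by derivations. Thus $E_{12},E_{23},E_{13}$ act on $\mathbb K[A]$ by $a_{i,j}\mapsto i\,a_{i-1,j}$, $j\,a_{i+1,j-1}$, $j\,a_{i,j-1}$; the operators $\hat D_1,\hat D_2,\hat D_3$ given by $E_{21},E_{32},E_{31}$ act by $a_{i,j}\mapsto (n-(i+j))a_{i+1,j}$, $i\,a_{i-1,j+1}$, $(n-(i+j))a_{i,j+1}$; and $z\,x_i=-\sum_j z_{ij}x_j$, $z\,u_j=\sum_i z_{ij}u_i$ for $z\in sl_3$. Let $UT_3$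 and $DT_3$ be the Lie algebras of strictly upper and strictly lower triangular $3\times3$ matrices, $\mathfrak U(L)$ the universal enveloping algebra of $L$, and $\Gamma_{d_1,d_2}$ the irreducible $sl_3$-module of highest weight $[d_1,d_2]$ (eigenvalues of $E_{11}-E_{22}$ and $E_{22}-E_{33}$), realized as the submodule of $\mathbb K[X,U]$ generated by $u_1^{d_1}x_3^{d_2}$. Let $a\in\mathbb K[A]$ be homogeneous of degree $m$, isobaric (an eigenvector of $E_{11}-E_{22}$ and of $E_{22}-E_{33}$), annihilated by $UT_3$, and of multiorder $[d_1,d_2]$, i.e. $d_r=\max\{s:\hat D_r^s(a)\ne0\}$ for $r=1,2$ (so $a\neq 0$; irreducibility of $a$ in whatever sense is not needed). Consider families $\bar B_{i,j}^{k,l}\in\mathbb K[A]$ ($i+j\le d_1$, $k+l\le d_2$) satisfying $\bar B_{0,0}^{0,0}=a$, $$\hat D_1(\bar B_{i,j}^{k,l})=(d_1-(i+j))\bar B_{i+1,j}^{k,l}-l\,\bar B_{i,j}^{k+1,l-1},$$ $$\hat D_2(\bar B_{i,j}^{k,l})=i\,\bar B_{i-1,j+1}^{k,l}-(d_2-(k+l))\bar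 B_{i,j}^{k,l+1},$$ $$\hat D_3(\bar B_{i,j}^{k,l})=(d_1-(i+j))\bar B_{i,j+1}^{k,l}-(d_2-(k+l))\bar B_{i,j}^{k+1,l}$$ (terms with an index out of range have coefficient zero and are omitted), and $\varphi\bigl(x_1^{d_1-s}u_3^{d_2-s}(x_1u_1+x_2u_2+x_3u_3)^s\bigr)=0$ for $1\le s\le\min(d_1,d_2)$, where $\varphi$ is the linear map with $\varphi\bigl(x_1^{d_1-(i+j)}x_2^ix_3^ju_3^{d_2-(k+l)}u_1^ku_2^l\bigr)=\bar B_{i,j}^{k,l}$. Then: (i) $\mathfrak U(DT_3)a$ is an $sl_3$-submodule of $\mathbb K[A]$, it is irreducible, and it is isomorphic to $\Gamma_{d_1,d_2}$. There is exactly one family $\bar B_{i,j}^{k,l}$ as above, and its linear span $\bar B_{d_1}^{d_2}$ equals $\mathfrak U(DT_3)a$. (ii) The element $$\Delta(\bar B_{d_1}^{d_2},S^{d_1}(X)\cdot S^{d_2}(U))=\sum_{i+j\le d_1,\;k+l\le d_2}\frac{d_1!\,d_2!\;\bar B_{i,j}^{k,l}\,x_1^{d_1-(i+j)}x_2^ix_3^j\,u_3^{d_2-(k+l)}u_1^ku_2^l}{i!\,j!\,k!\,l!\,(d_1-(i+j))!\,(d_2-(k+l))!}$$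 is a Casimir element, i.e. it is annihilated by $sl_3$, and it is a mixed concomitant of class $[d_1,d_2]$: it is nonzero, $SL_3$-invariant, and homogeneous of degree $m$ in $A$, $d_1$ in $X$ and $d_2$ in $U$. -/

import Mathlib

open MvPolynomial
open scoped Nat

attribute [local instance 100] LieRing.ofAssociativeRing

noncomputable section

namespace TernaryForms

/-- Indices `(i, j)` with `i + j ≤ n` of the coefficients of a ternary form of degree `n`. -/
abbrev FormIdx (n : ℕ) : Type := {p : ℕ × ℕ // p.1 + p.2 ≤ n}

/-- The ring `K[A]`, with one variable `a_{i,j}` for each `i + j ≤ n`. -/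
abbrev CoordRing (K : Type*) [Field K] (n : ℕ) : Type _ := MvPolynomial (FormIdx n) K

/-- The ring `K[X, U]`; `Sum.inl i` is the variable `x_{i+1}`, `Sum.inr i` is `u_{i+1}`. -/
abbrev XURing (K : Type*) [Field K] : Type _ := MvPolynomial (Fin 3 ⊕ Fin 3) K

/-- The ring `K[A, X, U]`. -/
abbrev FullRing (K : Type*) [Field K] (n : ℕ) : Type _ :=
  MvPolynomial (FormIdx n ⊕ (Fin 3 ⊕ Fin 3)) K

/-- The Lie algebra `sl_3`. -/
abbrev sl3 (K : Type*) [Field K] : LieSubalgebra K (Matrix (Fin 3) (Fin 3) K) :=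
  LieAlgebra.SpecialLinear.sl (Fin 3) K

/-- The algebra of strictly upper triangular matrices, with basis `E₁₂, E₂₃, E₁₃`. -/
def UT3 (K : Type*) [Field K] : LieSubalgebra K (Matrix (Fin 3) (Fin 3) K) where
  carrier := {z | ∀ i j, j ≤ i → z i j = 0}
  add_mem' := by
    intro z w hz hw i j h
    simp [hz i j h, hw i j h]
  zero_mem' := by
    intro i j _
    rfl
  smul_mem' := by
    intro c z hz i j h
    simp [hz i j h]
  lie_mem' := by
    intro z w hz hw i j h
    simp only [Ring.lie_def, Matrix.sub_apply, Matrix.mul_apply]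
    rw [Finset.sum_eq_zero, Finset.sum_eq_zero, sub_zero]
    · intro k _
      rcases le_total k i with hk | hk
      · simp [hw i k hk]
      · simp [hz k j (h.trans hk)]
    · intro k _
      rcases le_total k i with hk | hk
      · simp [hz i k hk]
      · simp [hw k j (h.trans hk)]

/-- The algebra of strictly lower triangular matrices, with basis `E₂₁, E₃₂, E₃₁`. -/
def DT3 (K : Type*) [Field K] : LieSubalgebra K (Matrix (Fin 3) (Fin 3) K) where
  carrier := {z | ∀ i j, i ≤ j → z i j = 0}
  add_mem' := by
    intro z w hz hw i j h
    simp [hz i j h, hw i j h]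
  zero_mem' := by
    intro i j _
    rfl
  smul_mem' := by
    intro c z hz i j h
    simp [hz i j h]
  lie_mem' := by
    intro z w hz hw i j h
    simp only [Ring.lie_def, Matrix.sub_apply, Matrix.mul_apply]
    rw [Finset.sum_eq_zero, Finset.sum_eq_zero, sub_zero]
    · intro k _
      rcases le_total i k with hk | hk
      · simp [hw i k hk]
      · simp [hz k j (hk.trans h)]
    · intro k _
      rcases le_total i k with hk | hk
      · simp [hz i k hk]
      · simp [hw k j (hk.trans h)]

section Actions

variable (K : Type*) [Field K] (n : ℕ)

/-- The variable `a_{i,j}`, read as `0` when `i + j > n`. -/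
def aVar (i j : ℕ) : CoordRing K n := if h : i + j ≤ n then X ⟨(i, j), h⟩ else 0

/-- The derivation of `K[A]` by which a matrix `z` acts: `E₁₂ a_{i,j} = i a_{i-1,j}`,
`E₂₃ a_{i,j} = j a_{i+1,j-1}`, `E₂₁ a_{i,j} = (n-(i+j)) a_{i+1,j}`, and so on. A term whose
index leaves the range has coefficient zero. -/
def coordDer (z : Matrix (Fin 3) (Fin 3) K) : Derivation K (CoordRing K n) (CoordRing K n) :=
  mkDerivation K fun p =>
    (z 0 1 * (p.1.1 : K)) • aVar K n (p.1.1 - 1) p.1.2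
      + (z 1 2 * (p.1.2 : K)) • aVar K n (p.1.1 + 1) (p.1.2 - 1)
      + (z 0 2 * (p.1.2 : K)) • aVar K n p.1.1 (p.1.2 - 1)
      + (z 1 0 * ((n - (p.1.1 + p.1.2) : ℕ) : K)) • aVar K n (p.1.1 + 1) p.1.2
      + (z 2 1 * (p.1.1 : K)) • aVar K n (p.1.1 - 1) (p.1.2 + 1)
      + (z 2 0 * ((n - (p.1.1 + p.1.2) : ℕ) : K)) • aVar K n p.1.1 (p.1.2 + 1)
      + (z 0 0 * ((n - (p.1.1 + p.1.2) : ℕ) : K) + z 1 1 * (p.1.1 : K)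
          + z 2 2 * (p.1.2 : K)) • aVar K n p.1.1 p.1.2

/-- The derivation of `K[X, U]` by which a matrix `z` acts: `z x_i = -∑ j, z_{ij} x_j` and
`z u_j = ∑ i, z_{ij} u_i`. -/
def xuDer (z : Matrix (Fin 3) (Fin 3) K) : Derivation K (XURing K) (XURing K) :=
  mkDerivation K (Sum.elim
    (fun i => -∑ j, z i j • X (Sum.inl j))
    (fun j => ∑ i, z i j • X (Sum.inr i)))

/-- The derivation of `K[A, X, U]` by which a matrix `z` acts. -/
def fullDer (z : Matrix (Fin 3) (Fin 3) K) : Derivation K (FullRing K n) (FullRing K n) :=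
  mkDerivation K (Sum.elim
    (fun p => rename Sum.inl (coordDer K n z (X p)))
    (fun s => rename Sum.inr (xuDer K z (X s))))

end Actions

section ActionLemmas

variable {K : Type*} [Field K] {n : ℕ}

variable (K n) in
/-- The image of `a_{i,j}` under `z`, with `k = n - (i + j)`. -/
def aVarImage (z : Matrix (Fin 3) (Fin 3) K) (i j k : ℕ) : CoordRing K n :=
  (z 0 1 * (i : K)) • aVar K n (i - 1) j
      + (z 1 2 * (j : K)) • aVar K n (i + 1) (j - 1)
      + (z 0 2 * (j : K)) • aVar K n i (j - 1)
      + (z 1 0 * (k : K)) • aVar K n (i + 1) j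
      + (z 2 1 * (i : K)) • aVar K n (i - 1) (j + 1)
      + (z 2 0 * (k : K)) • aVar K n i (j + 1)
      + (z 0 0 * (k : K) + z 1 1 * (i : K) + z 2 2 * (j : K)) • aVar K n i j

theorem coordDer_aVar (z : Matrix (Fin 3) (Fin 3) K) (i j k : ℕ) (h : i + j + k = n) :
    coordDer K n z (aVar K n i j) = aVarImage K n z i j k := by
  have h1 : i + j ≤ n := by omega
  have h2 : n - (i + j) = k := by omega
  conv_lhs => rw [aVar, dif_pos h1]
  simp only [coordDer, mkDerivation_X, h2, aVarImage]

theorem coordDer_lie (z w : Matrix (Fin 3) (Fin 3) K) :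
    coordDer K n ⁅z, w⁆ = ⁅coordDer K n z, coordDer K n w⁆ := by
  apply MvPolynomial.derivation_ext
  rintro ⟨⟨i, j⟩, hij⟩
  obtain ⟨k, hk⟩ := Nat.exists_eq_add_of_le hij
  have hX : (X ⟨(i, j), hij⟩ : CoordRing K n) = aVar K n i j := by rw [aVar, dif_pos hij]
  simp only at hk
  have hk' : i + j + k = n := hk.symm
  have e0 : ∀ v, coordDer K n v (aVar K n i j) = aVarImage K n v i j k :=
    fun v => coordDer_aVar v i j k hk'
  have e1 : ∀ v, (i : K) • coordDer K n v (aVar K n (i - 1) j) =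
      (i : K) • aVarImage K n v (i - 1) j (k + 1) := by
    intro v
    rcases i with _ | i
    · simp only [Nat.cast_zero, zero_smul]
    · exact congrArg _ (coordDer_aVar v (i + 1 - 1) j (k + 1) (by omega))
  have e2 : ∀ v, (j : K) • coordDer K n v (aVar K n (i + 1) (j - 1)) =
      (j : K) • aVarImage K n v (i + 1) (j - 1) k := by
    intro v
    rcases j with _ | j
    · simp only [Nat.cast_zero, zero_smul]
    · exact congrArg _ (coordDer_aVar v (i + 1) (j + 1 - 1) k (by omega))
  have e3 : ∀ v, (j : K) • coordDer K n v (aVar K n i (j - 1)) =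
      (j : K) • aVarImage K n v i (j - 1) (k + 1) := by
    intro v
    rcases j with _ | j
    · simp only [Nat.cast_zero, zero_smul]
    · exact congrArg _ (coordDer_aVar v i (j + 1 - 1) (k + 1) (by omega))
  have e4 : ∀ v, (k : K) • coordDer K n v (aVar K n (i + 1) j) =
      (k : K) • aVarImage K n v (i + 1) j (k - 1) := by
    intro v
    rcases k with _ | k
    · simp only [Nat.cast_zero, zero_smul]
    · exact congrArg _ (coordDer_aVar v (i + 1) j (k + 1 - 1) (by omega))
  have e5 : ∀ v, (i : K) • coordDer K n v (aVar K n (i - 1) (j + 1)) =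
      (i : K) • aVarImage K n v (i - 1) (j + 1) k := by
    intro v
    rcases i with _ | i
    · simp only [Nat.cast_zero, zero_smul]
    · exact congrArg _ (coordDer_aVar v (i + 1 - 1) (j + 1) k (by omega))
  have e6 : ∀ v, (k : K) • coordDer K n v (aVar K n i (j + 1)) =
      (k : K) • aVarImage K n v i (j + 1) (k - 1) := by
    intro v
    rcases k with _ | k
    · simp only [Nat.cast_zero, zero_smul]
    · exact congrArg _ (coordDer_aVar v i (j + 1) (k + 1 - 1) (by omega))
  rw [hX, Derivation.commutator_apply]
  simp only [e0, aVarImage, map_add, Derivation.map_smul, mul_smul, add_smul,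
    e1, e2, e3, e4, e5, e6]
  simp only [Ring.lie_def, Matrix.sub_apply, Matrix.mul_apply, Fin.sum_univ_three]
  clear e0 e1 e2 e3 e4 e5 e6
  rcases i with _ | i <;> rcases j with _ | j <;> rcases k with _ | k <;>
  simp only [Nat.cast_zero, zero_smul, smul_zero, Nat.cast_add, Nat.cast_one,
    Nat.add_sub_cancel, zero_add, add_zero] <;>
  module

theorem coordDer_add (z w : Matrix (Fin 3) (Fin 3) K) :
    coordDer K n (z + w) = coordDer K n z + coordDer K n w := by
  apply MvPolynomial.derivation_ext
  intro p
  simp only [coordDer, Derivation.add_apply, mkDerivation_X, Matrix.add_apply, add_mul, add_smul]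
  abel

theorem coordDer_smul (c : K) (z : Matrix (Fin 3) (Fin 3) K) :
    coordDer K n (c • z) = c • coordDer K n z := by
  apply MvPolynomial.derivation_ext
  intro p
  simp only [coordDer, Derivation.smul_apply, mkDerivation_X, Matrix.smul_apply, smul_add,
    smul_smul, smul_eq_mul, mul_add, mul_assoc]

theorem xuDer_lie (z w : Matrix (Fin 3) (Fin 3) K) :
    xuDer K ⁅z, w⁆ = ⁅xuDer K z, xuDer K w⁆ := by
  apply MvPolynomial.derivation_ext
  rintro (i | i)
  · simp only [xuDer, Derivation.commutator_apply, mkDerivation_X, Sum.elim_inl, Ring.lie_def,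
      Matrix.sub_apply, Matrix.mul_apply, Fin.sum_univ_three, map_add, map_neg,
      Derivation.map_smul]
    module
  · simp only [xuDer, Derivation.commutator_apply, mkDerivation_X, Sum.elim_inr, Ring.lie_def,
      Matrix.sub_apply, Matrix.mul_apply, Fin.sum_univ_three, map_add,
      Derivation.map_smul]
    module

theorem xuDer_add (z w : Matrix (Fin 3) (Fin 3) K) :
    xuDer K (z + w) = xuDer K z + xuDer K w := by
  apply MvPolynomial.derivation_ext
  rintro (i | i) <;>
  simp only [xuDer, Derivation.add_apply, mkDerivation_X, Sum.elim_inl, Sum.elim_inr,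
    Matrix.add_apply, add_smul, Finset.sum_add_distrib, neg_add]

theorem xuDer_smul (c : K) (z : Matrix (Fin 3) (Fin 3) K) :
    xuDer K (c • z) = c • xuDer K z := by
  apply MvPolynomial.derivation_ext
  rintro (i | i) <;>
  simp only [xuDer, Derivation.smul_apply, mkDerivation_X, Sum.elim_inl, Sum.elim_inr,
    Matrix.smul_apply, smul_eq_mul, Finset.smul_sum, smul_neg, smul_smul]

end ActionLemmas

section Modules

variable (K : Type*) [Field K] (n : ℕ)

/-- `3 × 3` matrices, hence also `sl_3` and its subalgebras, act on `K[A]`. -/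
instance coordLieRingModule : LieRingModule (Matrix (Fin 3) (Fin 3) K) (CoordRing K n) where
  bracket z f := coordDer K n z f
  add_lie z w f := by
    change coordDer K n (z + w) f = coordDer K n z f + coordDer K n w f
    rw [coordDer_add, Derivation.add_apply]
  lie_add z f g := map_add (coordDer K n z) f g
  leibniz_lie z w f := by
    change coordDer K n z (coordDer K n w f)
      = coordDer K n ⁅z, w⁆ f + coordDer K n w (coordDer K n z f)
    rw [coordDer_lie, Derivation.commutator_apply, sub_add_cancel]

instance coordLieModule : LieModule K (Matrix (Fin 3) (Fin 3) K) (CoordRing K n) where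
  smul_lie c z f := by
    change coordDer K n (c • z) f = c • coordDer K n z f
    rw [coordDer_smul, Derivation.smul_apply]
  lie_smul c z f := Derivation.map_smul (coordDer K n z) c f

/-- `3 × 3` matrices, hence also `sl_3` and its subalgebras, act on `K[X, U]`. -/
instance xuLieRingModule : LieRingModule (Matrix (Fin 3) (Fin 3) K) (XURing K) where
  bracket z f := xuDer K z f
  add_lie z w f := by
    change xuDer K (z + w) f = xuDer K z f + xuDer K w f
    rw [xuDer_add, Derivation.add_apply]
  lie_add z f g := map_add (xuDer K z) f g
  leibniz_lie z w f := by
    change xuDer K z (xuDer K w f) = xuDer K ⁅z, w⁆ f + xuDer K w (xuDer K z f)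
    rw [xuDer_lie, Derivation.commutator_apply, sub_add_cancel]

instance xuLieModule : LieModule K (Matrix (Fin 3) (Fin 3) K) (XURing K) where
  smul_lie c z f := by
    change xuDer K (c • z) f = c • xuDer K z f
    rw [xuDer_smul, Derivation.smul_apply]
  lie_smul c z f := Derivation.map_smul (xuDer K z) c f

/-- The irreducible `sl_3`-module `Γ_{d₁,d₂}` of highest weight `[d₁, d₂]`, realized as the
submodule of `K[X, U]` generated by the highest vector `u₁^{d₁} x₃^{d₂}`. -/
def Gamma (d₁ d₂ : ℕ) : LieSubmodule K (sl3 K) (XURing K) :=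
  LieSubmodule.lieSpan K (sl3 K) {X (Sum.inr 0) ^ d₁ * X (Sum.inl 2) ^ d₂}

variable {K n}

/-- The action of `E₂₁` on `K[A]`. -/
def hatD₁ : Derivation K (CoordRing K n) (CoordRing K n) := coordDer K n (Matrix.single 1 0 1)

/-- The action of `E₃₂` on `K[A]`. -/
def hatD₂ : Derivation K (CoordRing K n) (CoordRing K n) := coordDer K n (Matrix.single 2 1 1)

/-- The action of `E₃₁` on `K[A]`. -/
def hatD₃ : Derivation K (CoordRing K n) (CoordRing K n) := coordDer K n (Matrix.single 2 0 1)

/-- The action of `E₁₁ - E₂₂` on `K[A]`. -/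
def opE₁ : Derivation K (CoordRing K n) (CoordRing K n) :=
  coordDer K n (Matrix.single 0 0 1 - Matrix.single 1 1 1)

/-- The action of `E₂₂ - E₃₃` on `K[A]`. -/
def opE₂ : Derivation K (CoordRing K n) (CoordRing K n) :=
  coordDer K n (Matrix.single 1 1 1 - Matrix.single 2 2 1)

/-- `a` is an eigenvector of both weight operators. -/
def IsIsobaric (a : CoordRing K n) : Prop :=
  (∃ ω₁ : K, opE₁ a = ω₁ • a) ∧ ∃ ω₂ : K, opE₂ a = ω₂ • a

/-- `a` has order `[d₁, d₂]`: `d_i` is the largest `s` with `D̂_i^s a ≠ 0`. -/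
def HasOrder (a : CoordRing K n) (d₁ d₂ : ℕ) : Prop :=
  IsGreatest {s : ℕ | (hatD₁ : CoordRing K n → CoordRing K n)^[s] a ≠ 0} d₁ ∧
    IsGreatest {s : ℕ | (hatD₂ : CoordRing K n → CoordRing K n)^[s] a ≠ 0} d₂

/-- The subspace `𝔘(DT_3) a` of `K[A]`. -/
def envelopingSpan (a : CoordRing K n) : Submodule K (CoordRing K n) :=
  LinearMap.range ((LinearMap.applyₗ a).comp
    (UniversalEnvelopingAlgebra.lift K
      (LieModule.toEnd K (DT3 K) (CoordRing K n))).toLinearMap)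

end Modules

section Concomitants

variable {K : Type*} [Field K] {n d₁ d₂ : ℕ}

/-- The trinomial coefficient `n! / (i! j! (n-(i+j))!)`. -/
def trinom (K : Type*) [Field K] (n i j : ℕ) : K :=
  (n ! : K) / ((i ! : K) * (j ! : K) * ((n - (i + j))! : K))

/-- The entry `B_{i,j}^{k,l}` of a family, read as `0` outside `i + j ≤ d₁`, `k + l ≤ d₂`. -/
def entry (B : FormIdx d₁ → FormIdx d₂ → CoordRing K n) (i j k l : ℕ) : CoordRing K n :=
  if h : i + j ≤ d₁ ∧ k + l ≤ d₂ then B ⟨(i, j), h.1⟩ ⟨(k, l), h.2⟩ else 0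

/-- The linear map sending `x₁^{d₁-(i+j)} x₂^i x₃^j u₃^{d₂-(k+l)} u₁^k u₂^l` to
`B_{i,j}^{k,l}`. It is only evaluated at polynomials of bidegree `(d₁, d₂)`. -/
def dualMap (B : FormIdx d₁ → FormIdx d₂ → CoordRing K n) : XURing K →ₗ[K] CoordRing K n :=
  (basisMonomials (Fin 3 ⊕ Fin 3) K).constr K fun m =>
    entry B (m (Sum.inl 1)) (m (Sum.inl 2)) (m (Sum.inr 0)) (m (Sum.inr 1))

/-- The vector `x₁^{d₁-s} u₃^{d₂-s} (x₁u₁ + x₂u₂ + x₃u₃)^s` of `S^{d₁}(X) · S^{d₂}(U)`,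
annihilated by `DT_3`. -/
def lowestVector (K : Type*) [Field K] (d₁ d₂ s : ℕ) : XURing K :=
  X (Sum.inl 0) ^ (d₁ - s) * X (Sum.inr 2) ^ (d₂ - s)
    * (∑ i : Fin 3, X (Sum.inl i) * X (Sum.inr i)) ^ s

/-- The conditions from which the elements `B_{i,j}^{k,l}` are found. The summands whose index
falls outside the range have coefficient zero. -/
structure IsConcomitantFamily (a : CoordRing K n)
    (B : FormIdx d₁ → FormIdx d₂ → CoordRing K n) : Prop where
  init : entry B 0 0 0 0 = a
  hatD₁_eq : ∀ i j k l : ℕ, i + j ≤ d₁ → k + l ≤ d₂ →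
    hatD₁ (entry B i j k l) = ((d₁ - (i + j) : ℕ) : K) • entry B (i + 1) j k l
      - (l : K) • entry B i j (k + 1) (l - 1)
  hatD₂_eq : ∀ i j k l : ℕ, i + j ≤ d₁ → k + l ≤ d₂ →
    hatD₂ (entry B i j k l) = (i : K) • entry B (i - 1) (j + 1) k l
      - ((d₂ - (k + l) : ℕ) : K) • entry B i j k (l + 1)
  hatD₃_eq : ∀ i j k l : ℕ, i + j ≤ d₁ → k + l ≤ d₂ →
    hatD₃ (entry B i j k l) = ((d₁ - (i + j) : ℕ) : K) • entry B i (j + 1) k l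
      - ((d₂ - (k + l) : ℕ) : K) • entry B i j (k + 1) l
  vanish : ∀ s : ℕ, 1 ≤ s → s ≤ min d₁ d₂ → dualMap B (lowestVector K d₁ d₂ s) = 0

/-- The variable `x_{i+1}` of `K[A, X, U]`. -/
def xVar (K : Type*) [Field K] (n : ℕ) (i : Fin 3) : FullRing K n := X (Sum.inr (Sum.inl i))

/-- The variable `u_{i+1}` of `K[A, X, U]`. -/
def uVar (K : Type*) [Field K] (n : ℕ) (i : Fin 3) : FullRing K n := X (Sum.inr (Sum.inr i))

/-- The element `Δ(B, S^{d₁}(X) · S^{d₂}(U))`. -/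
def casimir (B : FormIdx d₁ → FormIdx d₂ → CoordRing K n) : FullRing K n :=
  ∑ i ∈ Finset.range (d₁ + 1), ∑ j ∈ Finset.range (d₁ + 1 - i),
    ∑ k ∈ Finset.range (d₂ + 1), ∑ l ∈ Finset.range (d₂ + 1 - k),
      (trinom K d₁ i j * trinom K d₂ k l) • (rename Sum.inl (entry B i j k l)
        * (xVar K n 0 ^ (d₁ - (i + j)) * xVar K n 1 ^ i * xVar K n 2 ^ j)
        * (uVar K n 2 ^ (d₂ - (k + l)) * uVar K n 0 ^ k * uVar K n 1 ^ l))

/-- The generic ternary form of degree `n`, with coefficients in `K[A]`. -/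
def genericForm (K : Type*) [Field K] (n : ℕ) : MvPolynomial (Fin 3) (CoordRing K n) :=
  ∑ i ∈ Finset.range (n + 1), ∑ j ∈ Finset.range (n + 1 - i),
    C (trinom K n i j • aVar K n i j) * (X 0 ^ (n - (i + j)) * X 1 ^ i * X 2 ^ j)

/-- The image of `a_{i,j}` under `g`: the coefficient with index `(i, j)`, in the normalization
of the generic form, of the form `F(g x)` obtained from the generic form `F(x)`. -/
def substCoeff (g : Matrix.SpecialLinearGroup (Fin 3) K) (p : FormIdx n) : CoordRing K n :=
  (trinom K n p.1.1 p.1.2)⁻¹ •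
    coeff (Finsupp.equivFunOnFinite.symm ![n - (p.1.1 + p.1.2), p.1.1, p.1.2])
      (bind₁ (fun r : Fin 3 => ∑ s : Fin 3, C (C (g.1 r s)) * X s) (genericForm K n))

/-- The action of `g ∈ SL_3` on `K[A, X, U]`, the ring of polynomial functions on
`T_n ⊕ K³ ⊕ (K³)^*`: `(g P)(F, v, ℓ) = P(F ∘ g, g⁻¹ v, ℓ ∘ g)`. -/
def slAct (g : Matrix.SpecialLinearGroup (Fin 3) K) : FullRing K n →ₐ[K] FullRing K n :=
  aeval (Sum.elim (fun p => rename Sum.inl (substCoeff g p))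
    (Sum.elim (fun i => ∑ j, (g⁻¹).1 i j • xVar K n j) (fun j => ∑ i, g.1 i j • uVar K n i)))

/-- `f` is a nonzero mixed concomitant of ternary forms of degree `n`: an `SL_3`-invariant in
`K[A, X, U]` that is homogeneous of degree `m` in `A`, `d₁` in `X` and `d₂` in `U`. -/
structure IsMixedConcomitant (m d₁ d₂ : ℕ) (f : FullRing K n) : Prop where
  ne_zero : f ≠ 0
  invariant : ∀ g : Matrix.SpecialLinearGroup (Fin 3) K, slAct g f = f
  homogeneous_A : IsWeightedHomogeneous (Sum.elim (fun _ => 1) (fun _ => 0) : _ → ℕ) f m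
  homogeneous_X : IsWeightedHomogeneous
    (Sum.elim (fun _ => 0) (Sum.elim (fun _ => 1) (fun _ => 0)) : _ → ℕ) f d₁
  homogeneous_U : IsWeightedHomogeneous
    (Sum.elim (fun _ => 0) (Sum.elim (fun _ => 0) (fun _ => 1)) : _ → ℕ) f d₂

end Concomitants

end TernaryForms

end

/-! The theorem is highest weight theory for `sl_3`, done by hand with nine operators `E i j` that
satisfy the relations of the matrix units.

On the line of `a`, the sl_2-identity for `E_{ij} E_{ji}^k` shows that the multiorder of `a` is its
weight. Commutators move every operator past the lowering ones, so `𝔘(DT_3) a` is stable under all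
of `sl_3`. For irreducibility (`highest_mem_of_stable`), a nonzero stable subspace has a weight
vector `b` of least depth, which is again a highest vector. The quadratic Casimir operator acts on
`a` and on `b` by the same scalar. If `b` lies `p` and `q` simple roots below `a`, this reads `p (d₁
+ m₁ + 2) + q (d₂ + m₂ + 2) = 0` with natural numbers `m₁, m₂`, so `p = q = 0` and `b` is a multiple
of `a`. The isomorphism with `Γ_{d₁,d₂}` is the submodule of the product generated by the pair of
highest vectors: that submodule is irreducible, so both projections are injective on it.

After the letters `x` and `u` are exchanged, the three systems of equations for `B` say that a
linear map `ψ` from `S^{d₁}(U) · S^{d₂}(X)` to `K[A]` commutes with the lowering operators. The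
remaining conditions say that `ψ` sends `u₁^{d₁} x₃^{d₂}` to `a` and kills the highest vectors `(∑
xᵢuᵢ)^s u₁^{d₁-s} x₃^{d₂-s}` with `s ≥ 1`. Its graph must therefore be `familyGraph`, the span
generated from these prescribed pairs by lowering. It is defined everywhere because the highest
vectors generate every monomial (`mon_mem_of_highest_mem`), and single-valued because the part
generated by `(a, u₁^{d₁} x₃^{d₂})` is irreducible and that monomial is not divisible by `∑ xᵢuᵢ`
(`eq_zero_of_mem_familyGraph`). Existence and uniqueness follow, and so does equivariance of `ψ`
under all of `sl_3`, since the graph is generated by highest vectors.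

The Casimir element is the image of the invariant tensor `(∑ uᵢ ⊗ xᵢ)^{d₁} (∑ xᵢ ⊗ uᵢ)^{d₂}` under
`f ⊗ g ↦ ψ(f) g`, so `sl_3` annihilates it. To pass to `SL_3`, the group is generated by
transvections `1 + t E_{rs}`; along such a family the `t`-derivative of the transformed element is
the transform of its image under `E_{rs}`, hence zero, and in characteristic `0` the element does
not depend on `t`. -/

noncomputable section

namespace TernaryForms

/-! ### Highest weight vectors for abstract matrix-unit operators -/

section HighestWeight

variable {K : Type*} [Field K] {V : Type*} [AddCommGroup V] [Module K V]
  {E : Fin 3 → Fin 3 → Module.End K V} {lam : Fin 3 → K} {a : V}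

/-- The operators `E i j` satisfy the commutation relations of the matrix units. -/
def MatrixUnitRel (E : Fin 3 → Fin 3 → Module.End K V) : Prop :=
  ∀ i j k l v, E i j (E k l v) = E k l (E i j v) + (if j = k then E i l v else 0)
    - (if l = i then E k j v else 0)

/-- The least subspace that contains `s` and is stable under the lowering operators. -/
def lowerSpan (E : Fin 3 → Fin 3 → Module.End K V) (s : Set V) : Submodule K V :=
  sInf {P | s ⊆ P ∧ ∀ i j, j < i → ∀ v ∈ P, E i j v ∈ P}

theorem subset_lowerSpan (s : Set V) : s ⊆ lowerSpan E s := by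
  intro v hv
  simp only [lowerSpan, SetLike.mem_coe, Submodule.mem_sInf]
  exact fun P hP => hP.1 hv

theorem lower_mem_lowerSpan {s : Set V} {i j : Fin 3} (hij : j < i) {v : V}
    (hv : v ∈ lowerSpan E s) : E i j v ∈ lowerSpan E s := by
  simp only [lowerSpan, Submodule.mem_sInf] at hv ⊢
  exact fun P hP => hP.2 i j hij v (hv P hP)

theorem lowerSpan_le {s : Set V} {P : Submodule K V} (hs : s ⊆ P)
    (hP : ∀ i j, j < i → ∀ v ∈ P, E i j v ∈ P) : lowerSpan E s ≤ P :=
  sInf_le ⟨hs, hP⟩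

theorem lowerSpan_mono {s t : Set V} (h : s ⊆ t) : lowerSpan E s ≤ lowerSpan E t :=
  lowerSpan_le (h.trans (subset_lowerSpan t)) fun _ _ hij _ hv => lower_mem_lowerSpan hij hv

/-- `a` is killed by the raising operators and has weight `lam`. -/
structure IsHighest (E : Fin 3 → Fin 3 → Module.End K V) (lam : Fin 3 → K) (a : V) : Prop where
  upper : ∀ i j, i < j → E i j a = 0
  diag : ∀ i, E i i a = lam i • a

/-- Moving `E i j` to the right past a lowering operator costs only terms with a single operator
`E`, so stability propagates from the generators. -/
theorem stable_lowerSpan (hE : MatrixUnitRel E) {s : Set V}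
    (hs : ∀ a ∈ s, ∃ lam, IsHighest E lam a) (i j : Fin 3) {v : V} (hv : v ∈ lowerSpan E s) :
    E i j v ∈ lowerSpan E s := by
  -- The vectors of the span that every operator keeps in the span; it suffices that this subspace
  -- contains `s` and is stable under lowering.
  let Q : Submodule K V :=
    lowerSpan E s ⊓ ⨅ i, ⨅ j, (lowerSpan E s).comap (E i j)
  have hQ : ∀ v, v ∈ Q ↔ v ∈ lowerSpan E s ∧ ∀ i j, E i j v ∈ lowerSpan E s := by
    intro v
    simp [Q]
  suffices h : lowerSpan E s ≤ Q from ((hQ v).1 (h hv)).2 i j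
  refine lowerSpan_le ?_ ?_
  · intro a ha
    have ha' := subset_lowerSpan (E := E) s ha
    refine (hQ a).2 ⟨ha', fun i j => ?_⟩
    obtain ⟨lam, h⟩ := hs a ha
    rcases lt_trichotomy i j with hij | rfl | hij
    · rw [h.upper i j hij]
      exact zero_mem _
    · rw [h.diag i]
      exact Submodule.smul_mem _ _ ha'
    · exact lower_mem_lowerSpan hij ha'
  · intro k l hkl v hv
    obtain ⟨h1, h2⟩ := (hQ v).1 hv
    refine (hQ _).2 ⟨lower_mem_lowerSpan hkl h1, fun i j => ?_⟩
    rw [hE i j k l v]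
    refine sub_mem (add_mem (lower_mem_lowerSpan hkl (h2 i j)) ?_) ?_
    · split_ifs
      · exact h2 i l
      · exact zero_mem _
    · split_ifs
      · exact h2 k j
      · exact zero_mem _

/-- Among sums of eigenvectors that lie in `M`, the operator `T - μ i` removes one summand. Either
it annihilates the sum, which is then an eigenvector, or induction applies to the shorter sum. -/
theorem exists_eigenvector_mem {T : Module.End K V} {ι : Type*} (μ : ι → K)
    {M : Submodule K V} (hM : ∀ v ∈ M, T v ∈ M) (hne : M ≠ ⊥)
    (hle : M ≤ ⨆ i, T.eigenspace (μ i)) : ∃ i, ∃ v ∈ M, v ≠ 0 ∧ T v = μ i • v := by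
  classical
  have key : ∀ (s : Finset ι) (f : ι → V), (∀ i, T (f i) = μ i • f i) → ∑ i ∈ s, f i ∈ M →
      ∑ i ∈ s, f i ≠ 0 → ∃ i, ∃ v ∈ M, v ≠ 0 ∧ T v = μ i • v := by
    intro s
    induction s using Finset.induction_on with
    | empty => intro f _ _ h; simp at h
    | insert i s his ih =>
      intro f hf hm h0
      have hw : T (∑ j ∈ insert i s, f j) - μ i • ∑ j ∈ insert i s, f j
          = ∑ j ∈ s, (μ j - μ i) • f j := by
        rw [map_sum, Finset.smul_sum, ← Finset.sum_sub_distrib, Finset.sum_insert his, hf i,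
          sub_self, zero_add]
        exact Finset.sum_congr rfl fun j _ => by rw [hf j, sub_smul]
      by_cases hz : ∑ j ∈ s, (μ j - μ i) • f j = 0
      · exact ⟨i, _, hm, h0, sub_eq_zero.1 (hw.trans hz)⟩
      · refine ih (fun j => (μ j - μ i) • f j) (fun j => ?_) ?_ hz
        · rw [map_smul, hf j, smul_comm]
        · rw [← hw]
          exact sub_mem (hM _ hm) (M.smul_mem _ hm)
  obtain ⟨v, hv, hv0⟩ := Submodule.exists_mem_ne_zero_of_ne_bot hne
  obtain ⟨f, hf, rfl⟩ := (Submodule.mem_iSup_iff_exists_finsupp _ _).1 (hle hv)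
  exact key f.support f (fun i => Module.End.mem_eigenspace_iff.1 (hf i)) hv hv0

theorem eigenvalue_of_mem_iSup {T : Module.End K V} {ι : Type*} {μ : ι → K} {v : V} {ν : K}
    (hv : v ∈ ⨆ i, T.eigenspace (μ i)) (hv0 : v ≠ 0) (hT : T v = ν • v) : ∃ i, ν = μ i := by
  obtain ⟨i, w, hw, hw0, hTw⟩ := exists_eigenvector_mem (M := K ∙ v) μ
    (fun w hw => by
      obtain ⟨c, rfl⟩ := Submodule.mem_span_singleton.1 hw
      rw [map_smul, hT]
      exact Submodule.smul_mem _ _ (Submodule.smul_mem _ _ (Submodule.mem_span_singleton_self v)))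
    (by simpa using hv0) (by simpa using hv)
  obtain ⟨c, rfl⟩ := Submodule.mem_span_singleton.1 hw
  refine ⟨i, ?_⟩
  rw [map_smul, hT, smul_comm] at hTw
  exact smul_left_injective K hw0 hTw

/-- If every lowering operator carries each `T`-eigenspace `μ k` to some eigenspace `μ k'`, the
lowering span of an eigenvector is a sum of these eigenspaces. -/
theorem lowerSpan_le_iSup_eigenspace {T : Module.End K V} {ι : Type*} {μ : ι → K} (k : ι)
    (ha : T a = μ k • a)
    (h : ∀ i j, j < i → ∀ k v, T v = μ k • v → ∃ k', T (E i j v) = μ k' • E i j v) :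
    lowerSpan E {a} ≤ ⨆ k, T.eigenspace (μ k) := by
  refine lowerSpan_le ?_ ?_
  · rintro _ rfl
    exact Submodule.mem_iSup_of_mem k (Module.End.mem_eigenspace_iff.2 ha)
  · intro i j hij v hv
    induction hv using Submodule.iSup_induction' with
    | mem k v hv =>
      obtain ⟨k', hk'⟩ := h i j hij k v (Module.End.mem_eigenspace_iff.1 hv)
      exact Submodule.mem_iSup_of_mem k' (Module.End.mem_eigenspace_iff.2 hk')
    | zero => simp
    | add v w _ _ hv hw => rw [map_add]; exact add_mem hv hw

/-- Only `E 1 0` and `E 2 0` change the first weight, each by `-1`. Together with the analogue for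
the last weight this lets depth be counted by two natural numbers. -/
theorem lowerSpan_le_eigenspaces_first (hE : MatrixUnitRel E) (ha : IsHighest E lam a) :
    lowerSpan E {a} ≤ ⨆ k : ℕ, (E 0 0).eigenspace (lam 0 - k) := by
  refine lowerSpan_le_iSup_eigenspace 0 (by simp [ha.diag]) ?_
  intro i j hij k v hv
  have hi : (0 : Fin 3) ≠ i := (lt_of_le_of_lt (Fin.zero_le j) hij).ne
  rw [hE 0 0 i j v, hv, if_neg hi, map_smul]
  by_cases hj : j = 0
  · refine ⟨k + 1, ?_⟩
    subst hj
    rw [if_pos rfl]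
    push_cast
    module
  · exact ⟨k, by rw [if_neg hj]; module⟩

theorem lowerSpan_le_eigenspaces_last (hE : MatrixUnitRel E) (ha : IsHighest E lam a) :
    lowerSpan E {a} ≤ ⨆ k : ℕ, (E 2 2).eigenspace (lam 2 + k) := by
  refine lowerSpan_le_iSup_eigenspace 0 (by simp [ha.diag]) ?_
  intro i j hij k v hv
  have hj : j ≠ 2 := (lt_of_lt_of_le hij (Fin.le_last i)).ne
  rw [hE 2 2 i j v, hv, if_neg hj, map_smul]
  by_cases hi : 2 = i
  · refine ⟨k + 1, ?_⟩
    subst hi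
    rw [if_pos rfl]
    push_cast
    module
  · exact ⟨k, by rw [if_neg hi]; module⟩

/-- The trace commutes with all matrix units, so it is constant on the module; the middle weight is
recovered from the outer two. -/
theorem sum_diag_of_mem_lowerSpan (hE : MatrixUnitRel E) (ha : IsHighest E lam a) {v : V}
    (hv : v ∈ lowerSpan E {a}) :
    E 0 0 v + E 1 1 v + E 2 2 v = (lam 0 + lam 1 + lam 2) • v := by
  suffices h : lowerSpan E {a} ≤ (E 0 0 + E 1 1 + E 2 2).eigenspace (lam 0 + lam 1 + lam 2) from
    Module.End.mem_eigenspace_iff.1 (h hv)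
  refine lowerSpan_le ?_ ?_
  · rintro _ rfl
    refine Module.End.mem_eigenspace_iff.2 ?_
    simp only [LinearMap.add_apply, ha.diag, add_smul]
  · intro i j _ v hv
    rw [Module.End.mem_eigenspace_iff] at hv ⊢
    rw [← map_smul, ← hv]
    simp only [LinearMap.add_apply, map_add]
    rw [hE 0 0 i j v, hE 1 1 i j v, hE 2 2 i j v]
    fin_cases i <;> fin_cases j <;> simp <;> abel

/-- The quadratic Casimir operator. -/
def casimirOp (E : Fin 3 → Fin 3 → Module.End K V) : Module.End K V :=
  ∑ i, ∑ j, E i j * E j i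

theorem casimirOp_comm (hE : MatrixUnitRel E) (k l : Fin 3) (v : V) :
    casimirOp E (E k l v) = E k l (casimirOp E v) := by
  simp only [casimirOp, LinearMap.sum_apply, Module.End.mul_apply, map_sum]
  have h : ∀ i j, E i j (E j i (E k l v)) = E k l (E i j (E j i v))
      + ((if j = k then E i l (E j i v) else 0) - (if l = i then E k j (E j i v) else 0)
      + (if i = k then E i j (E j l v) else 0) - (if l = j then E i j (E k i v) else 0)) := by
    intro i j
    rw [hE j i k l v, map_sub, map_add, hE i j k l]
    split_ifs <;> (try simp only [map_zero]) <;> abel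
  simp only [h, Finset.sum_add_distrib, Finset.sum_sub_distrib]
  rw [add_eq_left]
  -- The four correction sums cancel in pairs: the first against the fourth, the second against the
  -- third.
  have e1 : ∑ i, ∑ j, (if j = k then E i l (E j i v) else 0) = ∑ i, E i l (E k i v) := by simp
  have e2 : ∑ i, ∑ j, (if l = i then E k j (E j i v) else 0) = ∑ j, E k j (E j l v) := by
    rw [Finset.sum_comm]; simp
  have e3 : ∑ i, ∑ j, (if i = k then E i j (E j l v) else 0) = ∑ j, E k j (E j l v) := by
    rw [Finset.sum_comm]; simp
  have e4 : ∑ i, ∑ j, (if l = j then E i j (E k i v) else 0) = ∑ i, E i l (E k i v) := by simp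
  rw [e1, e2, e3, e4]
  abel

/-- For `i < j` the product `E i j * E j i` contributes `lam i - lam j`, the opposite product
contributes zero, and the three differences add up to `2 (lam 0 - lam 2)`. -/
theorem casimirOp_highest (hE : MatrixUnitRel E) (ha : IsHighest E lam a) :
    casimirOp E a = (lam 0 ^ 2 + lam 1 ^ 2 + lam 2 ^ 2 + 2 * (lam 0 - lam 2)) • a := by
  have hl : ∀ i j, i < j → E i j (E j i a) = (lam i - lam j) • a := by
    intro i j hij
    rw [hE i j j i a, ha.upper i j hij, if_pos rfl, if_pos rfl, ha.diag, ha.diag, map_zero,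
      zero_add, sub_smul]
  simp only [casimirOp, Fin.sum_univ_three, LinearMap.add_apply, Module.End.mul_apply]
  rw [hl 0 1 (by decide), hl 0 2 (by decide), hl 1 2 (by decide), ha.upper 0 1 (by decide),
    ha.upper 0 2 (by decide), ha.upper 1 2 (by decide)]
  simp only [ha.diag, map_smul, map_zero]
  module

theorem casimirOp_of_mem_lowerSpan (hE : MatrixUnitRel E) (ha : IsHighest E lam a) {v : V}
    (hv : v ∈ lowerSpan E {a}) :
    casimirOp E v = (lam 0 ^ 2 + lam 1 ^ 2 + lam 2 ^ 2 + 2 * (lam 0 - lam 2)) • v := by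
  suffices h : lowerSpan E {a} ≤ (casimirOp E).eigenspace
      (lam 0 ^ 2 + lam 1 ^ 2 + lam 2 ^ 2 + 2 * (lam 0 - lam 2)) from
    Module.End.mem_eigenspace_iff.1 (h hv)
  refine lowerSpan_le ?_ ?_
  · rintro _ rfl
    exact Module.End.mem_eigenspace_iff.2 (casimirOp_highest hE ha)
  · intro i j _ v hv
    rw [Module.End.mem_eigenspace_iff] at hv ⊢
    rw [casimirOp_comm hE, hv, map_smul]

/-- The sl_2-identity `e f^{k+1} b = (k+1)(h - k) f^k b`, where `h = μ - ν` is the weight of `b`. -/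
theorem raise_lower_pow (hE : MatrixUnitRel E) {i j : Fin 3} (hij : i ≠ j) {b : V} {μ ν : K}
    (hb : E i j b = 0) (hi : E i i b = μ • b) (hj : E j j b = ν • b) (k : ℕ) :
    E i j ((E j i ^ (k + 1)) b) = ((k + 1 : K) * (μ - ν - k)) • (E j i ^ k) b := by
  have hw : ∀ k : ℕ, E i i ((E j i ^ k) b) - E j j ((E j i ^ k) b)
      = (μ - ν - 2 * k) • (E j i ^ k) b := by
    intro k
    induction k with
    | zero => simp [hi, hj, sub_smul]
    | succ k ih =>
      rw [pow_succ', Module.End.mul_apply, hE i i j i, hE j j j i, if_neg hij, if_pos rfl,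
        if_pos rfl, if_neg hij]
      have := congrArg (E j i) ih
      rw [map_sub, map_smul] at this
      rw [eq_add_of_sub_eq this]
      push_cast
      module
  induction k with
  | zero =>
    rw [pow_succ', Module.End.mul_apply, hE i j j i, if_pos rfl, if_pos rfl]
    simp [hb, hi, hj, sub_smul]
  | succ k ih =>
    rw [pow_succ', Module.End.mul_apply, hE i j j i, ih, if_pos rfl, if_pos rfl, map_smul,
      ← Module.End.mul_apply, ← pow_succ', add_sub_assoc, hw (k + 1), ← add_smul]
    congr 1
    push_cast
    ring

/-- Raising the vanishing vector `f^{d+1} b` gives `(d+1)(μ - ν - d) f^d b = 0`. This is how an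
order becomes a weight. -/
theorem weight_sub_eq [CharZero K] (hE : MatrixUnitRel E) {i j : Fin 3} (hij : i ≠ j) {b : V}
    {μ ν : K} (hb : E i j b = 0) (hi : E i i b = μ • b) (hj : E j j b = ν • b) {d : ℕ}
    (hd : (E j i ^ d) b ≠ 0) (hd' : (E j i ^ (d + 1)) b = 0) : μ - ν = d := by
  have h := raise_lower_pow hE hij hb hi hj d
  rw [hd', map_zero, eq_comm, smul_eq_zero, or_iff_left hd, mul_eq_zero,
    or_iff_right (by exact_mod_cast d.succ_ne_zero)] at h
  exact sub_eq_zero.1 h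

theorem exists_nat_weight_sub [CharZero K] (hE : MatrixUnitRel E) {i j : Fin 3} (hij : i ≠ j)
    {b : V} {μ ν : K} (hb0 : b ≠ 0) (hb : E i j b = 0) (hi : E i i b = μ • b)
    (hj : E j j b = ν • b) (hn : ∃ k, (E j i ^ k) b = 0) : ∃ d : ℕ, μ - ν = d := by
  classical
  obtain ⟨d, hd⟩ : ∃ d, Nat.find hn = d + 1 := by
    refine Nat.exists_eq_succ_of_ne_zero fun h => hb0 ?_
    have := Nat.find_spec hn
    rwa [h, pow_zero] at this
  exact ⟨d, weight_sub_eq hE hij hb hi hj (Nat.find_min hn (by omega)) (hd ▸ Nat.find_spec hn)⟩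

/-- The Leibniz expansion of `f^{k+1} g` stops after the first commutator because `h` commutes with
`f`. -/
theorem pow_succ_apply_of_commutator {f g h : Module.End K V} (hfg : ∀ v, f (g v) = g (f v) + h v)
    (hfh : ∀ v, f (h v) = h (f v)) (k : ℕ) (v : V) :
    (f ^ (k + 1)) (g v) = g ((f ^ (k + 1)) v) + ((k + 1 : ℕ) : K) • h ((f ^ k) v) := by
  induction k with
  | zero => simp [hfg]
  | succ k ih =>
    rw [pow_succ', Module.End.mul_apply, ih, map_add, hfg, map_smul, hfh, Module.End.mul_apply,
      ← Module.End.mul_apply f (f ^ k), ← pow_succ']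
    push_cast
    module

/-- The commutator of `f` with any lowering operator is zero or `± E 2 0`, which commutes with `f`.
So the vectors killed by some power of `f` form a subspace stable under lowering. -/
theorem exists_pow_apply_eq_zero (hE : MatrixUnitRel E) {f : Module.End K V}
    (hf : f = E 1 0 ∨ f = E 2 1) (ha : ∃ k, (f ^ k) a = 0) {v : V}
    (hv : v ∈ lowerSpan E {a}) : ∃ k, (f ^ k) v = 0 := by
  have h20 : ∀ v, f (E 2 0 v) = E 2 0 (f v) := by
    intro v
    rcases hf with rfl | rfl
    · simpa using hE 1 0 2 0 v
    · simpa using hE 2 1 2 0 v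
  have step : ∀ (g h : Module.End K V), (∀ v, f (g v) = g (f v) + h v) →
      (∀ v, f (h v) = h (f v)) → ∀ v, (∃ k, (f ^ k) v = 0) → ∃ k, (f ^ k) (g v) = 0 := by
    rintro g h h1 h2 v ⟨k, hk⟩
    refine ⟨k + 1, ?_⟩
    rw [pow_succ_apply_of_commutator h1 h2, hk, pow_succ', Module.End.mul_apply, hk]
    simp
  let P : Submodule K V := ⨆ k, LinearMap.ker (f ^ k)
  have hmono : Monotone fun k => LinearMap.ker (f ^ k) := by
    intro k l hkl v hv
    obtain ⟨r, rfl⟩ := Nat.exists_eq_add_of_le' hkl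
    simp only [LinearMap.mem_ker] at hv ⊢
    rw [pow_add, Module.End.mul_apply, hv, map_zero]
  have hP : ∀ v, v ∈ P ↔ ∃ k, (f ^ k) v = 0 := by
    intro v
    simp [P, Submodule.mem_iSup_of_directed _ hmono.directed_le]
  suffices h : lowerSpan E {a} ≤ P from (hP v).1 (h hv)
  refine lowerSpan_le (by simpa [hP] using ha) ?_
  intro i j hij v hv
  rw [hP] at hv ⊢
  have h00 : ∀ v, f ((0 : Module.End K V) v) = (0 : Module.End K V) (f v) := by simp
  have cases : (i = 1 ∧ j = 0) ∨ (i = 2 ∧ j = 1) ∨ (i = 2 ∧ j = 0) := by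
    revert hij
    fin_cases i <;> fin_cases j <;> decide
  rcases cases with ⟨rfl, rfl⟩ | ⟨rfl, rfl⟩ | ⟨rfl, rfl⟩
  · rcases hf with rfl | rfl
    · exact step _ 0 (by simp) h00 v hv
    · exact step _ (E 2 0) (fun v => by simpa using hE 2 1 1 0 v) h20 v hv
  · rcases hf with rfl | rfl
    · refine step _ (-E 2 0) (fun v => ?_) (fun v => ?_) v hv
      · simpa [sub_eq_add_neg] using hE 1 0 2 1 v
      · simp [h20]
    · exact step _ 0 (by simp) h00 v hv
  · exact step _ 0 (by simpa using h20) h00 v hv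

/-- Every lowering operator strictly decreases the eigenvalue of `E 0 0 - E 2 2`, so beyond the line
of `a` the module has only smaller eigenvalues. The component of `b` off that line has the top
eigenvalue and must vanish. -/
theorem mem_span_of_weight_eq [CharZero K] (hE : MatrixUnitRel E) (ha : IsHighest E lam a)
    {b : V} (hb : b ∈ lowerSpan E {a}) (h0 : E 0 0 b = lam 0 • b) (h2 : E 2 2 b = lam 2 • b) :
    b ∈ K ∙ a := by
  let T : Module.End K V := E 0 0 - E 2 2
  let R : Submodule K V := ⨆ k : ℕ, T.eigenspace (lam 0 - lam 2 - (k + 1))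
  have hT : ∀ i j, j < i → ∃ r : ℕ, ∀ (v : V) (c : K), T v = c • v →
      T (E i j v) = (c - (r + 1)) • E i j v := by
    intro i j hij
    have cases : (i = 1 ∧ j = 0) ∨ (i = 2 ∧ j = 1) ∨ (i = 2 ∧ j = 0) := by
      revert hij
      fin_cases i <;> fin_cases j <;> decide
    have e : ∀ (v : V) (c : K), T v = c • v → T (E i j v) = c • E i j v
        + ((if 0 = i then E 0 j v else 0) - (if j = 0 then E i 0 v else 0)
          - ((if 2 = i then E 2 j v else 0) - (if j = 2 then E i 2 v else 0))) := by
      intro v c hv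
      rw [← map_smul, ← hv]
      simp only [T, LinearMap.sub_apply, map_sub]
      rw [hE 0 0 i j v, hE 2 2 i j v]
      abel
    rcases cases with ⟨rfl, rfl⟩ | ⟨rfl, rfl⟩ | ⟨rfl, rfl⟩
    · refine ⟨0, fun v c hv => ?_⟩
      rw [e v c hv]
      simp
      module
    · refine ⟨0, fun v c hv => ?_⟩
      rw [e v c hv]
      simp
      module
    · refine ⟨1, fun v c hv => ?_⟩
      rw [e v c hv]
      simp
      module
  have haT : T a = (lam 0 - lam 2) • a := by simp [T, ha.diag, sub_smul]
  have hle : lowerSpan E {a} ≤ (K ∙ a) ⊔ R := by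
    refine lowerSpan_le ?_ ?_
    · rintro _ rfl
      exact Submodule.mem_sup_left (Submodule.mem_span_singleton_self _)
    · intro i j hij v hv
      obtain ⟨r, hr⟩ := hT i j hij
      obtain ⟨x, hx, y, hy, rfl⟩ := Submodule.mem_sup.1 hv
      refine Submodule.mem_sup_right ?_
      rw [map_add]
      refine add_mem ?_ ?_
      · obtain ⟨c, rfl⟩ := Submodule.mem_span_singleton.1 hx
        rw [map_smul]
        refine Submodule.smul_mem _ _ (Submodule.mem_iSup_of_mem r ?_)
        exact Module.End.mem_eigenspace_iff.2 (hr a _ haT)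
      · clear hv
        induction hy using Submodule.iSup_induction' with
        | mem k v hv =>
          -- The drops `k + 1` and `r + 1` add up to `(k + r + 1) + 1`.
          refine Submodule.mem_iSup_of_mem (k + r + 1) (Module.End.mem_eigenspace_iff.2 ?_)
          rw [hr v _ (Module.End.mem_eigenspace_iff.1 hv)]
          push_cast
          module
        | zero => simp
        | add v w _ _ hv hw => rw [map_add]; exact add_mem hv hw
  obtain ⟨x, hx, y, hy, hxy⟩ := Submodule.mem_sup.1 (hle hb)
  obtain ⟨c, rfl⟩ := Submodule.mem_span_singleton.1 hx
  suffices hy0 : y = 0 by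
    rw [← hxy, hy0, add_zero]
    exact hx
  by_contra hy0
  have hTy : T y = (lam 0 - lam 2) • y := by
    have hy' : y = b - c • a := by rw [← hxy]; abel
    rw [hy', map_sub, map_smul, haT]
    simp only [T, LinearMap.sub_apply, h0, h2]
    module
  obtain ⟨k, hk⟩ := eigenvalue_of_mem_iSup hy hy0 hTy
  have : ((k + 1 : ℕ) : K) = 0 := by push_cast; linear_combination hk
  exact k.succ_ne_zero (by exact_mod_cast this)

/-- A highest weight module with locally nilpotent lowering operators is irreducible. -/
theorem highest_mem_of_stable [CharZero K] (hE : MatrixUnitRel E) (ha : IsHighest E lam a)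
    {d₁ d₂ : ℕ} (h01 : lam 0 - lam 1 = d₁) (h12 : lam 1 - lam 2 = d₂)
    (hn1 : ∃ k, (E 1 0 ^ k) a = 0) (hn2 : ∃ k, (E 2 1 ^ k) a = 0) {M : Submodule K V}
    (hM : M ≤ lowerSpan E {a}) (hst : ∀ i j, ∀ v ∈ M, E i j v ∈ M) (hne : M ≠ ⊥) : a ∈ M := by
  classical
  have wt : ∀ v ∈ M, v ≠ 0 → ∀ c c' : K, E 0 0 v = c • v → E 2 2 v = c' • v →
      ∃ p q : ℕ, c = lam 0 - p ∧ c' = lam 2 + q := by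
    intro v hv hv0 c c' h h'
    obtain ⟨p, hp⟩ := eigenvalue_of_mem_iSup
      (lowerSpan_le_eigenspaces_first hE ha (hM hv)) hv0 h
    obtain ⟨q, hq⟩ := eigenvalue_of_mem_iSup
      (lowerSpan_le_eigenspaces_last hE ha (hM hv)) hv0 h'
    exact ⟨p, q, hp, hq⟩
  -- `p + q` is the depth of a weight vector of `M` below `a`; a vector of least depth will turn out
  -- to be highest.
  let W : ℕ → Prop := fun r => ∃ p q : ℕ, p + q = r ∧ ∃ v ∈ M, v ≠ 0 ∧
    E 0 0 v = (lam 0 - p) • v ∧ E 2 2 v = (lam 2 + q) • v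
  have hW : ∃ r, W r := by
    obtain ⟨p, v, hv, hv0, hpv⟩ := exists_eigenvector_mem (fun k : ℕ => lam 0 - k)
      (hst 0 0) hne (hM.trans (lowerSpan_le_eigenspaces_first hE ha))
    obtain ⟨q, w, hw, hw0, hqw⟩ := exists_eigenvector_mem
      (M := M ⊓ (E 0 0).eigenspace (lam 0 - p)) (T := E 2 2) (fun k : ℕ => lam 2 + k)
      (fun w hw => ⟨hst 2 2 w hw.1, by
        change E 2 2 w ∈ (E 0 0).eigenspace (lam 0 - p)
        rw [Module.End.mem_eigenspace_iff, hE 0 0 2 2 w, Module.End.mem_eigenspace_iff.1 hw.2]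
        simp⟩)
      (fun h => hv0 (by
        rw [← Submodule.mem_bot K, ← h]
        exact ⟨hv, Module.End.mem_eigenspace_iff.2 hpv⟩))
      (inf_le_left.trans (hM.trans (lowerSpan_le_eigenspaces_last hE ha)))
    exact ⟨p + q, p, q, rfl, w, hw.1, hw0, Module.End.mem_eigenspace_iff.1 hw.2, hqw⟩
  obtain ⟨p, q, hpq, b, hb, hb0, hbp, hbq⟩ := Nat.find_spec hW
  have hmin : ∀ p' q' : ℕ, p' + q' < p + q → ∀ v ∈ M, E 0 0 v = (lam 0 - p') • v →
      E 2 2 v = (lam 2 + q') • v → v = 0 := by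
    intro p' q' h v hv h1 h2
    by_contra hv0
    exact Nat.find_min hW (m := p' + q') (by omega) ⟨p', q', rfl, v, hv, hv0, h1, h2⟩
  -- A raising operator decreases `p` when `i = 0` and `q` when `j = 2`. One of the two always
  -- occurs for `i < j`, so a nonzero image would have smaller depth.
  have kill : ∀ i j, i < j → E i j b = 0 := by
    intro i j hij
    by_contra h0
    have c1 : E 0 0 (E i j b) = (lam 0 - p + if 0 = i then 1 else 0) • E i j b := by
      rw [hE 0 0 i j b, hbp, if_neg (show j ≠ 0 from (lt_of_le_of_lt (Fin.zero_le i) hij).ne')]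
      split_ifs with hi
      · subst hi
        rw [map_smul]
        module
      · rw [map_smul]
        module
    have c2 : E 2 2 (E i j b) = (lam 2 + q - if j = 2 then 1 else 0) • E i j b := by
      rw [hE 2 2 i j b, hbq, if_neg (show 2 ≠ i from (lt_of_lt_of_le hij (Fin.le_last j)).ne')]
      split_ifs with hj
      · subst hj
        rw [map_smul]
        module
      · rw [map_smul]
        module
    obtain ⟨p', q', hp', hq'⟩ := wt _ (hst i j b hb) h0 _ _ c1 c2
    rw [hp'] at c1
    rw [hq'] at c2
    refine h0 (hmin p' q' ?_ _ (hst i j b hb) c1 c2)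
    have e1 : p = p' + if 0 = i then 1 else 0 := by
      have : (p : K) = p' + if 0 = i then 1 else 0 := by linear_combination -hp'
      split_ifs at this ⊢ <;> exact_mod_cast this
    have e2 : q = q' + if j = 2 then 1 else 0 := by
      have : (q : K) = q' + if j = 2 then 1 else 0 := by linear_combination hq'
      split_ifs at this ⊢ <;> exact_mod_cast this
    have : 0 = i ∨ j = 2 := by
      revert hij
      fin_cases i <;> fin_cases j <;> decide
    rcases this with h | h
    · rw [if_pos h] at e1; omega
    · rw [if_pos h] at e2; omega
  have hb1 : E 1 1 b = (lam 1 + p - q) • b := by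
    have := sum_diag_of_mem_lowerSpan hE ha (hM hb)
    rw [hbp, hbq] at this
    have e : E 1 1 b = (lam 0 + lam 1 + lam 2) • b - (lam 0 - (p : K)) • b
        - (lam 2 + (q : K)) • b := by
      rw [← this]; abel
    rw [e]
    module
  have hbh : IsHighest E ![lam 0 - p, lam 1 + p - q, lam 2 + q] b := by
    refine ⟨kill, fun i => ?_⟩
    fin_cases i
    · simpa using hbp
    · simpa using hb1
    · simpa using hbq
  obtain ⟨m₁, hm₁⟩ := exists_nat_weight_sub hE (i := 0) (j := 1) (by decide) hb0
    (kill 0 1 (by decide)) hbp hb1 (exists_pow_apply_eq_zero hE (Or.inl rfl) hn1 (hM hb))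
  obtain ⟨m₂, hm₂⟩ := exists_nat_weight_sub hE (i := 1) (j := 2) (by decide) hb0
    (kill 1 2 (by decide)) hb1 hbq (exists_pow_apply_eq_zero hE (Or.inr rfl) hn2 (hM hb))
  have hC := (casimirOp_of_mem_lowerSpan hE ha (hM hb)).symm.trans (casimirOp_highest hE hbh)
  have hC' := smul_left_injective K hb0 hC
  simp only [Matrix.cons_val_zero, Matrix.cons_val_one, Matrix.cons_val] at hC'
  -- The difference of the two Casimir scalars, rewritten through the integral weights of `a` and
  -- `b`. All summands are natural numbers and the factors in brackets are positive.
  have hz : ((p * (d₁ + m₁ + 2) + q * (d₂ + m₂ + 2) : ℕ) : K) = 0 := by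
    push_cast
    rw [← h01, ← h12, ← hm₁, ← hm₂]
    linear_combination hC'
  have hz' : p * (d₁ + m₁ + 2) + q * (d₂ + m₂ + 2) = 0 := by exact_mod_cast hz
  have hp : p = 0 := by
    rcases Nat.eq_zero_or_pos p with h | h
    · exact h
    · have := Nat.mul_pos h (show 0 < d₁ + m₁ + 2 by omega); omega
  have hq : q = 0 := by
    rcases Nat.eq_zero_or_pos q with h | h
    · exact h
    · have := Nat.mul_pos h (show 0 < d₂ + m₂ + 2 by omega); omega
  subst hp hq
  obtain ⟨c, hc⟩ := Submodule.mem_span_singleton.1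
    (mem_span_of_weight_eq hE ha (hM hb) (by simpa using hbp) (by simpa using hbq))
  have hc0 : c ≠ 0 := by
    rintro rfl
    exact hb0 (by rw [← hc, zero_smul])
  have : a = c⁻¹ • b := by rw [← hc, smul_smul, inv_mul_cancel₀ hc0, one_smul]
  rw [this]
  exact M.smul_mem _ hb

end HighestWeight

/-! ### Trace-free matrix units and the action of `sl_3` -/

section UnitOps

variable {K : Type*} [Field K]

variable (K) in
/-- The trace-free part of the matrix unit `E_{ij}`. -/
def slUnit (i j : Fin 3) : Matrix (Fin 3) (Fin 3) K :=
  Matrix.single i j 1 - if i = j then (1 / 3 : K) • 1 else 0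

theorem slUnit_of_ne {i j : Fin 3} (h : i ≠ j) : slUnit K i j = Matrix.single i j 1 := by
  simp [slUnit, h]

theorem slUnit_lie (i j k l : Fin 3) : ⁅slUnit K i j, slUnit K k l⁆
    = (if j = k then slUnit K i l else 0) - (if l = i then slUnit K k j else 0) := by
  have h1 : ⁅slUnit K i j, slUnit K k l⁆
      = ⁅(Matrix.single i j 1 : Matrix (Fin 3) (Fin 3) K), Matrix.single k l 1⁆ := by
    simp only [slUnit, Ring.lie_def]
    split_ifs <;> simp only [sub_mul, mul_sub, smul_mul_assoc, mul_smul_comm, one_mul, mul_one,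
      sub_zero] <;> module
  rw [h1, Ring.lie_def]
  by_cases hjk : j = k
  · subst hjk
    by_cases hli : l = i
    · subst hli
      simp [slUnit]
    · simp [hli, Matrix.single_mul_single_of_ne, slUnit_of_ne (Ne.symm hli)]
  · by_cases hli : l = i
    · subst hli
      simp [hjk, Matrix.single_mul_single_of_ne, slUnit_of_ne (Ne.symm hjk)]
    · simp [hjk, hli, Matrix.single_mul_single_of_ne]

theorem trace_slUnit [CharZero K] (i j : Fin 3) : (slUnit K i j).trace = 0 := by
  by_cases h : i = j
  · subst h
    simp [slUnit]
  · simp [slUnit, h, Matrix.trace_single_eq_of_ne]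

theorem eq_sum_slUnit {z : Matrix (Fin 3) (Fin 3) K} (hz : z.trace = 0) :
    z = ∑ i, ∑ j, z i j • slUnit K i j := by
  simp only [slUnit, smul_sub, Finset.sum_sub_distrib]
  have h2 : ∑ i, ∑ j, z i j • (if i = j then (1 / 3 : K) • (1 : Matrix (Fin 3) (Fin 3) K) else 0)
      = 0 := by
    simp only [smul_ite, smul_zero, Finset.sum_ite_eq, Finset.mem_univ, if_true]
    rw [← Finset.sum_smul, show ∑ i, z i i = 0 from hz, zero_smul]
  rw [h2, sub_zero]
  conv_lhs => rw [Matrix.matrix_eq_sum_single z]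
  simp [Matrix.smul_single]

variable (K) in
/-- The operators by which the trace-free parts of the matrix units act. -/
def unitOps (V : Type*) [AddCommGroup V] [Module K V] [LieRingModule (Matrix (Fin 3) (Fin 3) K) V]
    [LieModule K (Matrix (Fin 3) (Fin 3) K) V] (i j : Fin 3) : Module.End K V :=
  LieModule.toEnd K (Matrix (Fin 3) (Fin 3) K) V (slUnit K i j)

variable {V : Type*} [AddCommGroup V] [Module K V] [LieRingModule (Matrix (Fin 3) (Fin 3) K) V]
    [LieModule K (Matrix (Fin 3) (Fin 3) K) V]

theorem matrixUnitRel_unitOps : MatrixUnitRel (unitOps K V) := by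
  intro i j k l v
  change ⁅slUnit K i j, ⁅slUnit K k l, v⁆⁆ = ⁅slUnit K k l, ⁅slUnit K i j, v⁆⁆
    + (if j = k then ⁅slUnit K i l, v⁆ else 0) - (if l = i then ⁅slUnit K k j, v⁆ else 0)
  rw [leibniz_lie, slUnit_lie, sub_lie]
  split_ifs <;> (try simp only [zero_lie]) <;> abel

theorem lie_eq_sum_unitOps {z : Matrix (Fin 3) (Fin 3) K} (hz : z.trace = 0) (v : V) :
    ⁅z, v⁆ = ∑ i, ∑ j, z i j • unitOps K V i j v := by
  conv_lhs => rw [eq_sum_slUnit hz]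
  change LieModule.toEnd K (Matrix (Fin 3) (Fin 3) K) V (∑ i, ∑ j, z i j • slUnit K i j) v = _
  simp only [map_sum, map_smul, LinearMap.sum_apply, LinearMap.smul_apply]
  rfl

end UnitOps

/-! ### Diagonal operators on a product -/

section Product

variable {K : Type*} [Field K] {V W : Type*} [AddCommGroup V] [Module K V] [AddCommGroup W]
  [Module K W]

/-- The diagonal operators on a product. -/
def prodOps (E : Fin 3 → Fin 3 → Module.End K V) (F : Fin 3 → Fin 3 → Module.End K W)
    (i j : Fin 3) : Module.End K (V × W) := (E i j).prodMap (F i j)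

theorem MatrixUnitRel.prod {E : Fin 3 → Fin 3 → Module.End K V}
    {F : Fin 3 → Fin 3 → Module.End K W} (hE : MatrixUnitRel E) (hF : MatrixUnitRel F) :
    MatrixUnitRel (prodOps E F) := by
  rintro i j k l ⟨v, w⟩
  simp only [prodOps, LinearMap.prodMap_apply, hE i j k l v, hF i j k l w]
  split_ifs <;> simp

theorem prodOps_pow (E : Fin 3 → Fin 3 → Module.End K V) (F : Fin 3 → Fin 3 → Module.End K W)
    (i j : Fin 3) (k : ℕ) (v : V) (w : W) :
    (prodOps E F i j ^ k) (v, w) = ((E i j ^ k) v, (F i j ^ k) w) := by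
  induction k with
  | zero => rfl
  | succ k ih =>
    rw [pow_succ', Module.End.mul_apply, ih, pow_succ', pow_succ']
    rfl

end Product

/-! ### Monomials of `K[X, U]` and their generation by lowering -/

section XU

variable {K : Type*} [Field K]

variable (K) in
/-- The monomial `u₁^a u₂^b u₃^c x₁^d x₂^e x₃^f`. -/
def mon (a b c d e f : ℕ) : XURing K :=
  X (Sum.inr 0) ^ a * X (Sum.inr 1) ^ b * X (Sum.inr 2) ^ c
    * (X (Sum.inl 0) ^ d * X (Sum.inl 1) ^ e * X (Sum.inl 2) ^ f)

variable (K) in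
/-- The invariant `x₁u₁ + x₂u₂ + x₃u₃`. -/
def pairing : XURing K := ∑ i : Fin 3, X (Sum.inl i) * X (Sum.inr i)

theorem xuDer_pairing (z : Matrix (Fin 3) (Fin 3) K) : xuDer K z (pairing K) = 0 := by
  simp only [pairing, Fin.sum_univ_three, map_add, Derivation.leibniz, xuDer, mkDerivation_X,
    Sum.elim_inl, Sum.elim_inr, smul_eq_mul, MvPolynomial.smul_eq_C_mul]
  ring

theorem xuDer_pairing_mul (z : Matrix (Fin 3) (Fin 3) K) (f : XURing K) :
    xuDer K z (pairing K * f) = pairing K * xuDer K z f := by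
  rw [Derivation.leibniz, xuDer_pairing, smul_zero, add_zero, smul_eq_mul]

theorem unitOps_xu_apply (i j : Fin 3) (f : XURing K) :
    unitOps K (XURing K) i j f = xuDer K (slUnit K i j) f := rfl

theorem pairing_mul_mon (a b c d e f : ℕ) : pairing K * mon K a b c d e f =
    mon K (a + 1) b c (d + 1) e f + mon K a (b + 1) c d (e + 1) f
      + mon K a b (c + 1) d e (f + 1) := by
  simp only [pairing, mon, Fin.sum_univ_three]
  ring

theorem unitOps_mon_one_zero (a b c d e f : ℕ) : unitOps K (XURing K) 1 0 (mon K a b c d e f)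
    = (a : K) • mon K (a - 1) (b + 1) c d e f - (e : K) • mon K a b c (d + 1) (e - 1) f := by
  rw [unitOps_xu_apply, slUnit_of_ne (by decide)]
  simp [mon, Derivation.leibniz, Derivation.leibniz_pow, xuDer, mkDerivation_X,
    Fin.sum_univ_three, MvPolynomial.smul_eq_C_mul]
  ring

theorem unitOps_mon_two_one (a b c d e f : ℕ) : unitOps K (XURing K) 2 1 (mon K a b c d e f)
    = (b : K) • mon K a (b - 1) (c + 1) d e f - (f : K) • mon K a b c d (e + 1) (f - 1) := by
  rw [unitOps_xu_apply, slUnit_of_ne (by decide)]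
  simp [mon, Derivation.leibniz, Derivation.leibniz_pow, xuDer, mkDerivation_X,
    Fin.sum_univ_three, MvPolynomial.smul_eq_C_mul]
  ring

theorem unitOps_mon_two_zero (a b c d e f : ℕ) : unitOps K (XURing K) 2 0 (mon K a b c d e f)
    = (a : K) • mon K (a - 1) b (c + 1) d e f - (f : K) • mon K a b c (d + 1) e (f - 1) := by
  rw [unitOps_xu_apply, slUnit_of_ne (by decide)]
  simp [mon, Derivation.leibniz, Derivation.leibniz_pow, xuDer, mkDerivation_X,
    Fin.sum_univ_three, MvPolynomial.smul_eq_C_mul]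
  ring

variable (K) in
/-- The weight of `u₁^a x₃^f`. -/
def monWeight (a f : ℕ) (i : Fin 3) : K :=
  a * ((if i = 0 then 1 else 0) - 1 / 3) - f * ((if i = 2 then 1 else 0) - 1 / 3)

theorem unitOps_mon_highest {i j : Fin 3} (hij : i ≤ j) (a f : ℕ) :
    unitOps K (XURing K) i j (mon K a 0 0 0 0 f)
      = (if i = j then monWeight K a f i else 0) • mon K a 0 0 0 0 f := by
  have hu : xuDer K (slUnit K i j) (X (Sum.inr 0))
      = (if i = j then (if i = 0 then 1 else 0) - 1 / 3 else 0 : K) • X (Sum.inr 0) := by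
    fin_cases i <;> fin_cases j <;> simp at hij <;>
      simp [xuDer, mkDerivation_X, slUnit, Fin.sum_univ_three]
  have hx : xuDer K (slUnit K i j) (X (Sum.inl 2))
      = (if i = j then -((if i = 2 then 1 else 0) - 1 / 3) else 0 : K) • X (Sum.inl 2) := by
    fin_cases i <;> fin_cases j <;> simp at hij <;>
      simp [xuDer, mkDerivation_X, slUnit, Fin.sum_univ_three] <;> module
  have hpow : ∀ (D : Derivation K (XURing K) (XURing K)) (v : XURing K) (c : K) (k : ℕ),
      D v = c • v → D (v ^ k) = (k * c) • v ^ k := by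
    intro D v c k hv
    rcases k with _ | k
    · simp
    · rw [Derivation.leibniz_pow, hv, Nat.add_sub_cancel, smul_eq_mul, mul_smul_comm, ← pow_succ,
        ← Nat.cast_smul_eq_nsmul K, smul_smul]
  have hm : mon K a 0 0 0 0 f = X (Sum.inr 0) ^ a * X (Sum.inl 2) ^ f := by simp [mon]
  rw [unitOps_xu_apply, hm, Derivation.leibniz, hpow _ _ _ a hu, hpow _ _ _ f hx, smul_eq_mul,
    smul_eq_mul, mul_smul_comm, mul_smul_comm, mul_comm (X (Sum.inl 2) ^ f), ← add_smul]
  congr 1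
  by_cases h : i = j
  · simp only [if_pos h, monWeight]
    ring
  · simp [h]

/-- Multiplication by the invariant `∑ xᵢuᵢ` commutes with the action, so it preserves highest
vectors and their weights. -/
theorem isHighest_pairing_mul_mon (s a f : ℕ) :
    IsHighest (unitOps K (XURing K))
    (monWeight K a f : Fin 3 → K) (pairing K ^ s * mon K a 0 0 0 0 f) := by
  have h : ∀ i j, i ≤ j → unitOps K (XURing K) i j (pairing K ^ s * mon K a 0 0 0 0 f)
      = (if i = j then monWeight K a f i else 0) • (pairing K ^ s * mon K a 0 0 0 0 f) := by
    intro i j hij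
    induction s with
    | zero => simpa using unitOps_mon_highest (K := K) hij a f
    | succ s ih =>
      rw [pow_succ', mul_assoc, unitOps_xu_apply, xuDer_pairing_mul, ← unitOps_xu_apply, ih,
        mul_smul_comm]
  exact ⟨fun i j hij => by simpa [hij.ne] using h i j hij.le, fun i => by simpa using h i i le_rfl⟩

variable {P : Submodule K (XURing K)}

/-- Given all multiples of the pairing, the relation `x₁u₁ + x₂u₂ + x₃u₃ ≡ 0` is available for
rewriting. Monomials are then reached in three stages: those in `u₁, u₂, x₃`, then those without
`u₃`, then the rest. -/
theorem mon_mem_of_mul_pairing_mem [CharZero K] {d₁ d₂ : ℕ}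
    (hP : ∀ i j, j < i → ∀ v ∈ P, unitOps K (XURing K) i j v ∈ P)
    (hw : mon K d₁ 0 0 0 0 d₂ ∈ P)
    (hq : ∀ a b c d e f, a + b + c + 1 = d₁ → d + e + f + 1 = d₂ →
      pairing K * mon K a b c d e f ∈ P) :
    ∀ a b c d e f, a + b + c = d₁ → d + e + f = d₂ → mon K a b c d e f ∈ P := by
  have cancel : ∀ {k : ℕ} {v : XURing K}, ((k + 1 : ℕ) : K) • v ∈ P → v ∈ P := fun {k} {v} h =>
    (P.smul_mem_iff (by exact_mod_cast k.succ_ne_zero)).1 h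
  have s0 : ∀ b a, a + b = d₁ → mon K a b 0 0 0 d₂ ∈ P := by
    intro b
    induction b with
    | zero =>
      rintro a rfl
      exact hw
    | succ b ih =>
      intro a hab
      have h := hP 1 0 (by decide) _ (ih (a + 1) (by omega))
      rw [unitOps_mon_one_zero] at h
      simp only [Nat.cast_zero, zero_smul, sub_zero, Nat.add_sub_cancel] at h
      exact cancel h
  have s1 : ∀ t a b d e f, d + e = t → a + b = d₁ → d + e + f = d₂ → mon K a b 0 d e f ∈ P := by
    intro t
    induction t with
    | zero =>
      intro a b d e f hde hab hf
      obtain ⟨rfl, rfl⟩ : d = 0 ∧ e = 0 := by omega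
      obtain rfl : f = d₂ := by omega
      exact s0 b a hab
    | succ t ih =>
      have h31 : ∀ a b d e f, d + e = t → a + b = d₁ → d + e + (f + 1) = d₂ →
          (a : K) • mon K (a - 1) b 1 d e (f + 1)
            - ((f + 1 : ℕ) : K) • mon K a b 0 (d + 1) e f ∈ P := by
        intro a b d e f hde hab hf
        have h := hP 2 0 (by decide) _ (ih a b d e (f + 1) hde hab hf)
        rwa [unitOps_mon_two_zero] at h
      have h32 : ∀ a b d e f, d + e = t → a + b = d₁ → d + e + (f + 1) = d₂ →
          (b : K) • mon K a (b - 1) 1 d e (f + 1)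
            - ((f + 1 : ℕ) : K) • mon K a b 0 d (e + 1) f ∈ P := by
        intro a b d e f hde hab hf
        have h := hP 2 1 (by decide) _ (ih a b d e (f + 1) hde hab hf)
        rwa [unitOps_mon_two_one] at h
      -- Lowering by `E₃₁` and by `E₃₂`, plus `f + 1` times the pairing relation, leaves this
      -- monomial alone with coefficient `(a + 1) + (b + 1) + (f + 1)`. It is nonzero in
      -- characteristic `0`.
      have hY : ∀ a b d e f, d + e = t → a + b + 1 = d₁ → d + e + (f + 1) = d₂ →
          mon K a b 1 d e (f + 1) ∈ P := by
        intro a b d e f hde hab hf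
        have r1 := h31 (a + 1) b d e f hde (by omega) hf
        have r2 := h32 a (b + 1) d e f hde (by omega) hf
        have r3 := hq a b 0 d e f (by omega) (by omega)
        rw [pairing_mul_mon] at r3
        simp only [Nat.add_sub_cancel, zero_add] at r1 r2 r3
        apply cancel (k := a + b + f + 2)
        have := add_mem (add_mem r1 r2) (P.smul_mem ((f + 1 : ℕ) : K) r3)
        convert this using 1
        push_cast
        module
      intro a b d e f hde hab hf
      rcases d with _ | d
      · obtain ⟨e, rfl⟩ : ∃ e', e = e' + 1 := ⟨t, by omega⟩
        have h := h32 a b 0 e f (by omega) hab (by omega)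
        apply cancel (k := f)
        rcases b with _ | b
        · simpa using h
        · have := hY a b 0 e f (by omega) (by omega) (by omega)
          exact (P.sub_mem_iff_right (P.smul_mem _ this)).1 h
      · have h := h31 a b d e f (by omega) hab (by omega)
        apply cancel (k := f)
        rcases a with _ | a
        · simpa using h
        · have := hY a b d e f (by omega) (by omega) (by omega)
          exact (P.sub_mem_iff_right (P.smul_mem _ this)).1 h
  -- Each further factor `u₃` comes from `E₃₁` when `x₃` is absent, and otherwise from the pairing
  -- relation, which trades `x₃u₃` for terms with fewer `u₃`.
  intro a b c
  induction c generalizing a b with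
  | zero => exact fun d e f h1 h2 => s1 _ a b d e f rfl h1 h2
  | succ c ih =>
    intro d e f h1 h2
    rcases f with _ | f
    · have h := hP 2 0 (by decide) _ (ih (a + 1) b d e 0 (by omega) h2)
      rw [unitOps_mon_two_zero] at h
      simp only [Nat.cast_zero, zero_smul, sub_zero, Nat.add_sub_cancel] at h
      exact cancel h
    · have h := hq a b c d e f (by omega) (by omega)
      rw [pairing_mul_mon] at h
      exact (P.add_mem_iff_right (add_mem (ih (a + 1) b (d + 1) e f (by omega) (by omega))
        (ih a (b + 1) d (e + 1) f (by omega) (by omega)))).1 h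

/-- The lowering operators generate all monomials of bidegree `(d₁, d₂)` from the vectors
`(x₁u₁ + x₂u₂ + x₃u₃)^s u₁^{d₁-s} x₃^{d₂-s}`. -/
theorem mon_mem_of_highest_mem [CharZero K] (d₁ d₂ : ℕ) :
    ∀ {P : Submodule K (XURing K)},
      (∀ i j, j < i → ∀ v ∈ P, unitOps K (XURing K) i j v ∈ P) →
      (∀ s, s ≤ min d₁ d₂ → pairing K ^ s * mon K (d₁ - s) 0 0 0 0 (d₂ - s) ∈ P) →
      ∀ a b c d e f, a + b + c = d₁ → d + e + f = d₂ → mon K a b c d e f ∈ P := by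
  induction d₁ generalizing d₂ with
  | zero =>
    intro P hP h
    refine mon_mem_of_mul_pairing_mem hP (by simpa using h 0 (Nat.zero_le _)) ?_
    intros
    omega
  | succ d₁ ih =>
    intro P hP h
    refine mon_mem_of_mul_pairing_mem hP (by simpa using h 0 (Nat.zero_le _)) ?_
    intro a b c d e f h1 h2
    obtain ⟨d₂, rfl⟩ : ∃ k, d₂ = k + 1 := ⟨d + e + f, h2.symm⟩
    -- The preimage of `P` under multiplication by the pairing satisfies the same hypotheses in
    -- bidegree `(d₁ - 1, d₂ - 1)`, with `s` shifted by one.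
    rw [← LinearMap.mulLeft_apply (R := K), ← Submodule.mem_comap]
    refine ih d₂ ?_ ?_ a b c d e f (by omega) (by omega)
    · intro i j hij v hv
      rw [Submodule.mem_comap, LinearMap.mulLeft_apply] at hv ⊢
      have h' := hP i j hij _ hv
      rwa [unitOps_xu_apply, xuDer_pairing_mul] at h'
    · intro s hs
      have h' := h (s + 1) (by omega)
      rw [Submodule.mem_comap, LinearMap.mulLeft_apply]
      rwa [pow_succ', mul_assoc, Nat.add_sub_add_right, Nat.add_sub_add_right] at h'

end XU

/-! ### Lowering spans under equivariant maps and products -/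

section LowerSpan

variable {K : Type*} [Field K] {V V' : Type*} [AddCommGroup V] [Module K V] [AddCommGroup V']
  [Module K V'] {E : Fin 3 → Fin 3 → Module.End K V} {E' : Fin 3 → Fin 3 → Module.End K V'}

theorem map_lowerSpan (π : V →ₗ[K] V') (h : ∀ i j v, π (E i j v) = E' i j (π v)) (s : Set V) :
    (lowerSpan E s).map π = lowerSpan E' (π '' s) := by
  apply le_antisymm
  · rw [Submodule.map_le_iff_le_comap]
    refine lowerSpan_le ?_ ?_
    · exact fun v hv => subset_lowerSpan _ ⟨v, hv, rfl⟩
    · intro i j hij v hv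
      rw [Submodule.mem_comap] at hv ⊢
      rw [h]
      exact lower_mem_lowerSpan hij hv
  · refine lowerSpan_le ?_ ?_
    · rintro _ ⟨v, hv, rfl⟩
      exact ⟨v, subset_lowerSpan s hv, rfl⟩
    · rintro i j hij _ ⟨v, hv, rfl⟩
      exact ⟨E i j v, lower_mem_lowerSpan hij hv, h i j v⟩

theorem IsHighest.prod {lam : Fin 3 → K} {a : V} {a' : V'} (h : IsHighest E lam a)
    (h' : IsHighest E' lam a') : IsHighest (prodOps E E') lam (a, a') where
  upper i j hij := by simp [prodOps, h.upper i j hij, h'.upper i j hij]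
  diag i := by simp [prodOps, h.diag, h'.diag]

theorem isHighest_zero (lam : Fin 3 → K) : IsHighest E lam 0 where
  upper i j _ := map_zero _
  diag i := by simp

end LowerSpan

/-! ### Irreducibility and isomorphism of highest weight modules -/

section LieSubmodules

variable {K : Type*} [Field K]

theorem mem_sl3 {z : Matrix (Fin 3) (Fin 3) K} : z ∈ sl3 K ↔ z.trace = 0 := Iff.rfl

variable [CharZero K] {V : Type*} [AddCommGroup V] [Module K V]
  [LieRingModule (Matrix (Fin 3) (Fin 3) K) V] [LieModule K (Matrix (Fin 3) (Fin 3) K) V]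

theorem slUnit_mem_sl3 (i j : Fin 3) : slUnit K i j ∈ sl3 K := mem_sl3.2 (trace_slUnit i j)

/-- A subspace stable under the trace-free parts of the matrix units, as an `sl_3`-submodule. -/
def stableLieSubmodule (P : Submodule K V) (h : ∀ i j, ∀ v ∈ P, unitOps K V i j v ∈ P) :
    LieSubmodule K (sl3 K) V where
  toSubmodule := P
  lie_mem {z v} hv := by
    change ⁅(z : Matrix (Fin 3) (Fin 3) K), v⁆ ∈ P
    rw [lie_eq_sum_unitOps (mem_sl3.1 z.2)]
    exact sum_mem fun i _ => sum_mem fun j _ => P.smul_mem _ (h i j v hv)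

theorem lowerSpan_le_lieSpan (s : Set V) :
    lowerSpan (unitOps K V) s ≤ (LieSubmodule.lieSpan K (sl3 K) s).toSubmodule := by
  refine lowerSpan_le LieSubmodule.subset_lieSpan ?_
  intro i j _ v hv
  exact LieSubmodule.lie_mem (x := (⟨slUnit K i j, slUnit_mem_sl3 i j⟩ : sl3 K)) _ hv

theorem lieSpan_eq_lowerSpan {lam : Fin 3 → K} {a : V} (ha : IsHighest (unitOps K V) lam a) :
    (LieSubmodule.lieSpan K (sl3 K) {a}).toSubmodule = lowerSpan (unitOps K V) {a} := by
  apply le_antisymm _ (lowerSpan_le_lieSpan {a})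
  have h : LieSubmodule.lieSpan K (sl3 K) {a} ≤ stableLieSubmodule (lowerSpan (unitOps K V) {a})
      (fun i j _ hv => stable_lowerSpan matrixUnitRel_unitOps (by simpa using ⟨lam, ha⟩) i j hv) :=
    LieSubmodule.lieSpan_le.2 (subset_lowerSpan (E := unitOps K V) {a})
  exact h

theorem isIrreducible_of_highest {lam : Fin 3 → K} {a : V} (ha0 : a ≠ 0)
    (ha : IsHighest (unitOps K V) lam a) {d₁ d₂ : ℕ} (h01 : lam 0 - lam 1 = d₁)
    (h12 : lam 1 - lam 2 = d₂) (hn1 : ∃ k, (unitOps K V 1 0 ^ k) a = 0)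
    (hn2 : ∃ k, (unitOps K V 2 1 ^ k) a = 0) (N : LieSubmodule K (sl3 K) V)
    (hN : N.toSubmodule = lowerSpan (unitOps K V) {a}) : LieModule.IsIrreducible K (sl3 K) N := by
  have haN : a ∈ N := by
    rw [← LieSubmodule.mem_toSubmodule, hN]
    exact subset_lowerSpan _ rfl
  have : Nontrivial N := ⟨⟨⟨a, haN⟩, 0, fun h => ha0 (congrArg Subtype.val h)⟩⟩
  refine LieModule.IsIrreducible.mk fun M hM => ?_
  have hmem : a ∈ M.toSubmodule.map N.toSubmodule.subtype := by
    refine highest_mem_of_stable matrixUnitRel_unitOps ha h01 h12 hn1 hn2 ?_ ?_ ?_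
    · rw [← hN]
      exact Submodule.map_subtype_le _ _
    · rintro i j _ ⟨v, hv, rfl⟩
      exact ⟨_, M.lie_mem (x := ⟨slUnit K i j, slUnit_mem_sl3 i j⟩) hv, rfl⟩
    · intro h
      rw [← Submodule.map_bot N.toSubmodule.subtype] at h
      exact hM ((LieSubmodule.toSubmodule_eq_bot M).1
        (Submodule.map_injective_of_injective N.toSubmodule.injective_subtype h))
  obtain ⟨a', ha', h'⟩ := hmem
  have key : lowerSpan (unitOps K V) {a} ≤ M.toSubmodule.map N.toSubmodule.subtype := by
    refine lowerSpan_le ?_ ?_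
    · rintro _ rfl
      exact ⟨a', ha', h'⟩
    · rintro i j _ _ ⟨v, hv, rfl⟩
      exact ⟨_, M.lie_mem (x := ⟨slUnit K i j, slUnit_mem_sl3 i j⟩) hv, rfl⟩
  rw [eq_top_iff]
  rintro ⟨v, hv⟩ -
  have hv' : v ∈ lowerSpan (unitOps K V) {a} := by
    rw [← hN]
    exact hv
  obtain ⟨u, hu, rfl⟩ := key hv'
  exact hu

variable {V' : Type*} [AddCommGroup V'] [Module K V']
  [LieRingModule (Matrix (Fin 3) (Fin 3) K) V'] [LieModule K (Matrix (Fin 3) (Fin 3) K) V']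

/-- The pair of highest vectors is a highest vector of the product, so it generates an irreducible
module. A stable subspace that misses the generator meets this module only in zero. -/
theorem mem_lowerSpan_prod_of_stable {lam : Fin 3 → K} {a : V} {a' : V'}
    (ha : IsHighest (unitOps K V) lam a) (ha' : IsHighest (unitOps K V') lam a') {d₁ d₂ : ℕ}
    (h01 : lam 0 - lam 1 = d₁) (h12 : lam 1 - lam 2 = d₂)
    (hn1 : ∃ k, (unitOps K V 1 0 ^ k) a = 0) (hn2 : ∃ k, (unitOps K V 2 1 ^ k) a = 0)
    (hn1' : ∃ k, (unitOps K V' 1 0 ^ k) a' = 0) (hn2' : ∃ k, (unitOps K V' 2 1 ^ k) a' = 0)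
    {Q : Submodule K (V × V')}
    (hQ : ∀ i j, ∀ v ∈ Q, prodOps (unitOps K V) (unitOps K V') i j v ∈ Q)
    (haQ : (a, a') ∉ Q) {v : V × V'}
    (hv : v ∈ lowerSpan (prodOps (unitOps K V) (unitOps K V')) {(a, a')}) (hvQ : v ∈ Q) :
    v = 0 := by
  have hrel : MatrixUnitRel (prodOps (unitOps K V) (unitOps K V')) :=
    matrixUnitRel_unitOps.prod matrixUnitRel_unitOps
  have nil : ∀ i j, (∃ k, (unitOps K V i j ^ k) a = 0) → (∃ k, (unitOps K V' i j ^ k) a' = 0) →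
      ∃ k, (prodOps (unitOps K V) (unitOps K V') i j ^ k) (a, a') = 0 := by
    rintro i j ⟨k, hk⟩ ⟨l, hl⟩
    refine ⟨k + l, ?_⟩
    rw [prodOps_pow, pow_add (unitOps K V' i j), Module.End.mul_apply, hl, add_comm, pow_add,
      Module.End.mul_apply, hk]
    simp
  by_contra hv0
  refine haQ (highest_mem_of_stable hrel (ha.prod ha') h01 h12 (nil 1 0 hn1 hn1')
    (nil 2 1 hn2 hn2') (M := lowerSpan _ _ ⊓ Q) inf_le_left ?_ ?_).2
  · rintro i j v ⟨h1, h2⟩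
    exact ⟨stable_lowerSpan hrel (by simpa using ⟨lam, ha.prod ha'⟩) i j h1, hQ i j v h2⟩
  · intro h
    exact hv0 ((Submodule.mem_bot K).1 (h ▸ ⟨hv, hvQ⟩))

/-- Highest weight modules of the same dominant weight are isomorphic. -/
theorem nonempty_equiv_of_highest {lam : Fin 3 → K} {a : V} {a' : V'} (ha0 : a ≠ 0)
    (ha0' : a' ≠ 0)
    (ha : IsHighest (unitOps K V) lam a) (ha' : IsHighest (unitOps K V') lam a') {d₁ d₂ : ℕ}
    (h01 : lam 0 - lam 1 = d₁) (h12 : lam 1 - lam 2 = d₂)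
    (hn1 : ∃ k, (unitOps K V 1 0 ^ k) a = 0) (hn2 : ∃ k, (unitOps K V 2 1 ^ k) a = 0)
    (hn1' : ∃ k, (unitOps K V' 1 0 ^ k) a' = 0) (hn2' : ∃ k, (unitOps K V' 2 1 ^ k) a' = 0)
    (N : LieSubmodule K (sl3 K) V) (hN : N.toSubmodule = lowerSpan (unitOps K V) {a})
    (N' : LieSubmodule K (sl3 K) V') (hN' : N'.toSubmodule = lowerSpan (unitOps K V') {a'}) :
    Nonempty (N ≃ₗ⁅K, sl3 K⁆ N') := by
  -- The graph of the isomorphism. It projects onto both modules, and the kernels of the projections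
  -- are stable and miss `(a, a')`.
  let P := lowerSpan (prodOps (unitOps K V) (unitOps K V')) {(a, a')}
  have hP : ∀ i j, ∀ v ∈ P, prodOps (unitOps K V) (unitOps K V') i j v ∈ P := fun i j v hv =>
    stable_lowerSpan (matrixUnitRel_unitOps.prod matrixUnitRel_unitOps)
      (by simpa using ⟨lam, ha.prod ha'⟩) i j hv
  have hlie : ∀ z : sl3 K, ∀ v ∈ P, (⁅z, v.1⁆, ⁅z, v.2⁆) ∈ P := by
    intro z v hv
    have e : (⁅z, v.1⁆, ⁅z, v.2⁆)
        = ∑ i, ∑ j, z.1 i j • prodOps (unitOps K V) (unitOps K V') i j v := by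
      change (⁅(z : Matrix (Fin 3) (Fin 3) K), v.1⁆, ⁅(z : Matrix (Fin 3) (Fin 3) K), v.2⁆) = _
      rw [lie_eq_sum_unitOps (mem_sl3.1 z.2), lie_eq_sum_unitOps (mem_sl3.1 z.2)]
      simp [Prod.ext_iff, Prod.fst_sum, Prod.snd_sum, prodOps]
    rw [e]
    exact sum_mem fun i _ => sum_mem fun j _ => P.smul_mem _ (hP i j v hv)
  have hfst : P.map (LinearMap.fst K V V') = N.toSubmodule := by
    rw [hN, map_lowerSpan (E' := unitOps K V) _ (fun _ _ _ => rfl)]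
    simp
  have hsnd : P.map (LinearMap.snd K V V') = N'.toSubmodule := by
    rw [hN', map_lowerSpan (E' := unitOps K V') _ (fun _ _ _ => rfl)]
    simp
  have inj1 : ∀ v ∈ P, v.1 = 0 → v = 0 := by
    intro v hv h
    refine mem_lowerSpan_prod_of_stable ha ha' h01 h12 hn1 hn2 hn1' hn2'
      (Q := LinearMap.ker (LinearMap.fst K V V')) ?_ (by simpa using ha0) hv (by simpa using h)
    intro i j v hv
    simp only [LinearMap.mem_ker, LinearMap.fst_apply] at hv ⊢
    simp [prodOps, hv]
  have inj2 : ∀ v ∈ P, v.2 = 0 → v = 0 := by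
    intro v hv h
    refine mem_lowerSpan_prod_of_stable ha ha' h01 h12 hn1 hn2 hn1' hn2'
      (Q := LinearMap.ker (LinearMap.snd K V V')) ?_ (by simpa using ha0') hv (by simpa using h)
    intro i j v hv
    simp only [LinearMap.mem_ker, LinearMap.snd_apply] at hv ⊢
    simp [prodOps, hv]
  let f₁ : P →ₗ[K] N.toSubmodule := ((LinearMap.fst K V V').comp P.subtype).codRestrict _
    fun v => hfst ▸ Submodule.mem_map_of_mem v.2
  let f₂ : P →ₗ[K] N'.toSubmodule := ((LinearMap.snd K V V').comp P.subtype).codRestrict _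
    fun v => hsnd ▸ Submodule.mem_map_of_mem v.2
  have b₁ : Function.Bijective f₁ := by
    constructor
    · rw [← LinearMap.ker_eq_bot, LinearMap.ker_eq_bot']
      exact fun v hv => Subtype.ext (inj1 v v.2 (congrArg Subtype.val hv))
    · rintro ⟨x, hx⟩
      rw [← hfst] at hx
      obtain ⟨v, hv, rfl⟩ := hx
      exact ⟨⟨v, hv⟩, rfl⟩
  have b₂ : Function.Bijective f₂ := by
    constructor
    · rw [← LinearMap.ker_eq_bot, LinearMap.ker_eq_bot']
      exact fun v hv => Subtype.ext (inj2 v v.2 (congrArg Subtype.val hv))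
    · rintro ⟨x, hx⟩
      rw [← hsnd] at hx
      obtain ⟨v, hv, rfl⟩ := hx
      exact ⟨⟨v, hv⟩, rfl⟩
  let e₁ := LinearEquiv.ofBijective f₁ b₁
  let e₂ := LinearEquiv.ofBijective f₂ b₂
  let e : N ≃ₗ[K] N' := e₁.symm.trans e₂
  have he : ∀ x : N, ((x : V), (e x : V')) ∈ P := by
    intro x
    have h := (e₁.symm x).2
    have h1 : (e₁.symm x).1.1 = x := congrArg Subtype.val (e₁.apply_symm_apply x)
    have h2 : (e₁.symm x).1.2 = e x := rfl
    rwa [← h1, ← h2]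
  suffices hz : ∀ (z : sl3 K) (x : N), e ⁅z, x⁆ = ⁅z, e x⁆ from
    ⟨{ e with map_lie' := fun {z x} => hz z x }⟩
  intro z x
  have h1 := he ⁅z, x⁆
  have h2 := hlie z _ (he x)
  -- Two points of the graph with the same first coordinate coincide, which gives equivariance of
  -- `e`.
  have h3 := inj1 _ (sub_mem h1 h2) (sub_self _)
  exact Subtype.ext (sub_eq_zero.1 (congrArg Prod.snd h3))

end LieSubmodules

/-! ### The space `𝔘(DT_3) a` and the weight of `a` -/

section Enveloping

variable {K : Type*} [Field K] {n d₁ d₂ : ℕ} {a : CoordRing K n}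

theorem mem_envelopingSpan {v : CoordRing K n} : v ∈ envelopingSpan a ↔
    ∃ u, UniversalEnvelopingAlgebra.lift K
      (LieModule.toEnd K (DT3 K) (CoordRing K n)) u a = v := Iff.rfl

/-- The endomorphisms that preserve the lowering span form a subalgebra containing the image of
`DT_3`. By uniqueness of the lift, all of `𝔘(DT_3)` acts through this subalgebra. -/
theorem envelopingSpan_eq_lowerSpan (a : CoordRing K n) :
    envelopingSpan a = lowerSpan (unitOps K (CoordRing K n)) {a} := by
  apply le_antisymm
  · let P := lowerSpan (unitOps K (CoordRing K n)) {a}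
    let S : Subalgebra K (Module.End K (CoordRing K n)) :=
      { carrier := {T | ∀ v ∈ P, T v ∈ P}
        mul_mem' := fun hS hT v hv => hS _ (hT v hv)
        add_mem' := fun hS hT v hv => add_mem (hS v hv) (hT v hv)
        algebraMap_mem' := fun c v hv => P.smul_mem c hv }
    have hS : ∀ z : DT3 K, LieModule.toEnd K (DT3 K) (CoordRing K n) z ∈ S := by
      intro z v hv
      have hz : (z : Matrix (Fin 3) (Fin 3) K) = ∑ i, ∑ j,
          if j < i then z.1 i j • slUnit K i j else 0 := by
        conv_lhs => rw [Matrix.matrix_eq_sum_single z.1]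
        refine Finset.sum_congr rfl fun i _ => Finset.sum_congr rfl fun j _ => ?_
        split_ifs with h
        · rw [slUnit_of_ne h.ne', Matrix.smul_single, smul_eq_mul, mul_one]
        · rw [z.2 i j (not_lt.1 h), Matrix.single_zero]
      have e : LieModule.toEnd K (DT3 K) (CoordRing K n) z v = ∑ i, ∑ j,
          if j < i then z.1 i j • unitOps K (CoordRing K n) i j v else 0 := by
        change LieModule.toEnd K (Matrix (Fin 3) (Fin 3) K) (CoordRing K n) z.1 v = _
        rw [hz]
        simp only [map_sum, LinearMap.sum_apply]
        refine Finset.sum_congr rfl fun i _ => Finset.sum_congr rfl fun j _ => ?_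
        rw [← hz]
        split_ifs with h
        · rw [map_smul]
          rfl
        · simp
      rw [e]
      refine sum_mem fun i _ => sum_mem fun j _ => ?_
      split_ifs with h
      · exact P.smul_mem _ (lower_mem_lowerSpan h hv)
      · exact zero_mem _
    let f : DT3 K →ₗ⁅K⁆ S :=
      { toFun := fun z => ⟨LieModule.toEnd K (DT3 K) (CoordRing K n) z, hS z⟩
        map_add' := fun z w => Subtype.ext (map_add _ z w)
        map_smul' := fun c z => Subtype.ext (map_smul _ c z)
        map_lie' := fun {z w} => Subtype.ext (LieHom.map_lie _ z w) }
    have hlift : UniversalEnvelopingAlgebra.lift K (LieModule.toEnd K (DT3 K) (CoordRing K n))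
        = S.val.comp (UniversalEnvelopingAlgebra.lift K f) := by
      refine ((UniversalEnvelopingAlgebra.lift_unique K _ _).1 ?_).symm
      funext z
      change ((UniversalEnvelopingAlgebra.lift K f (UniversalEnvelopingAlgebra.ι K z) : S) :
        Module.End K (CoordRing K n)) = _
      rw [UniversalEnvelopingAlgebra.lift_ι_apply]
      rfl
    intro v hv
    obtain ⟨u, rfl⟩ := mem_envelopingSpan.1 hv
    rw [hlift]
    exact (UniversalEnvelopingAlgebra.lift K f u).2 a (subset_lowerSpan _ rfl)
  · refine lowerSpan_le ?_ ?_
    · rintro _ rfl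
      exact mem_envelopingSpan.2 ⟨1, by rw [map_one]; rfl⟩
    · intro i j hij v hv
      obtain ⟨u, rfl⟩ := mem_envelopingSpan.1 hv
      have hz : slUnit K i j ∈ DT3 K := by
        intro k l hkl
        rw [slUnit_of_ne hij.ne', Matrix.single_apply]
        refine if_neg ?_
        rintro ⟨rfl, rfl⟩
        exact absurd hkl (not_le.2 hij)
      refine mem_envelopingSpan.2 ⟨UniversalEnvelopingAlgebra.ι K ⟨_, hz⟩ * u, ?_⟩
      rw [map_mul, UniversalEnvelopingAlgebra.lift_ι_apply]
      rfl

theorem unitOps_coord_apply (i j : Fin 3) (f : CoordRing K n) :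
    unitOps K (CoordRing K n) i j f = coordDer K n (slUnit K i j) f := rfl

theorem unitOps_one_zero_apply (f : CoordRing K n) :
    unitOps K (CoordRing K n) 1 0 f = hatD₁ f := by
  rw [unitOps_coord_apply, slUnit_of_ne (by decide)]
  rfl

theorem unitOps_two_one_apply (f : CoordRing K n) :
    unitOps K (CoordRing K n) 2 1 f = hatD₂ f := by
  rw [unitOps_coord_apply, slUnit_of_ne (by decide)]
  rfl

theorem unitOps_two_zero_apply (f : CoordRing K n) :
    unitOps K (CoordRing K n) 2 0 f = hatD₃ f := by
  rw [unitOps_coord_apply, slUnit_of_ne (by decide)]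
  rfl

theorem HasOrder.pow_apply (h : HasOrder a d₁ d₂) :
    ((unitOps K (CoordRing K n) 1 0 ^ d₁) a ≠ 0 ∧
      (unitOps K (CoordRing K n) 1 0 ^ (d₁ + 1)) a = 0) ∧
    ((unitOps K (CoordRing K n) 2 1 ^ d₂) a ≠ 0 ∧
      (unitOps K (CoordRing K n) 2 1 ^ (d₂ + 1)) a = 0) := by
  have e1 : (unitOps K (CoordRing K n) 1 0 : CoordRing K n → CoordRing K n) = hatD₁ :=
    funext unitOps_one_zero_apply
  have e2 : (unitOps K (CoordRing K n) 2 1 : CoordRing K n → CoordRing K n) = hatD₂ :=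
    funext unitOps_two_one_apply
  simp only [Module.End.pow_apply, e1, e2]
  refine ⟨⟨h.1.1, ?_⟩, h.2.1, ?_⟩
  · by_contra h'
    exact absurd (h.1.2 h') (by omega)
  · by_contra h'
    exact absurd (h.2.2 h') (by omega)

theorem HasOrder.ne_zero (h : HasOrder a d₁ d₂) : a ≠ 0 := by
  rintro rfl
  exact h.pow_apply.1.1 (map_zero _)

/-- The isobaric eigenvalues are not given as numbers; the sl_2-identity identifies them with the
orders `d₁` and `d₂`. -/
theorem isHighest_of_hasOrder [CharZero K]
    (ha_inv : a ∈ LieModule.maxTrivSubmodule K (UT3 K) (CoordRing K n))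
    (ha_iso : IsIsobaric a) (ha_ord : HasOrder a d₁ d₂) :
    IsHighest (unitOps K (CoordRing K n)) (monWeight K d₁ d₂) a := by
  have up : ∀ i j, i < j → unitOps K (CoordRing K n) i j a = 0 := by
    intro i j hij
    have hz : slUnit K i j ∈ UT3 K := by
      intro k l hkl
      rw [slUnit_of_ne hij.ne, Matrix.single_apply]
      refine if_neg ?_
      rintro ⟨rfl, rfl⟩
      exact absurd hkl (not_le.2 hij)
    exact (LieModule.mem_maxTrivSubmodule K (UT3 K) (CoordRing K n) a).1 ha_inv ⟨_, hz⟩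
  obtain ⟨⟨ω₁, h1⟩, ω₂, h2⟩ := ha_iso
  -- The trace-free diagonal units in the basis `E₁₁ - E₂₂`, `E₂₂ - E₃₃` of the diagonal subalgebra.
  have s0 : slUnit K 0 0 = (2 / 3 : K) • (Matrix.single 0 0 1 - Matrix.single 1 1 1)
      + (1 / 3 : K) • (Matrix.single 1 1 1 - Matrix.single 2 2 1) := by
    ext i j
    fin_cases i <;> fin_cases j <;> simp [slUnit] <;> norm_num
  have s1 : slUnit K 1 1 = (-1 / 3 : K) • (Matrix.single 0 0 1 - Matrix.single 1 1 1)
      + (1 / 3 : K) • (Matrix.single 1 1 1 - Matrix.single 2 2 1) := by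
    ext i j
    fin_cases i <;> fin_cases j <;> simp [slUnit] <;> norm_num
  have s2 : slUnit K 2 2 = (-1 / 3 : K) • (Matrix.single 0 0 1 - Matrix.single 1 1 1)
      + (-2 / 3 : K) • (Matrix.single 1 1 1 - Matrix.single 2 2 1) := by
    ext i j
    fin_cases i <;> fin_cases j <;> simp [slUnit] <;> norm_num
  have w : ∀ (α β : K) (i : Fin 3), slUnit K i i
      = α • (Matrix.single 0 0 1 - Matrix.single 1 1 1)
        + β • (Matrix.single 1 1 1 - Matrix.single 2 2 1) →
      unitOps K (CoordRing K n) i i a = (α * ω₁ + β * ω₂) • a := by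
    intro α β i hi
    rw [unitOps_coord_apply, hi, coordDer_add, coordDer_smul, coordDer_smul, Derivation.add_apply,
      Derivation.smul_apply, Derivation.smul_apply, ← opE₁, ← opE₂, h1, h2]
    module
  have w0 := w _ _ 0 s0
  have w1 := w _ _ 1 s1
  have w2 := w _ _ 2 s2
  have o := ha_ord.pow_apply
  have e1 := weight_sub_eq matrixUnitRel_unitOps (i := 0) (j := 1) (by decide)
    (up 0 1 (by decide)) w0 w1 o.1.1 o.1.2
  have e2 := weight_sub_eq matrixUnitRel_unitOps (i := 1) (j := 2) (by decide)
    (up 1 2 (by decide)) w1 w2 o.2.1 o.2.2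
  have e1' : ω₁ = d₁ := by rw [← e1]; ring
  have e2' : ω₂ = d₂ := by rw [← e2]; ring
  subst e1' e2'
  refine ⟨up, fun i => ?_⟩
  fin_cases i
  · refine w0.trans (congrArg (· • a) ?_)
    simp [monWeight]
    ring
  · refine w1.trans (congrArg (· • a) ?_)
    simp [monWeight]
    ring
  · refine w2.trans (congrArg (· • a) ?_)
    simp [monWeight]
    ring

end Enveloping

/-! ### The highest vector of `Γ_{d₁,d₂}` -/

section HighestMonomial

variable {K : Type*} [Field K]

theorem monWeight_zero_sub_one (a f : ℕ) : monWeight K a f 0 - monWeight K a f 1 = a := by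
  simp [monWeight]
  ring

theorem monWeight_one_sub_two (a f : ℕ) : monWeight K a f 1 - monWeight K a f 2 = f := by
  simp [monWeight]
  ring

theorem isHighest_mon (a f : ℕ) :
    IsHighest (unitOps K (XURing K)) (monWeight K a f) (mon K a 0 0 0 0 f) := by
  simpa using isHighest_pairing_mul_mon (K := K) 0 a f

theorem exists_pow_one_zero_mon (a f : ℕ) :
    ∃ k, (unitOps K (XURing K) 1 0 ^ k) (mon K a 0 0 0 0 f) = 0 := by
  have h : ∀ a b, (unitOps K (XURing K) 1 0 ^ (a + 1)) (mon K a b 0 0 0 f) = 0 := by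
    intro a
    induction a with
    | zero => intro b; simp [unitOps_mon_one_zero]
    | succ a ih =>
      intro b
      rw [pow_succ, Module.End.mul_apply, unitOps_mon_one_zero]
      simp [ih]
  exact ⟨_, h a 0⟩

theorem exists_pow_two_one_mon (a f : ℕ) :
    ∃ k, (unitOps K (XURing K) 2 1 ^ k) (mon K a 0 0 0 0 f) = 0 := by
  have h : ∀ f e, (unitOps K (XURing K) 2 1 ^ (f + 1)) (mon K a 0 0 0 e f) = 0 := by
    intro f
    induction f with
    | zero => intro b; simp [unitOps_mon_two_one]
    | succ f ih =>
      intro e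
      rw [pow_succ, Module.End.mul_apply, unitOps_mon_two_one]
      simp [ih]
  exact ⟨_, h f 0⟩

theorem mon_ne_zero (a b c d e f : ℕ) : mon K a b c d e f ≠ 0 := by
  simp [mon, X_ne_zero]

theorem gamma_toSubmodule [CharZero K] (d₁ d₂ : ℕ) : (Gamma K d₁ d₂).toSubmodule
    = lowerSpan (unitOps K (XURing K)) {mon K d₁ 0 0 0 0 d₂} := by
  have h : X (Sum.inr 0) ^ d₁ * X (Sum.inl 2) ^ d₂ = mon K d₁ 0 0 0 0 d₂ := by simp [mon]
  rw [Gamma, h, lieSpan_eq_lowerSpan (isHighest_mon d₁ d₂)]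

end HighestMonomial

theorem exists_lieSubmodule_envelopingSpan {K : Type*} [Field K] [CharZero K] {n d₁ d₂ : ℕ}
    {a : CoordRing K n} (ha : IsHighest (unitOps K (CoordRing K n)) (monWeight K d₁ d₂) a)
    (ha_ord : HasOrder a d₁ d₂) :
    ∃ N : LieSubmodule K (sl3 K) (CoordRing K n), N.toSubmodule = envelopingSpan a ∧
      LieModule.IsIrreducible K (sl3 K) N ∧ Nonempty (N ≃ₗ⁅K, sl3 K⁆ Gamma K d₁ d₂) := by
  have o := ha_ord.pow_apply
  have hN := lieSpan_eq_lowerSpan ha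
  refine ⟨_, hN.trans (envelopingSpan_eq_lowerSpan a).symm, ?_, ?_⟩
  · exact isIrreducible_of_highest ha_ord.ne_zero ha (monWeight_zero_sub_one d₁ d₂)
      (monWeight_one_sub_two d₁ d₂) ⟨_, o.1.2⟩ ⟨_, o.2.2⟩ _ hN
  · exact nonempty_equiv_of_highest ha_ord.ne_zero (mon_ne_zero d₁ 0 0 0 0 d₂) ha
      (isHighest_mon d₁ d₂) (monWeight_zero_sub_one d₁ d₂)
      (monWeight_one_sub_two d₁ d₂) ⟨_, o.1.2⟩ ⟨_, o.2.2⟩ (exists_pow_one_zero_mon d₁ d₂)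
      (exists_pow_two_one_mon d₁ d₂) _ hN _ (gamma_toSubmodule d₁ d₂)

/-! ### Concomitant families as equivariant maps -/

section Family

variable {K : Type*} [Field K] {n d₁ d₂ : ℕ}

/-- The linear map sending `u₁^a u₂^b u₃^c x₁^d x₂^e x₃^f` to `B_{b,c}^{d,e}`. -/
def dualSwap (B : FormIdx d₁ → FormIdx d₂ → CoordRing K n) : XURing K →ₗ[K] CoordRing K n :=
  dualMap B ∘ₗ (rename Sum.swap : XURing K →ₐ[K] XURing K).toLinearMap

theorem dualSwap_mon (B : FormIdx d₁ → FormIdx d₂ → CoordRing K n) (a b c d e f : ℕ) :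
    dualSwap B (mon K a b c d e f) = entry B b c d e := by
  have h : rename Sum.swap (mon K a b c d e f) = monomial
      (Finsupp.single (Sum.inl 0) a + Finsupp.single (Sum.inl 1) b + Finsupp.single (Sum.inl 2) c
        + (Finsupp.single (Sum.inr 0) d + Finsupp.single (Sum.inr 1) e
          + Finsupp.single (Sum.inr 2) f)) (1 : K) := by
    simp only [mon, map_mul, map_pow, rename_X, Sum.swap_inl, Sum.swap_inr]
    simp only [X_pow_eq_monomial, monomial_mul, mul_one]
  have hm : ∀ m : (Fin 3 ⊕ Fin 3) →₀ ℕ, dualMap B (monomial m 1)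
      = entry B (m (Sum.inl 1)) (m (Sum.inl 2)) (m (Sum.inr 0)) (m (Sum.inr 1)) := by
    intro m
    rw [dualMap, show monomial m (1 : K) = basisMonomials (Fin 3 ⊕ Fin 3) K m by
      rw [coe_basisMonomials], Module.Basis.constr_basis]
  rw [dualSwap, LinearMap.comp_apply, AlgHom.toLinearMap_apply, h, hm]
  simp

theorem dualSwap_pairing_pow_mul_mon (B : FormIdx d₁ → FormIdx d₂ → CoordRing K n) (s : ℕ) :
    dualSwap B (pairing K ^ s * mon K (d₁ - s) 0 0 0 0 (d₂ - s))
      = dualMap B (lowestVector K d₁ d₂ s) := by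
  rw [dualSwap, LinearMap.comp_apply, AlgHom.toLinearMap_apply]
  congr 1
  simp only [pairing, mon, lowestVector, map_mul, map_pow, map_sum, rename_X, Sum.swap_inl,
    Sum.swap_inr, pow_zero, mul_one, one_mul]
  rw [mul_comm]
  congr 2
  exact Finset.sum_congr rfl fun i _ => mul_comm _ _

variable (K) in
/-- The space `S^{d₁}(U) · S^{d₂}(X)`. -/
def bidegreeSpace (d₁ d₂ : ℕ) : Submodule K (XURing K) :=
  Submodule.span K {v | ∃ a b c d e f, a + b + c = d₁ ∧ d + e + f = d₂ ∧ v = mon K a b c d e f}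

theorem mon_mem_bidegreeSpace {a b c d e f : ℕ} (h₁ : a + b + c = d₁) (h₂ : d + e + f = d₂) :
    mon K a b c d e f ∈ bidegreeSpace K d₁ d₂ :=
  Submodule.subset_span ⟨a, b, c, d, e, f, h₁, h₂, rfl⟩

theorem pairing_pow_mul_mon_mem (s : ℕ) : ∀ {a b c d e f d₁ d₂ : ℕ}, a + b + c + s = d₁ →
    d + e + f + s = d₂ → pairing K ^ s * mon K a b c d e f ∈ bidegreeSpace K d₁ d₂ := by
  induction s with
  | zero =>
    intro a b c d e f d₁ d₂ h₁ h₂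
    rw [pow_zero, one_mul]
    exact mon_mem_bidegreeSpace h₁ h₂
  | succ s ih =>
    intro a b c d e f d₁ d₂ h₁ h₂
    rw [pow_succ, mul_assoc, pairing_mul_mon, mul_add, mul_add]
    exact add_mem (add_mem (ih (by omega) (by omega)) (ih (by omega) (by omega)))
      (ih (by omega) (by omega))

variable (K) in
/-- The highest vectors that generate the graph of the map given by a concomitant family. -/
def graphGenerators (a : CoordRing K n) (d₁ d₂ : ℕ) : Set (CoordRing K n × XURing K) :=
  insert (a, mon K d₁ 0 0 0 0 d₂)
    {v | ∃ s, 1 ≤ s ∧ s ≤ min d₁ d₂ ∧ v = (0, pairing K ^ s * mon K (d₁ - s) 0 0 0 0 (d₂ - s))}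

variable (K n) in
/-- The diagonal operators on `K[A] × K[X, U]`. -/
abbrev graphOps : Fin 3 → Fin 3 → Module.End K (CoordRing K n × XURing K) :=
  prodOps (unitOps K (CoordRing K n)) (unitOps K (XURing K))

/-- The graph of the map given by a concomitant family. -/
def familyGraph (a : CoordRing K n) (d₁ d₂ : ℕ) : Submodule K (CoordRing K n × XURing K) :=
  lowerSpan (graphOps K n) (graphGenerators K a d₁ d₂)

variable {a : CoordRing K n}

theorem prodOps_apply {V W : Type*} [AddCommGroup V] [Module K V] [AddCommGroup W] [Module K W]
    (E : Fin 3 → Fin 3 → Module.End K V) (F : Fin 3 → Fin 3 → Module.End K W) (i j : Fin 3)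
    (v : V) (w : W) : prodOps E F i j (v, w) = (E i j v, F i j w) := rfl

theorem highest_mem_familyGraph : (a, mon K d₁ 0 0 0 0 d₂) ∈ familyGraph a d₁ d₂ :=
  subset_lowerSpan _ (Set.mem_insert _ _)

theorem zero_highest_mem_familyGraph {s : ℕ} (hs : 1 ≤ s) (hs' : s ≤ min d₁ d₂) :
    (0, pairing K ^ s * mon K (d₁ - s) 0 0 0 0 (d₂ - s)) ∈ familyGraph a d₁ d₂ :=
  subset_lowerSpan _ (Set.mem_insert_of_mem _ ⟨s, hs, hs', rfl⟩)

theorem matrixUnitRel_graphOps : MatrixUnitRel (graphOps K n) :=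
  matrixUnitRel_unitOps.prod matrixUnitRel_unitOps

theorem familyGraph_stable (ha : IsHighest (unitOps K (CoordRing K n)) (monWeight K d₁ d₂) a)
    (i j : Fin 3) {v : CoordRing K n × XURing K} (hv : v ∈ familyGraph a d₁ d₂) :
    graphOps K n i j v ∈ familyGraph a d₁ d₂ := by
  refine stable_lowerSpan matrixUnitRel_graphOps ?_ i j hv
  rintro _ (rfl | ⟨s, _, _, rfl⟩)
  · exact ⟨_, ha.prod (isHighest_mon d₁ d₂)⟩
  · exact ⟨_, (isHighest_zero _).prod (isHighest_pairing_mul_mon s (d₁ - s) (d₂ - s))⟩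

/-- The graph is defined on every monomial, because its second projection is stable under lowering
and contains all the highest vectors of the bidegree. -/
theorem exists_mem_familyGraph [CharZero K] (x : CoordRing K n) {a b c d e f : ℕ}
    (h₁ : a + b + c = d₁) (h₂ : d + e + f = d₂) :
    ∃ y, (y, mon K a b c d e f) ∈ familyGraph x d₁ d₂ := by
  have h := mon_mem_of_highest_mem (K := K) d₁ d₂
    (P := (familyGraph x d₁ d₂).map (LinearMap.snd K _ _)) ?_ ?_ a b c d e f h₁ h₂
  · obtain ⟨⟨y, z⟩, hy, rfl⟩ := h
    exact ⟨y, hy⟩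
  · rintro i j hij _ ⟨v, hv, rfl⟩
    exact ⟨_, lower_mem_lowerSpan hij hv, rfl⟩
  · intro s hs
    rcases Nat.eq_zero_or_pos s with rfl | hs0
    · refine ⟨(x, mon K d₁ 0 0 0 0 d₂), highest_mem_familyGraph, ?_⟩
      rw [pow_zero, one_mul, Nat.sub_zero, Nat.sub_zero]
      rfl
    · exact ⟨_, zero_highest_mem_familyGraph hs0 hs, rfl⟩

theorem mon_notMem_span_pairing (a f : ℕ) :
    mon K a 0 0 0 0 f ∉ Ideal.span {pairing K} := by
  rw [Ideal.mem_span_singleton]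
  rintro ⟨g, hg⟩
  -- At the point `x = (0, 0, 1)`, `u = (1, 0, 0)` the pairing vanishes and the monomial equals `1`.
  have h := congrArg (aeval (Sum.elim ![0, 0, 1] ![1, 0, 0] : Fin 3 ⊕ Fin 3 → K)) hg
  simp [mon, pairing, Fin.sum_univ_three] at h

/-- The graph is single-valued. Modulo the ideal of the pairing only the generator with `s = 0`
survives, and the irreducible module it generates contains no nonzero vector whose second coordinate
lies in that ideal. -/
theorem eq_zero_of_mem_familyGraph [CharZero K]
    (ha : IsHighest (unitOps K (CoordRing K n)) (monWeight K d₁ d₂) a)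
    (ha_ord : HasOrder a d₁ d₂) {y : CoordRing K n} (hy : (y, 0) ∈ familyGraph a d₁ d₂) :
    y = 0 := by
  let I : Submodule K (XURing K) := (Ideal.span {pairing K}).restrictScalars K
  have hI : ∀ i j, ∀ f ∈ I, unitOps K (XURing K) i j f ∈ I := by
    intro i j f hf
    obtain ⟨g, rfl⟩ := Ideal.mem_span_singleton.1 hf
    refine Ideal.mem_span_singleton.2 ?_
    rw [unitOps_xu_apply, xuDer_pairing_mul]
    exact dvd_mul_right _ _
  let P := lowerSpan (graphOps K n) {(a, mon K d₁ 0 0 0 0 d₂)}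
  have hle : familyGraph a d₁ d₂ ≤ P ⊔ (⊥ : Submodule K (CoordRing K n)).prod I := by
    refine lowerSpan_le ?_ ?_
    · rintro _ (rfl | ⟨s, hs, _, rfl⟩)
      · exact Submodule.mem_sup_left (subset_lowerSpan _ rfl)
      · refine Submodule.mem_sup_right ⟨rfl, Ideal.mem_span_singleton.2 ?_⟩
        exact (dvd_pow_self _ (by omega)).mul_right _
    · intro i j hij v hv
      obtain ⟨x, hx, ⟨z, w⟩, hw, rfl⟩ := Submodule.mem_sup.1 hv
      obtain ⟨rfl, hw⟩ := (Submodule.mem_prod.1 hw : z = 0 ∧ w ∈ I)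
      rw [map_add]
      refine add_mem (Submodule.mem_sup_left (lower_mem_lowerSpan hij hx))
        (Submodule.mem_sup_right ⟨?_, hI i j w hw⟩)
      exact map_zero (unitOps K (CoordRing K n) i j)
  obtain ⟨x, hx, ⟨z, w⟩, hw, h⟩ := Submodule.mem_sup.1 (hle hy)
  obtain ⟨rfl, hw⟩ := (Submodule.mem_prod.1 hw : z = 0 ∧ w ∈ I)
  have o := ha_ord.pow_apply
  have hx1 : x.1 = y := by simpa using congrArg Prod.fst h
  have hx2 : x.2 = -w := eq_neg_of_add_eq_zero_left (congrArg Prod.snd h)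
  rw [← hx1, mem_lowerSpan_prod_of_stable ha (isHighest_mon d₁ d₂) (monWeight_zero_sub_one d₁ d₂)
    (monWeight_one_sub_two d₁ d₂) ⟨_, o.1.2⟩ ⟨_, o.2.2⟩ (exists_pow_one_zero_mon d₁ d₂)
    (exists_pow_two_one_mon d₁ d₂) (Q := I.comap (LinearMap.snd K _ _))
    (fun i j v hv => hI i j v.2 hv) (mon_notMem_span_pairing d₁ d₂) hx]
  · rfl
  · rw [Submodule.mem_comap, LinearMap.snd_apply, hx2]
    exact neg_mem hw

theorem eq_of_mem_familyGraph [CharZero K]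
    (ha : IsHighest (unitOps K (CoordRing K n)) (monWeight K d₁ d₂) a)
    (ha_ord : HasOrder a d₁ d₂) {y z : CoordRing K n} {w : XURing K}
    (hy : (y, w) ∈ familyGraph a d₁ d₂) (hz : (z, w) ∈ familyGraph a d₁ d₂) : y = z := by
  have h := sub_mem hy hz
  rw [Prod.mk_sub_mk, sub_self] at h
  exact sub_eq_zero.1 (eq_zero_of_mem_familyGraph ha ha_ord h)

variable {B : FormIdx d₁ → FormIdx d₂ → CoordRing K n}

theorem smul_mon_mem_bidegreeSpace {r a b c d e f : ℕ}
    (h : r ≠ 0 → a + b + c = d₁ ∧ d + e + f = d₂) :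
    (r : K) • mon K a b c d e f ∈ bidegreeSpace K d₁ d₂ := by
  rcases eq_or_ne r 0 with rfl | hr
  · rw [Nat.cast_zero, zero_smul]
    exact zero_mem _
  · exact Submodule.smul_mem _ _ (mon_mem_bidegreeSpace (h hr).1 (h hr).2)

/-- The equations for `hatD₁`, `hatD₂`, `hatD₃` are exactly the statement that `ψ` commutes with
`E₂₁`, `E₃₂`, `E₃₁` on monomials. -/
theorem IsConcomitantFamily.lower_mon (hB : IsConcomitantFamily a B) {i j : Fin 3} (hij : j < i)
    {p q r s t w : ℕ} (h₁ : p + q + r = d₁) (h₂ : s + t + w = d₂) :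
    unitOps K (XURing K) i j (mon K p q r s t w) ∈ bidegreeSpace K d₁ d₂ ∧
      unitOps K (CoordRing K n) i j (dualSwap B (mon K p q r s t w))
        = dualSwap B (unitOps K (XURing K) i j (mon K p q r s t w)) := by
  have e₁ : d₁ - (q + r) = p := by omega
  have e₂ : d₂ - (s + t) = w := by omega
  have cases : (i = 1 ∧ j = 0) ∨ (i = 2 ∧ j = 1) ∨ (i = 2 ∧ j = 0) := by
    revert hij
    fin_cases i <;> fin_cases j <;> decide
  rcases cases with ⟨rfl, rfl⟩ | ⟨rfl, rfl⟩ | ⟨rfl, rfl⟩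
  · rw [unitOps_mon_one_zero]
    refine ⟨sub_mem (smul_mon_mem_bidegreeSpace (by omega))
      (smul_mon_mem_bidegreeSpace (by omega)), ?_⟩
    rw [unitOps_one_zero_apply, dualSwap_mon, hB.hatD₁_eq q r s t (by omega) (by omega), e₁,
      map_sub, map_smul, map_smul, dualSwap_mon, dualSwap_mon]
  · rw [unitOps_mon_two_one]
    refine ⟨sub_mem (smul_mon_mem_bidegreeSpace (by omega))
      (smul_mon_mem_bidegreeSpace (by omega)), ?_⟩
    rw [unitOps_two_one_apply, dualSwap_mon, hB.hatD₂_eq q r s t (by omega) (by omega), e₂,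
      map_sub, map_smul, map_smul, dualSwap_mon, dualSwap_mon]
  · rw [unitOps_mon_two_zero]
    refine ⟨sub_mem (smul_mon_mem_bidegreeSpace (by omega))
      (smul_mon_mem_bidegreeSpace (by omega)), ?_⟩
    rw [unitOps_two_zero_apply, dualSwap_mon, hB.hatD₃_eq q r s t (by omega) (by omega), e₁, e₂,
      map_sub, map_smul, map_smul, dualSwap_mon, dualSwap_mon]

/-- The graph of `ψ` contains the generators and is stable under lowering, so it contains everything
they generate. -/
theorem IsConcomitantFamily.familyGraph_le (hB : IsConcomitantFamily a B) :
    familyGraph a d₁ d₂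
      ≤ (bidegreeSpace K d₁ d₂).map ((dualSwap B).prod LinearMap.id) := by
  refine lowerSpan_le ?_ ?_
  · rintro _ (rfl | ⟨s, hs, hs', rfl⟩)
    · refine ⟨mon K d₁ 0 0 0 0 d₂, mon_mem_bidegreeSpace (by omega) (by omega),
        Prod.ext ?_ rfl⟩
      exact (dualSwap_mon B _ _ _ _ _ _).trans hB.init
    · refine ⟨pairing K ^ s * mon K (d₁ - s) 0 0 0 0 (d₂ - s),
        pairing_pow_mul_mon_mem s (by omega) (by omega), Prod.ext ?_ rfl⟩
      exact (dualSwap_pairing_pow_mul_mon B s).trans (hB.vanish s hs hs')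
  · rintro i j hij _ ⟨f, hf, rfl⟩
    suffices h : unitOps K (XURing K) i j f ∈ bidegreeSpace K d₁ d₂ ∧
        unitOps K (CoordRing K n) i j (dualSwap B f)
          = dualSwap B (unitOps K (XURing K) i j f) from
      ⟨_, h.1, Prod.ext h.2.symm rfl⟩
    induction hf using Submodule.span_induction with
    | mem v hv =>
      obtain ⟨p, q, r, s, t, w, h₁, h₂, rfl⟩ := hv
      exact hB.lower_mon hij h₁ h₂
    | zero => simp
    | add v w _ _ hv hw =>
      simp only [map_add, hv.2, hw.2]
      exact ⟨add_mem hv.1 hw.1, trivial⟩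
    | smul c v _ hv =>
      simp only [map_smul, hv.2]
      exact ⟨Submodule.smul_mem _ c hv.1, trivial⟩

theorem IsConcomitantFamily.fst_eq (hB : IsConcomitantFamily a B) {v : CoordRing K n × XURing K}
    (hv : v ∈ familyGraph a d₁ d₂) : v.1 = dualSwap B v.2 := by
  obtain ⟨f, _, rfl⟩ := hB.familyGraph_le hv
  rfl

theorem IsConcomitantFamily.entry_mem [CharZero K] (hB : IsConcomitantFamily a B)
    {p q r s t w : ℕ} (h₁ : p + q + r = d₁) (h₂ : s + t + w = d₂) :
    (entry B q r s t, mon K p q r s t w) ∈ familyGraph a d₁ d₂ := by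
  obtain ⟨y, hy⟩ := exists_mem_familyGraph a h₁ h₂
  have h := hB.fst_eq hy
  rw [dualSwap_mon] at h
  rwa [← h]

theorem entry_apply (p : FormIdx d₁) (q : FormIdx d₂) :
    entry B p.1.1 p.1.2 q.1.1 q.1.2 = B p q := by
  rw [entry, dif_pos ⟨p.2, q.2⟩]

theorem dualSwap_mem_of_entry_mem {D : Submodule K (CoordRing K n × XURing K)}
    (h : ∀ p q r s t w, p + q + r = d₁ → s + t + w = d₂ →
      (entry B q r s t, mon K p q r s t w) ∈ D) {f : XURing K}
    (hf : f ∈ bidegreeSpace K d₁ d₂) : (dualSwap B f, f) ∈ D := by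
  suffices hle : bidegreeSpace K d₁ d₂ ≤ D.comap ((dualSwap B).prod LinearMap.id) from hle hf
  refine Submodule.span_le.2 ?_
  rintro _ ⟨p, q, r, s, t, w, h₁, h₂, rfl⟩
  have := h p q r s t w h₁ h₂
  rwa [← dualSwap_mon B p q r s t w] at this

theorem IsConcomitantFamily.dualSwap_mem [CharZero K] (hB : IsConcomitantFamily a B) {f : XURing K}
    (hf : f ∈ bidegreeSpace K d₁ d₂) : (dualSwap B f, f) ∈ familyGraph a d₁ d₂ :=
  dualSwap_mem_of_entry_mem (fun _ _ _ _ _ _ h₁ h₂ => hB.entry_mem h₁ h₂) hf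

/-- The definition of a family mentions lowering operators only. The raising and diagonal ones come
for free, since the graph is generated by highest vectors. -/
theorem IsConcomitantFamily.unitOps_dualSwap [CharZero K]
    (ha : IsHighest (unitOps K (CoordRing K n)) (monWeight K d₁ d₂) a)
    (hB : IsConcomitantFamily a B) (i j : Fin 3) {f : XURing K}
    (hf : f ∈ bidegreeSpace K d₁ d₂) :
    unitOps K (CoordRing K n) i j (dualSwap B f) = dualSwap B (unitOps K (XURing K) i j f) :=
  hB.fst_eq (familyGraph_stable ha i j (hB.dualSwap_mem hf))

theorem IsConcomitantFamily.unique [CharZero K] (hB : IsConcomitantFamily a B)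
    {B' : FormIdx d₁ → FormIdx d₂ → CoordRing K n} (hB' : IsConcomitantFamily a B') : B = B' := by
  funext ⟨⟨i, j⟩, hp⟩ ⟨⟨k, l⟩, hq⟩
  have h := hB'.fst_eq (hB.entry_mem (p := d₁ - (i + j)) (q := i) (r := j) (s := k) (t := l)
    (w := d₂ - (k + l)) (by simp only at hp; omega) (by simp only at hq; omega))
  rw [dualSwap_mon] at h
  rw [← entry_apply (B := B), ← entry_apply (B := B')]
  exact h

theorem isConcomitantFamily_of_mem [CharZero K]
    (ha : IsHighest (unitOps K (CoordRing K n)) (monWeight K d₁ d₂) a)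
    (ha_ord : HasOrder a d₁ d₂)
    (h : ∀ p q r s t w, p + q + r = d₁ → s + t + w = d₂ →
      (entry B q r s t, mon K p q r s t w) ∈ familyGraph a d₁ d₂) :
    IsConcomitantFamily a B := by
  -- A coefficient that vanishes excuses an index out of range, where truncated subtraction would
  -- leave the bidegree.
  have lin : ∀ {r p q r' s t w : ℕ}, (r ≠ 0 → p + q + r' = d₁ ∧ s + t + w = d₂) →
      ((r : K) • entry B q r' s t, (r : K) • mon K p q r' s t w) ∈ familyGraph a d₁ d₂ := by
    intro r p q r' s t w hr
    rcases eq_or_ne r 0 with rfl | hr0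
    · simp only [Nat.cast_zero, zero_smul]
      exact zero_mem _
    · exact Submodule.smul_mem _ (r : K) (h p q r' s t w (hr hr0).1 (hr hr0).2)
  have lin₂ : ∀ {r p q r' s t w r₁ p₁ q₁ r₁' s₁ t₁ w₁ : ℕ},
      (r ≠ 0 → p + q + r' = d₁ ∧ s + t + w = d₂) →
      (r₁ ≠ 0 → p₁ + q₁ + r₁' = d₁ ∧ s₁ + t₁ + w₁ = d₂) →
      ((r : K) • entry B q r' s t - (r₁ : K) • entry B q₁ r₁' s₁ t₁,
        (r : K) • mon K p q r' s t w - (r₁ : K) • mon K p₁ q₁ r₁' s₁ t₁ w₁)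
          ∈ familyGraph a d₁ d₂ := by
    intro r p q r' s t w r₁ p₁ q₁ r₁' s₁ t₁ w₁ h₁ h₂
    have := sub_mem (lin h₁) (lin h₂)
    rwa [Prod.mk_sub_mk] at this
  have low : ∀ {i j : Fin 3} {p q r s t w : ℕ} {y : CoordRing K n}, j < i → p + q + r = d₁ →
      s + t + w = d₂ → (y, unitOps K (XURing K) i j (mon K p q r s t w)) ∈ familyGraph a d₁ d₂ →
      unitOps K (CoordRing K n) i j (entry B q r s t) = y := by
    intro i j p q r s t w y hij h₁ h₂ hy
    have h' : graphOps K n i j (entry B q r s t, mon K p q r s t w) ∈ familyGraph a d₁ d₂ :=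
      lower_mem_lowerSpan hij (h p q r s t w h₁ h₂)
    rw [prodOps_apply] at h'
    exact eq_of_mem_familyGraph ha ha_ord h' hy
  refine ⟨?_, ?_, ?_, ?_, ?_⟩
  · exact eq_of_mem_familyGraph ha ha_ord (h d₁ 0 0 0 0 d₂ (by omega) (by omega))
      highest_mem_familyGraph
  · intro i j k l h₁ h₂
    rw [← unitOps_one_zero_apply]
    refine low (p := d₁ - (i + j)) (w := d₂ - (k + l)) (by decide) (by omega) (by omega) ?_
    rw [unitOps_mon_one_zero]
    exact lin₂ (by omega) (by omega)
  · intro i j k l h₁ h₂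
    rw [← unitOps_two_one_apply]
    refine low (p := d₁ - (i + j)) (w := d₂ - (k + l)) (by decide) (by omega) (by omega) ?_
    rw [unitOps_mon_two_one]
    exact lin₂ (by omega) (by omega)
  · intro i j k l h₁ h₂
    rw [← unitOps_two_zero_apply]
    refine low (p := d₁ - (i + j)) (w := d₂ - (k + l)) (by decide) (by omega) (by omega) ?_
    rw [unitOps_mon_two_zero]
    exact lin₂ (by omega) (by omega)
  · intro s hs hs'
    rw [← dualSwap_pairing_pow_mul_mon]
    exact eq_of_mem_familyGraph ha ha_ord
      (dualSwap_mem_of_entry_mem h (pairing_pow_mul_mon_mem s (by omega) (by omega)))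
      (zero_highest_mem_familyGraph hs hs')

theorem existsUnique_isConcomitantFamily [CharZero K]
    (ha : IsHighest (unitOps K (CoordRing K n)) (monWeight K d₁ d₂) a)
    (ha_ord : HasOrder a d₁ d₂) :
    ∃! B : FormIdx d₁ → FormIdx d₂ → CoordRing K n, IsConcomitantFamily a B := by
  have hex : ∀ (p : FormIdx d₁) (q : FormIdx d₂), ∃ y, (y, mon K (d₁ - (p.1.1 + p.1.2)) p.1.1 p.1.2
      q.1.1 q.1.2 (d₂ - (q.1.1 + q.1.2))) ∈ familyGraph a d₁ d₂ := fun p q =>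
    exists_mem_familyGraph a (by have := p.2; omega) (by have := q.2; omega)
  choose B hB using hex
  have h : IsConcomitantFamily a B := by
    refine isConcomitantFamily_of_mem ha ha_ord ?_
    intro p q r s t w h₁ h₂
    have h' := hB ⟨(q, r), by simp only; omega⟩ ⟨(s, t), by simp only; omega⟩
    rw [← entry_apply (B := B)] at h'
    simp only at h'
    rwa [show d₁ - (q + r) = p by omega, show d₂ - (s + t) = w by omega] at h'
  exact ⟨B, h, fun B' hB' => hB'.unique h⟩

/-- Both sides are the first projection of the graph: the generators `(0, ·)` contribute nothing to
it, and the entries are the values of `ψ` on monomials. -/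
theorem IsConcomitantFamily.span_eq [CharZero K] (hB : IsConcomitantFamily a B) :
    Submodule.span K {b | ∃ p q, b = B p q} = envelopingSpan a := by
  have hsub : (familyGraph a d₁ d₂).map (LinearMap.fst K _ _)
      = lowerSpan (unitOps K (CoordRing K n)) {a} := by
    rw [familyGraph, map_lowerSpan (E' := unitOps K (CoordRing K n)) _ (fun _ _ _ => rfl)]
    apply le_antisymm
    · refine lowerSpan_le ?_ fun _ _ hij _ hv => lower_mem_lowerSpan hij hv
      rintro _ ⟨_, (rfl | ⟨s, _, _, rfl⟩), rfl⟩
      · exact subset_lowerSpan _ rfl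
      · exact zero_mem _
    · refine lowerSpan_mono ?_
      rintro _ rfl
      exact ⟨_, Set.mem_insert _ _, rfl⟩
  rw [envelopingSpan_eq_lowerSpan, ← hsub]
  apply le_antisymm
  · refine Submodule.span_le.2 ?_
    rintro _ ⟨p, q, rfl⟩
    refine ⟨_, hB.entry_mem (p := d₁ - (p.1.1 + p.1.2)) (q := p.1.1) (r := p.1.2) (s := q.1.1)
      (t := q.1.2) (w := d₂ - (q.1.1 + q.1.2)) (by have := p.2; omega) (by have := q.2; omega), ?_⟩
    exact entry_apply p q
  · refine (Submodule.map_mono hB.familyGraph_le).trans ?_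
    rw [Submodule.map_le_iff_le_comap, Submodule.map_le_iff_le_comap]
    refine Submodule.span_le.2 ?_
    rintro _ ⟨p, q, r, s, t, w, h₁, h₂, rfl⟩
    refine Submodule.subset_span ⟨⟨(q, r), by simp only; omega⟩, ⟨(s, t), by simp only; omega⟩, ?_⟩
    rw [← entry_apply (B := B)]
    exact dualSwap_mon B p q r s t w

end Family

/-! ### Trinomial expansion -/

section Expansion

variable {K : Type*} [Field K] [CharZero K]

theorem trinom_eq_choose {d i j : ℕ} (h : i + j ≤ d) :
    trinom K d i j = (d.choose i : K) * ((d - i).choose j : K) := by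
  rw [Nat.cast_choose K (by omega), Nat.cast_choose K (by omega), trinom, Nat.sub_sub]
  have h1 : ((d - i)! : K) ≠ 0 := Nat.cast_ne_zero.2 (Nat.factorial_ne_zero _)
  have h2 : (i ! : K) ≠ 0 := Nat.cast_ne_zero.2 (Nat.factorial_ne_zero _)
  have h3 : (j ! : K) ≠ 0 := Nat.cast_ne_zero.2 (Nat.factorial_ne_zero _)
  have h4 : ((d - (i + j))! : K) ≠ 0 := Nat.cast_ne_zero.2 (Nat.factorial_ne_zero _)
  field_simp

theorem trinom_ne_zero (d i j : ℕ) : trinom K d i j ≠ 0 := by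
  simp only [trinom]
  refine div_ne_zero ?_ (mul_ne_zero (mul_ne_zero ?_ ?_) ?_) <;>
    exact Nat.cast_ne_zero.2 (Nat.factorial_ne_zero _)

theorem add_add_pow_eq_sum_trinom {R : Type*} [CommRing R] [Algebra K R] (a b c : R) (d : ℕ) :
    (a + b + c) ^ d = ∑ i ∈ Finset.range (d + 1), ∑ j ∈ Finset.range (d + 1 - i),
      trinom K d i j • (a ^ (d - (i + j)) * b ^ i * c ^ j) := by
  rw [show a + b + c = b + (c + a) by ring, add_pow]
  refine Finset.sum_congr rfl fun i hi => ?_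
  have hi' : i ≤ d := by rw [Finset.mem_range] at hi; omega
  rw [add_pow, show d - i + 1 = d + 1 - i by omega, Finset.mul_sum, Finset.sum_mul]
  refine Finset.sum_congr rfl fun j hj => ?_
  have hj' : i + j ≤ d := by rw [Finset.mem_range] at hj; omega
  rw [trinom_eq_choose hj', Algebra.smul_def, map_mul, map_natCast, map_natCast, Nat.sub_sub]
  ring

end Expansion

/-! ### The Casimir element as the image of an invariant tensor -/

section Invariance

open scoped TensorProduct

variable {K : Type*} [Field K] {n d₁ d₂ : ℕ}

theorem fullDer_rename_inl (z : Matrix (Fin 3) (Fin 3) K) (f : CoordRing K n) :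
    fullDer K n z (rename Sum.inl f) = rename Sum.inl (coordDer K n z f) := by
  induction f using MvPolynomial.induction_on with
  | C c => simp
  | add f g hf hg => simp only [map_add, hf, hg]
  | mul_X f p hf =>
    simp only [map_mul, rename_X, Derivation.leibniz, hf, smul_eq_mul, map_add]
    simp only [fullDer, mkDerivation_X, Sum.elim_inl]

theorem fullDer_rename_inr (z : Matrix (Fin 3) (Fin 3) K) (f : XURing K) :
    fullDer K n z (rename Sum.inr f) = rename Sum.inr (xuDer K z f) := by
  induction f using MvPolynomial.induction_on with
  | C c => simp
  | add f g hf hg => simp only [map_add, hf, hg]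
  | mul_X f p hf =>
    simp only [map_mul, rename_X, Derivation.leibniz, hf, smul_eq_mul, map_add]
    simp only [fullDer, mkDerivation_X, Sum.elim_inr]

/-- The diagonal action of a matrix on `K[X, U] ⊗ K[X, U]`. -/
def tensorDer (z : Matrix (Fin 3) (Fin 3) K) :
    XURing K ⊗[K] XURing K →ₗ[K] XURing K ⊗[K] XURing K :=
  LinearMap.rTensor _ (xuDer K z).toLinearMap + LinearMap.lTensor _ (xuDer K z).toLinearMap

theorem tensorDer_tmul (z : Matrix (Fin 3) (Fin 3) K) (f g : XURing K) :
    tensorDer z (f ⊗ₜ g) = xuDer K z f ⊗ₜ g + f ⊗ₜ xuDer K z g := rfl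

theorem tensorDer_mul (z : Matrix (Fin 3) (Fin 3) K) (s t : XURing K ⊗[K] XURing K) :
    tensorDer z (s * t) = tensorDer z s * t + s * tensorDer z t := by
  induction s using TensorProduct.induction_on with
  | zero => simp
  | add s₁ s₂ h₁ h₂ => simp only [add_mul, map_add, h₁, h₂]; ring
  | tmul f g =>
    induction t using TensorProduct.induction_on with
    | zero => simp
    | add t₁ t₂ h₁ h₂ => simp only [mul_add, map_add, h₁, h₂]; ring
    | tmul f' g' =>
      simp only [Algebra.TensorProduct.tmul_mul_tmul, tensorDer_tmul, Derivation.leibniz,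
        smul_eq_mul, add_mul, mul_add, TensorProduct.add_tmul, TensorProduct.tmul_add]
      rw [mul_comm f' (xuDer K z f), mul_comm g' (xuDer K z g)]
      abel

theorem tensorDer_one (z : Matrix (Fin 3) (Fin 3) K) : tensorDer z 1 = 0 := by
  rw [Algebra.TensorProduct.one_def, tensorDer_tmul]
  simp

theorem tensorDer_pow_eq_zero {z : Matrix (Fin 3) (Fin 3) K} {t : XURing K ⊗[K] XURing K}
    (h : tensorDer z t = 0) (k : ℕ) : tensorDer z (t ^ k) = 0 := by
  induction k with
  | zero => rw [pow_zero, tensorDer_one]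
  | succ k ih => rw [pow_succ, tensorDer_mul, ih, h, zero_mul, mul_zero, add_zero]

variable (K) in
/-- The invariant `(∑ uᵢ ⊗ xᵢ)^{d₁} (∑ xᵢ ⊗ uᵢ)^{d₂}`. -/
def invariantTensor (d₁ d₂ : ℕ) : XURing K ⊗[K] XURing K :=
  (X (Sum.inr 0) ⊗ₜ X (Sum.inl 0) + X (Sum.inr 1) ⊗ₜ X (Sum.inl 1)
      + X (Sum.inr 2) ⊗ₜ X (Sum.inl 2)) ^ d₁
    * (X (Sum.inl 2) ⊗ₜ X (Sum.inr 2) + X (Sum.inl 0) ⊗ₜ X (Sum.inr 0)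
      + X (Sum.inl 1) ⊗ₜ X (Sum.inr 1)) ^ d₂

theorem tensorDer_invariantTensor (z : Matrix (Fin 3) (Fin 3) K) :
    tensorDer z (invariantTensor K d₁ d₂) = 0 := by
  rw [invariantTensor, tensorDer_mul, tensorDer_pow_eq_zero, tensorDer_pow_eq_zero, zero_mul,
    mul_zero, add_zero]
  · simp only [map_add, tensorDer_tmul, xuDer, mkDerivation_X, Sum.elim_inl, Sum.elim_inr,
      Fin.sum_univ_three, TensorProduct.add_tmul, TensorProduct.tmul_add, TensorProduct.neg_tmul,
      ← TensorProduct.smul_tmul', TensorProduct.tmul_smul]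
    module
  · simp only [map_add, tensorDer_tmul, xuDer, mkDerivation_X, Sum.elim_inl, Sum.elim_inr,
      Fin.sum_univ_three, TensorProduct.add_tmul, TensorProduct.tmul_add,
      TensorProduct.tmul_neg, ← TensorProduct.smul_tmul', TensorProduct.tmul_smul]
    module

/-- The summands of the two trinomials are ordered so that the leading variables of the right factor
are `x₁` and `u₃`, as in the Casimir element. -/
theorem invariantTensor_eq_sum [CharZero K] : invariantTensor K d₁ d₂ =
    ∑ i ∈ Finset.range (d₁ + 1), ∑ j ∈ Finset.range (d₁ + 1 - i),
      ∑ k ∈ Finset.range (d₂ + 1), ∑ l ∈ Finset.range (d₂ + 1 - k),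
        (trinom K d₁ i j * trinom K d₂ k l) •
          (mon K (d₁ - (i + j)) i j k l (d₂ - (k + l)) ⊗ₜ[K]
            (X (Sum.inl 0) ^ (d₁ - (i + j)) * X (Sum.inl 1) ^ i * X (Sum.inl 2) ^ j
              * (X (Sum.inr 2) ^ (d₂ - (k + l)) * X (Sum.inr 0) ^ k * X (Sum.inr 1) ^ l))) := by
  rw [invariantTensor, add_add_pow_eq_sum_trinom (K := K), add_add_pow_eq_sum_trinom (K := K)]
  rw [Finset.sum_mul]
  refine Finset.sum_congr rfl fun i _ => ?_
  rw [Finset.sum_mul]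
  refine Finset.sum_congr rfl fun j _ => ?_
  rw [Finset.mul_sum]
  refine Finset.sum_congr rfl fun k _ => ?_
  rw [Finset.mul_sum]
  refine Finset.sum_congr rfl fun l _ => ?_
  rw [smul_mul_smul_comm]
  simp only [Algebra.TensorProduct.tmul_pow, Algebra.TensorProduct.tmul_mul_tmul]
  congr 2
  simp only [mon]
  ring

/-- The linear map `f ⊗ g ↦ ψ(f) g` to `K[A, X, U]`, where `ψ` is given by the family `B`. -/
def evalTensor (B : FormIdx d₁ → FormIdx d₂ → CoordRing K n) :
    XURing K ⊗[K] XURing K →ₗ[K] FullRing K n :=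
  TensorProduct.lift ((LinearMap.mul K (FullRing K n)).compl₁₂
    ((rename Sum.inl : CoordRing K n →ₐ[K] FullRing K n).toLinearMap ∘ₗ dualSwap B)
    (rename Sum.inr : XURing K →ₐ[K] FullRing K n).toLinearMap)

theorem evalTensor_tmul (B : FormIdx d₁ → FormIdx d₂ → CoordRing K n) (f g : XURing K) :
    evalTensor B (f ⊗ₜ g) = rename Sum.inl (dualSwap B f) * rename Sum.inr g := rfl

theorem evalTensor_invariantTensor [CharZero K] (B : FormIdx d₁ → FormIdx d₂ → CoordRing K n) :
    evalTensor B (invariantTensor K d₁ d₂) = casimir B := by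
  rw [invariantTensor_eq_sum, casimir]
  simp only [map_sum, map_smul, evalTensor_tmul, dualSwap_mon, map_mul, map_pow, rename_X,
    xVar, uVar, mul_assoc]

/-- Equivariance of `ψ` is assumed at the single vector `f`, since it is available only within
bidegree `(d₁, d₂)`. -/
theorem fullDer_evalTensor {z : Matrix (Fin 3) (Fin 3) K}
    {B : FormIdx d₁ → FormIdx d₂ → CoordRing K n} {f : XURing K}
    (h : coordDer K n z (dualSwap B f) = dualSwap B (xuDer K z f)) (g : XURing K) :
    fullDer K n z (evalTensor B (f ⊗ₜ g)) = evalTensor B (tensorDer z (f ⊗ₜ g)) := by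
  rw [tensorDer_tmul, map_add, evalTensor_tmul, evalTensor_tmul, evalTensor_tmul,
    Derivation.leibniz, fullDer_rename_inl, fullDer_rename_inr, h, smul_eq_mul, smul_eq_mul]
  ring

theorem IsConcomitantFamily.fullDer_casimir [CharZero K] {a : CoordRing K n}
    {B : FormIdx d₁ → FormIdx d₂ → CoordRing K n}
    (ha : IsHighest (unitOps K (CoordRing K n)) (monWeight K d₁ d₂) a)
    (hB : IsConcomitantFamily a B) {z : Matrix (Fin 3) (Fin 3) K} (hz : z ∈ sl3 K) :
    fullDer K n z (casimir B) = 0 := by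
  have equiv : ∀ f ∈ bidegreeSpace K d₁ d₂,
      coordDer K n z (dualSwap B f) = dualSwap B (xuDer K z f) := by
    intro f hf
    have e1 := lie_eq_sum_unitOps (mem_sl3.1 hz) (dualSwap B f)
    have e2 := lie_eq_sum_unitOps (mem_sl3.1 hz) f
    refine e1.trans (Eq.trans ?_ (congrArg (dualSwap B) e2).symm)
    simp only [map_sum, map_smul, hB.unitOps_dualSwap ha _ _ hf]
  rw [← evalTensor_invariantTensor, ← map_zero (evalTensor B),
    ← tensorDer_invariantTensor (d₁ := d₁) (d₂ := d₂) z, invariantTensor_eq_sum]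
  simp only [map_sum, map_smul]
  refine Finset.sum_congr rfl fun i hi => Finset.sum_congr rfl fun j hj =>
    Finset.sum_congr rfl fun k hk => Finset.sum_congr rfl fun l hl => ?_
  rw [Finset.mem_range] at hi hj hk hl
  rw [Derivation.map_smul, fullDer_evalTensor (equiv _ (mon_mem_bidegreeSpace
    (by omega) (by omega)))]

end Invariance

/-! ### Homogeneity and nonvanishing of the Casimir element -/

section Homogeneity

variable {K : Type*} [Field K] {n d₁ d₂ : ℕ}

theorem isWeightedHomogeneous_rename {σ τ : Type*} {w : τ → ℕ} {f : σ → τ}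
    {p : MvPolynomial σ K} {m : ℕ} (hp : IsWeightedHomogeneous (w ∘ f) p m) :
    IsWeightedHomogeneous w (rename f p) m := by
  intro d hd
  obtain ⟨d', rfl, hd'⟩ := coeff_rename_ne_zero f p d hd
  rw [← hp hd', Finsupp.weight_apply, Finsupp.weight_apply,
    Finsupp.sum_mapDomain_index (by simp) (by simp [add_mul])]
  rfl

theorem isWeightedHomogeneous_zero_weight {σ : Type*} (p : MvPolynomial σ K) :
    IsWeightedHomogeneous (fun _ : σ => (0 : ℕ)) p 0 := by
  intro d _
  simp [Finsupp.weight_apply]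

theorem isHomogeneous_mkDerivation {σ : Type*} {f : σ → MvPolynomial σ K}
    (hf : ∀ i, (f i).IsHomogeneous 1) {p : MvPolynomial σ K} {m : ℕ} (hp : p.IsHomogeneous m) :
    (mkDerivation K f p).IsHomogeneous m := by
  classical
  rw [p.as_sum, map_sum]
  refine IsHomogeneous.sum _ _ _ fun s hs => ?_
  have hdeg : s.degree = m := by
    have := hp (mem_support_iff.1 hs)
    rwa [Finsupp.degree_eq_weight_one]
  rw [mkDerivation_monomial]
  refine (homogeneousSubmodule σ K m).smul_mem _ ?_
  refine sum_mem fun i hi => ?_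
  have hi1 : 1 ≤ s i := Nat.one_le_iff_ne_zero.2 (Finsupp.mem_support_iff.1 hi)
  have hle : Finsupp.single i 1 ≤ s := by
    intro j
    by_cases h : i = j
    · subst h; simpa using hi1
    · simp [h]
  have hd : (s - Finsupp.single i 1).degree + 1 = m := by
    rw [← hdeg]
    conv_rhs => rw [← tsub_add_cancel_of_le hle]
    simp
  simp only [smul_eq_mul]
  rw [mem_homogeneousSubmodule, ← hd]
  exact (isHomogeneous_monomial _ rfl).mul (hf i)

theorem isHomogeneous_aVar (i j : ℕ) : (aVar K n i j).IsHomogeneous 1 := by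
  rw [aVar]
  split_ifs
  · exact isHomogeneous_X _ _
  · exact isHomogeneous_zero _ _ _

theorem isHomogeneous_coordDer (z : Matrix (Fin 3) (Fin 3) K) {p : CoordRing K n} {m : ℕ}
    (hp : p.IsHomogeneous m) : (coordDer K n z p).IsHomogeneous m := by
  refine isHomogeneous_mkDerivation (fun p => ?_) hp
  have h : ∀ (c : K) (i j : ℕ),
      c • aVar K n i j ∈ homogeneousSubmodule (FormIdx n) K 1 := fun c i j =>
    Submodule.smul_mem _ c (isHomogeneous_aVar i j)
  exact add_mem (add_mem (add_mem (add_mem (add_mem (add_mem (h _ _ _) (h _ _ _)) (h _ _ _))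
    (h _ _ _)) (h _ _ _)) (h _ _ _)) (h _ _ _)

theorem envelopingSpan_le_homogeneousSubmodule {a : CoordRing K n} {m : ℕ}
    (ha : a.IsHomogeneous m) : envelopingSpan a ≤ homogeneousSubmodule (FormIdx n) K m := by
  rw [envelopingSpan_eq_lowerSpan]
  refine lowerSpan_le ?_ ?_
  · rintro _ rfl
    exact ha
  · intro i j _ v hv
    exact isHomogeneous_coordDer _ hv

variable {B : FormIdx d₁ → FormIdx d₂ → CoordRing K n}

/-- The Casimir element is weighted homogeneous for every weight that is constant on each of the
groups of variables `A`, `X`, `U`. -/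
theorem isWeightedHomogeneous_casimir {m α β γ μ : ℕ}
    (hB : ∀ p q, (IsWeightedHomogeneous (fun _ : FormIdx n => α) (B p q) μ))
    (hm : μ + (d₁ * β + d₂ * γ) = m) {w : FormIdx n ⊕ (Fin 3 ⊕ Fin 3) → ℕ}
    (hw : w = Sum.elim (fun _ => α) (Sum.elim (fun _ => β) (fun _ => γ))) :
    IsWeightedHomogeneous w (casimir B) m := by
  refine IsWeightedHomogeneous.sum _ _ _ fun i hi => IsWeightedHomogeneous.sum _ _ _ fun j hj =>
    IsWeightedHomogeneous.sum _ _ _ fun k hk => IsWeightedHomogeneous.sum _ _ _ fun l hl => ?_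
  rw [Finset.mem_range] at hi hj hk hl
  refine (weightedHomogeneousSubmodule K w m).smul_mem _ ?_
  have hx : ∀ r, IsWeightedHomogeneous w (xVar K n r) β := by
    intro r
    have := isWeightedHomogeneous_X K w (Sum.inr (Sum.inl r))
    rwa [hw] at this ⊢
  have hu : ∀ r, IsWeightedHomogeneous w (uVar K n r) γ := by
    intro r
    have := isWeightedHomogeneous_X K w (Sum.inr (Sum.inr r))
    rwa [hw] at this ⊢
  have hA : IsWeightedHomogeneous w (rename Sum.inl (entry B i j k l) : FullRing K n) μ := by
    refine isWeightedHomogeneous_rename ?_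
    rw [entry]
    split_ifs
    · rw [hw]
      exact hB _ _
    · exact isWeightedHomogeneous_zero _ _ _
  have h := (hA.mul ((((hx 0).pow (d₁ - (i + j))).mul ((hx 1).pow i)).mul ((hx 2).pow j))).mul
    ((((hu 2).pow (d₂ - (k + l))).mul ((hu 0).pow k)).mul ((hu 1).pow l))
  have e : m = μ + ((d₁ - (i + j)) • β + i • β + j • β)
      + ((d₂ - (k + l)) • γ + k • γ + l • γ) := by
    rw [← add_smul, ← add_smul, ← add_smul, ← add_smul, ← hm,
      show d₁ - (i + j) + i + j = d₁ by omega, show d₂ - (k + l) + k + l = d₂ by omega,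
      smul_eq_mul, smul_eq_mul, add_assoc]
  rw [mem_weightedHomogeneousSubmodule, e]
  exact h

/-- Specializing `x = (1, 0, 0)` and `u = (0, 0, 1)` leaves only the entry of index zero. -/
theorem casimir_ne_zero [CharZero K] (h : entry B 0 0 0 0 ≠ 0) : casimir B ≠ 0 := by
  intro h0
  refine h ?_
  obtain ⟨ψ, hr, hx, hu⟩ : ∃ ψ : FullRing K n →ₐ[K] CoordRing K n,
      (∀ p, ψ (rename Sum.inl p) = p) ∧ (∀ i, ψ (xVar K n i) = ![1, 0, 0] i) ∧
        ∀ i, ψ (uVar K n i) = ![0, 0, 1] i := by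
    refine ⟨aeval (Sum.elim X (Sum.elim ![1, 0, 0] ![0, 0, 1])), fun p => ?_, fun i => ?_,
      fun i => ?_⟩
    · rw [aeval_rename, Sum.elim_comp_inl, aeval_X_left, AlgHom.id_apply]
    · rw [xVar, aeval_X, Sum.elim_inr, Sum.elim_inl]
    · rw [uVar, aeval_X, Sum.elim_inr, Sum.elim_inr]
  have h' := congrArg ψ h0
  simp only [casimir, map_sum, map_smul, map_mul, map_pow, map_zero, hr, hx, hu] at h'
  rw [Finset.sum_eq_single 0, Finset.sum_eq_single 0, Finset.sum_eq_single 0,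
    Finset.sum_eq_single 0] at h'
  · simpa [trinom_ne_zero] using h'
  · intro l _ hl
    simp [hl]
  · simp
  · intro k _ hk
    exact Finset.sum_eq_zero fun l _ => by simp [hk]
  · simp
  · intro j _ hj
    exact Finset.sum_eq_zero fun k _ => Finset.sum_eq_zero fun l _ => by simp [hj]
  · simp
  · intro i _ hi
    exact Finset.sum_eq_zero fun j _ => Finset.sum_eq_zero fun k _ =>
      Finset.sum_eq_zero fun l _ => by simp [hi]
  · simp

end Homogeneity

/-! ### Derivations acting on coefficients -/

section CoeffDerivation

variable {K σ S : Type*} [Field K] [CommRing S] [Algebra K S]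

/-- A derivation of the coefficient ring, applied to each coefficient of a polynomial. -/
def coeffDer (δ : Derivation K S S) : Derivation K (MvPolynomial σ S) (MvPolynomial σ S) :=
  Derivation.mk'
    { toFun := fun p => .ofCoeff (Finsupp.mapRange δ (map_zero δ) (AddMonoidAlgebra.coeff p))
      map_add' := fun p q => by
        ext m
        exact map_add δ (coeff m p) (coeff m q)
      map_smul' := fun c p => by
        ext m
        exact δ.map_smul c (coeff m p) }
    fun p q => by
      classical
      ext m
      change δ (coeff m (p * q)) = _
      rw [coeff_add, smul_eq_mul, smul_eq_mul, mul_comm q, coeff_mul, coeff_mul, coeff_mul,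
        map_sum, ← Finset.sum_add_distrib]
      refine Finset.sum_congr rfl fun x _ => ?_
      rw [Derivation.leibniz, smul_eq_mul, smul_eq_mul, mul_comm (coeff x.2 q)]
      rfl

theorem coeff_coeffDer (δ : Derivation K S S) (m : σ →₀ ℕ) (p : MvPolynomial σ S) :
    coeff m (coeffDer δ p) = δ (coeff m p) := rfl

theorem coeffDer_C (δ : Derivation K S S) (s : S) :
    coeffDer δ (C s : MvPolynomial σ S) = C (δ s) := by
  classical
  ext m
  rw [coeff_coeffDer, coeff_C, coeff_C]
  split_ifs <;> simp

theorem coeffDer_X (δ : Derivation K S S) (i : σ) :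
    coeffDer δ (X i : MvPolynomial σ S) = 0 := by
  classical
  ext m
  rw [coeff_coeffDer, coeff_X, coeff_zero]
  split_ifs <;> simp

end CoeffDerivation

/-! ### The generic form and the infinitesimal action -/

section GenericForm

variable {K : Type*} [Field K] {n : ℕ}

/-- The exponent of the monomial of a ternary form with index `(i, j)`. -/
abbrev formExp (p : FormIdx n) : Fin 3 →₀ ℕ :=
  Finsupp.equivFunOnFinite.symm ![n - (p.1.1 + p.1.2), p.1.1, p.1.2]

theorem degree_fin_three (m : Fin 3 →₀ ℕ) : m.degree = m 0 + m 1 + m 2 := by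
  rw [Finsupp.degree_eq_sum, Fin.sum_univ_three]

theorem degree_formExp (p : FormIdx n) : (formExp p).degree = n := by
  have := p.2
  rw [degree_fin_three]
  simp
  omega

theorem eq_formExp {m : Fin 3 →₀ ℕ} (h : m.degree = n) :
    ∃ p : FormIdx n, m = formExp p := by
  rw [degree_fin_three] at h
  refine ⟨⟨(m 1, m 2), by omega⟩, ?_⟩
  ext i
  fin_cases i <;> simp
  omega

theorem eq_of_isHomogeneous_of_coeff_formExp {S : Type*} [CommRing S]
    {P Q : MvPolynomial (Fin 3) S} (hP : P.IsHomogeneous n) (hQ : Q.IsHomogeneous n)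
    (h : ∀ p : FormIdx n, coeff (formExp p) P = coeff (formExp p) Q) : P = Q := by
  ext m
  by_cases hm : m.degree = n
  · obtain ⟨p, rfl⟩ := eq_formExp hm
    exact h p
  · rw [hP.coeff_eq_zero hm, hQ.coeff_eq_zero hm]

theorem isHomogeneous_genericForm : (genericForm K n).IsHomogeneous n := by
  refine IsHomogeneous.sum _ _ _ fun i hi => IsHomogeneous.sum _ _ _ fun j hj => ?_
  rw [Finset.mem_range] at hi hj
  have h := (isHomogeneous_C (Fin 3) (trinom K n i j • aVar K n i j)).mul
    ((((isHomogeneous_X (CoordRing K n) (0 : Fin 3)).pow (n - (i + j))).mul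
      ((isHomogeneous_X (CoordRing K n) (1 : Fin 3)).pow i)).mul
      ((isHomogeneous_X (CoordRing K n) (2 : Fin 3)).pow j))
  convert h using 1
  omega

theorem coeff_genericForm {m : Fin 3 →₀ ℕ} (hm : m.degree = n) :
    coeff m (genericForm K n) = trinom K n (m 1) (m 2) • aVar K n (m 1) (m 2) := by
  classical
  rw [degree_fin_three] at hm
  have hX : ∀ i j, (X 0 ^ (n - (i + j)) * X 1 ^ i * X 2 ^ j : MvPolynomial (Fin 3) (CoordRing K n))
      = monomial (Finsupp.single 0 (n - (i + j)) + Finsupp.single 1 i + Finsupp.single 2 j) 1 := by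
    intro i j
    rw [X_pow_eq_monomial, X_pow_eq_monomial, X_pow_eq_monomial, monomial_mul, monomial_mul,
      mul_one, mul_one]
  simp only [genericForm, coeff_sum, hX, coeff_C_mul, coeff_monomial]
  have key : ∀ i j : ℕ, Finsupp.single 0 (n - (i + j)) + Finsupp.single 1 i + Finsupp.single 2 j = m
      ↔ i + j ≤ n ∧ i = m 1 ∧ j = m 2 := by
    intro i j
    constructor
    · rintro rfl
      simp at hm ⊢
      omega
    · rintro ⟨h, rfl, rfl⟩
      ext r
      fin_cases r <;> simp
      omega
  simp only [key]
  rw [Finset.sum_eq_single (m 1), Finset.sum_eq_single (m 2)]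
  · rw [if_pos ⟨by omega, rfl, rfl⟩, mul_one]
  · intro j _ hj
    rw [if_neg (by tauto), mul_zero]
  · intro h
    rw [Finset.mem_range] at h
    omega
  · intro i _ hi
    refine Finset.sum_eq_zero fun j _ => ?_
    rw [if_neg (by tauto), mul_zero]
  · intro h
    rw [Finset.mem_range] at h
    omega

theorem coeff_formExp_genericForm (p : FormIdx n) :
    coeff (formExp p) (genericForm K n) = trinom K n p.1.1 p.1.2 • X p := by
  rw [coeff_genericForm (degree_formExp p)]
  congr 1
  exact dif_pos p.2

variable (K n) in
/-- The variable `a_{i,j}` attached to the monomial `x₁^{n-(i+j)} x₂^i x₃^j`. -/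
def expVar (m : Fin 3 →₀ ℕ) : CoordRing K n := aVar K n (m 1) (m 2)

/-- Indexing by exponents makes the action symmetric in the three coordinates. The factor `m s`
vanishes where the subtraction would be truncated. -/
theorem coordDer_expVar (z : Matrix (Fin 3) (Fin 3) K) {m : Fin 3 →₀ ℕ} (hm : m.degree = n) :
    coordDer K n z (expVar K n m) = ∑ r : Fin 3, ∑ s : Fin 3, (z r s * (m s : K)) •
      expVar K n (m - Finsupp.single s 1 + Finsupp.single r 1) := by
  rw [degree_fin_three] at hm
  rw [expVar, coordDer_aVar z (m 1) (m 2) (m 0) (by omega), aVarImage]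
  simp only [expVar, Fin.sum_univ_three, Finsupp.add_apply, Finsupp.tsub_apply]
  generalize m 0 = k
  generalize m 1 = i
  generalize m 2 = j
  rcases i with _ | i <;> rcases j with _ | j <;> simp <;> module

theorem trinom_eq_div_prod {m : Fin 3 →₀ ℕ} (hm : m.degree = n) :
    trinom K n (m 1) (m 2) = n ! / ∏ i, ((m i)! : K) := by
  rw [degree_fin_three] at hm
  rw [trinom, show n - (m 1 + m 2) = m 0 by omega, Fin.prod_univ_three]
  congr 1
  ring

theorem prod_factorial_add_single (m : Fin 3 →₀ ℕ) (r : Fin 3) :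
    ∏ i, (((m + Finsupp.single r 1 : Fin 3 →₀ ℕ) i)! : K) = (m r + 1) * ∏ i, ((m i)! : K) := by
  fin_cases r <;> simp [Fin.prod_univ_three, Nat.factorial_succ] <;> ring

variable [CharZero K]

/-- The right side does not depend on `r`; this is why the trinomial normalization makes the action
on coefficients integral. -/
theorem trinom_add_single {m : Fin 3 →₀ ℕ} (r : Fin 3)
    (hm : (m + Finsupp.single r 1).degree = n) :
    trinom K n ((m + Finsupp.single r 1 : Fin 3 →₀ ℕ) 1) ((m + Finsupp.single r 1 : Fin 3 →₀ ℕ) 2)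
      * (m r + 1) = n ! / ∏ i, ((m i)! : K) := by
  rw [trinom_eq_div_prod hm, prod_factorial_add_single]
  have h1 : ∏ i, ((m i)! : K) ≠ 0 :=
    Finset.prod_ne_zero_iff.2 fun i _ => Nat.cast_ne_zero.2 (Nat.factorial_ne_zero _)
  have h2 : (m r : K) + 1 ≠ 0 := Nat.cast_add_one_ne_zero _
  field_simp

/-- The infinitesimal form of `F(g x)`: a matrix acts on the coefficients of the generic form as a
vector field on its variables. -/
theorem coeffDer_genericForm (z : Matrix (Fin 3) (Fin 3) K) :
    coeffDer (coordDer K n z) (genericForm K n) =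
      ∑ r, ∑ s, C (C (z r s)) * X s * pderiv r (genericForm K n) := by
  classical
  ext1 m
  rw [coeff_coeffDer]
  simp only [coeff_sum, mul_assoc, coeff_C_mul]
  -- With `m = m' + e_s`, both normalizations reduce to `n! / ∏ m'ᵢ!`, once through `s` and once
  -- through `r`.
  have key : ∀ r s, coeff m (X s * pderiv r (genericForm K n)) =
      if m.degree = n then (trinom K n (m 1) (m 2) * m s) •
        expVar K n (m - Finsupp.single s 1 + Finsupp.single r 1) else 0 := by
    intro r s
    by_cases hs : m s = 0
    · rw [coeff_X_mul', if_neg (by simpa using hs), hs]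
      simp
    · obtain ⟨m, rfl⟩ : ∃ m', m = m' + Finsupp.single s 1 :=
        ⟨m - Finsupp.single s 1, (tsub_add_cancel_of_le (by simpa using by omega)).symm⟩
      rw [add_comm m, coeff_X_mul, add_comm _ m, coeff_pderiv, add_tsub_cancel_right]
      split_ifs with hm
      · have hm' : (m + Finsupp.single r 1).degree = n := by simpa using hm
        rw [coeff_genericForm hm', Finsupp.add_apply m _ s, Finsupp.single_eq_same, Nat.cast_add,
          Nat.cast_one, trinom_add_single s hm, ← trinom_add_single r hm', mul_comm, mul_smul,
          smul_comm, expVar]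
        simp [smul_eq_C_mul]
      · rw [isHomogeneous_genericForm.coeff_eq_zero (by simpa using hm), zero_mul]
  simp only [key]
  split_ifs with hm
  · rw [coeff_genericForm hm, Derivation.map_smul]
    refine (congrArg _ (coordDer_expVar z hm)).trans ?_
    simp only [Finset.smul_sum, ← smul_eq_C_mul, smul_smul]
    refine Finset.sum_congr rfl fun r _ => Finset.sum_congr rfl fun s _ => ?_
    congr 1
    ring
  · rw [isHomogeneous_genericForm.coeff_eq_zero hm]
    simp

end GenericForm

/-! ### Linear substitutions in the generic form -/

section Substitution

variable {K S : Type*} [Field K] [CommRing S] [Algebra K S] {n : ℕ}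

/-- The `r`-th coordinate of `M x`. -/
def linForm (M : Matrix (Fin 3) (Fin 3) S) (r : Fin 3) : MvPolynomial (Fin 3) S :=
  ∑ s, C (M r s) * X s

theorem isHomogeneous_linForm (M : Matrix (Fin 3) (Fin 3) S) (r : Fin 3) :
    (linForm M r).IsHomogeneous 1 :=
  IsHomogeneous.sum _ _ _ fun s _ => by
    simpa using (isHomogeneous_C (Fin 3) (M r s)).mul (isHomogeneous_X S s)

theorem bind₁_linForm_linForm (M N : Matrix (Fin 3) (Fin 3) S) (r : Fin 3) :
    bind₁ (linForm N) (linForm M r) = linForm (M * N) r := by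
  simp only [linForm, map_sum, map_mul, bind₁_C_right, bind₁_X_right, Matrix.mul_apply,
    Finset.mul_sum, Finset.sum_mul]
  rw [Finset.sum_comm]
  exact Finset.sum_congr rfl fun s _ => Finset.sum_congr rfl fun t _ => by ring

theorem linForm_one (r : Fin 3) : linForm (1 : Matrix (Fin 3) (Fin 3) S) r = X r := by
  simp [linForm, Matrix.one_apply]

/-- The homomorphism `K[A] → S` which gives the coefficients of `F(M x)`, where `F` is the generic
form with its coefficients mapped to `S` by `ι`. -/
def substHom (ι : CoordRing K n →ₐ[K] S) (M : Matrix (Fin 3) (Fin 3) S) : CoordRing K n →ₐ[K] S :=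
  aeval fun p => (trinom K n p.1.1 p.1.2)⁻¹ •
    coeff (formExp p) (bind₁ (linForm M) (map (ι : CoordRing K n →+* S) (genericForm K n)))

theorem coeff_formExp_map_genericForm (ι : CoordRing K n →ₐ[K] S) (p : FormIdx n) :
    coeff (formExp p) (map (ι : CoordRing K n →+* S) (genericForm K n)) =
      trinom K n p.1.1 p.1.2 • ι (X p) := by
  rw [coeff_map, coeff_formExp_genericForm]
  exact map_smul ι _ _

variable [CharZero K]

/-- Each variable of `K[A]` is a coefficient of the generic form up to a nonzero scalar. Identities
between substitutions can thus be checked on the form. -/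
theorem algHom_ext_of_map_genericForm {f g : CoordRing K n →ₐ[K] S}
    (h : map (f : CoordRing K n →+* S) (genericForm K n) =
      map (g : CoordRing K n →+* S) (genericForm K n)) : f = g := by
  refine MvPolynomial.algHom_ext fun p => ?_
  have := congrArg (coeff (formExp p)) h
  rw [coeff_formExp_map_genericForm, coeff_formExp_map_genericForm] at this
  exact smul_right_injective S (trinom_ne_zero (K := K) n p.1.1 p.1.2) this

theorem map_substHom_genericForm (ι : CoordRing K n →ₐ[K] S) (M : Matrix (Fin 3) (Fin 3) S) :
    map (substHom ι M : CoordRing K n →+* S) (genericForm K n) =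
      bind₁ (linForm M) (map (ι : CoordRing K n →+* S) (genericForm K n)) := by
  refine eq_of_isHomogeneous_of_coeff_formExp (isHomogeneous_genericForm.map _) ?_ fun p => ?_
  · have := (isHomogeneous_genericForm (K := K) (n := n)).map (ι : CoordRing K n →+* S)
    simpa using this.aeval (linForm M) (isHomogeneous_linForm M)
  · rw [coeff_formExp_map_genericForm, substHom, aeval_X,
      smul_inv_smul₀ (trinom_ne_zero n p.1.1 p.1.2)]

theorem substHom_substHom (ι : CoordRing K n →ₐ[K] S) (M N : Matrix (Fin 3) (Fin 3) S) :
    substHom (substHom ι M) N = substHom ι (M * N) := by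
  apply algHom_ext_of_map_genericForm
  rw [map_substHom_genericForm, map_substHom_genericForm, map_substHom_genericForm, bind₁_bind₁]
  simp only [bind₁_linForm_linForm]

theorem substHom_one (ι : CoordRing K n →ₐ[K] S) : substHom ι 1 = ι := by
  apply algHom_ext_of_map_genericForm
  rw [map_substHom_genericForm, show linForm (1 : Matrix (Fin 3) (Fin 3) S) = X from
    funext linForm_one, bind₁_X_left, AlgHom.id_apply]

theorem comp_substHom {T : Type*} [CommRing T] [Algebra K T] (f : S →ₐ[K] T)
    (ι : CoordRing K n →ₐ[K] S) (M : Matrix (Fin 3) (Fin 3) S) :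
    f.comp (substHom ι M) = substHom (f.comp ι) (M.map f) := by
  apply algHom_ext_of_map_genericForm
  rw [map_substHom_genericForm]
  have h : map ((f.comp (substHom ι M) : CoordRing K n →ₐ[K] T) : CoordRing K n →+* T)
      (genericForm K n) =
      map (f : S →+* T) (map (substHom ι M : CoordRing K n →+* S) (genericForm K n)) := by
    rw [map_map]
    rfl
  rw [h, map_substHom_genericForm, map_bind₁, map_map]
  congr 2
  funext r
  simp [linForm]

/-- The flow of the vector field by which `z` acts: if `M' = M z` for a derivation `δ` of `S`, then
`δ` of the coefficients of `F(M x)` is given by the action of `z` on `K[A]`. -/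
theorem derivation_substHom {δ : Derivation K S S} {ι : CoordRing K n →ₐ[K] S}
    (hι : ∀ f, δ (ι f) = 0) {M : Matrix (Fin 3) (Fin 3) S} {z : Matrix (Fin 3) (Fin 3) K}
    (hM : ∀ i j, δ (M i j) = (M * z.map (algebraMap K S)) i j) (p : FormIdx n) :
    δ (substHom ι M (X p)) = substHom ι M (coordDer K n z (X p)) := by
  set Φ := substHom ι M with hΦ
  let E : Derivation K (MvPolynomial (Fin 3) S) (MvPolynomial (Fin 3) S) :=
    ∑ r, ∑ s, (C (algebraMap K S (z r s)) * X s : MvPolynomial (Fin 3) S) •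
      (pderiv r).restrictScalars K
  have hE : ∀ q, E q = ∑ r, ∑ s, C (algebraMap K S (z r s)) * X s * pderiv r q := by
    intro q
    simp only [E, Fin.sum_univ_three, Derivation.add_apply, Derivation.smul_apply, smul_eq_mul]
    rfl
  -- Since `δ` kills the image of `ι`, the polynomial `G(M x)` varies through `M` only, and `M' = M
  -- z` amounts to differentiating along the vector field `x ↦ z x`.
  have agree : ∀ G : MvPolynomial (Fin 3) (CoordRing K n),
      coeffDer δ (bind₁ (linForm M) (map (ι : CoordRing K n →+* S) G)) =
        E (bind₁ (linForm M) (map (ι : CoordRing K n →+* S) G)) := by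
    intro G
    induction G using MvPolynomial.induction_on with
    | C c =>
      rw [map_C, bind₁_C_right, coeffDer_C, hE]
      simp [hι]
    | add G H hG hH => simp only [map_add, hG, hH]
    | mul_X G r hG =>
      rw [map_mul, map_mul, Derivation.leibniz, Derivation.leibniz, hG, map_X, bind₁_X_right]
      congr 2
      rw [hE]
      have h1 : ∀ t, pderiv t (linForm M r) = C (M r t) := fun t => by
        simp [linForm, pderiv_X, Pi.single_apply]
      have h2 : coeffDer δ (linForm M r) =
          ∑ s, ∑ t, C (M r t * algebraMap K S (z t s)) * X s := by
        simp only [linForm, map_sum, Derivation.leibniz, coeffDer_C, coeffDer_X, smul_eq_mul,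
          hM, Matrix.mul_apply, Matrix.map_apply, Finset.mul_sum, mul_zero, zero_add]
        exact Finset.sum_congr rfl fun s _ => Finset.sum_congr rfl fun t _ => mul_comm _ _
      simp only [h1, h2, map_mul]
      rw [Finset.sum_comm]
      exact Finset.sum_congr rfl fun s _ => Finset.sum_congr rfl fun t _ => by ring
  have h1 : coeffDer δ (map (Φ : CoordRing K n →+* S) (genericForm K n)) =
      map (Φ : CoordRing K n →+* S) (coeffDer (coordDer K n z) (genericForm K n)) := by
    rw [map_substHom_genericForm, agree, hE, coeffDer_genericForm, ← map_substHom_genericForm]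
    simp only [map_sum, map_mul, map_C, map_X, pderiv_map]
    refine Finset.sum_congr rfl fun r _ => Finset.sum_congr rfl fun s _ => ?_
    rw [← Φ.commutes]
    rfl
  have h2 := congrArg (coeff (formExp p)) h1
  rw [coeff_coeffDer, coeff_formExp_map_genericForm, coeff_map, coeff_coeffDer,
    coeff_formExp_genericForm, Derivation.map_smul, Derivation.map_smul] at h2
  exact smul_right_injective S (trinom_ne_zero (K := K) n p.1.1 p.1.2)
    (h2.trans (map_smul Φ _ _))

end Substitution

/-! ### The action on `K[A, X, U]` with parameters -/

section Action

variable {K S : Type*} [Field K] [CommRing S] [Algebra K S] {n : ℕ}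

/-- The substitution `F ↦ F ∘ M`, `x ↦ N x`, `ℓ ↦ ℓ ∘ M` in `S`-valued polynomial functions. -/
def actHom (ι : FullRing K n →ₐ[K] S) (M N : Matrix (Fin 3) (Fin 3) S) : FullRing K n →ₐ[K] S :=
  aeval (Sum.elim (fun p => substHom (ι.comp (rename Sum.inl)) M (X p))
    (Sum.elim (fun i => ∑ j, N i j * ι (xVar K n j)) (fun j => ∑ i, M i j * ι (uVar K n i))))

theorem actHom_xVar (ι : FullRing K n →ₐ[K] S) (M N : Matrix (Fin 3) (Fin 3) S) (i : Fin 3) :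
    actHom ι M N (xVar K n i) = ∑ j, N i j * ι (xVar K n j) := by
  rw [actHom, xVar, aeval_X]
  rfl

theorem actHom_uVar (ι : FullRing K n →ₐ[K] S) (M N : Matrix (Fin 3) (Fin 3) S) (j : Fin 3) :
    actHom ι M N (uVar K n j) = ∑ i, M i j * ι (uVar K n i) := by
  rw [actHom, uVar, aeval_X]
  rfl

theorem actHom_comp_rename (ι : FullRing K n →ₐ[K] S) (M N : Matrix (Fin 3) (Fin 3) S) :
    (actHom ι M N).comp (rename Sum.inl) = substHom (ι.comp (rename Sum.inl)) M := by
  refine MvPolynomial.algHom_ext fun p => ?_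
  rw [AlgHom.comp_apply, rename_X, actHom, aeval_X, Sum.elim_inl]

theorem fullRing_algHom_ext {f g : FullRing K n →ₐ[K] S}
    (ha : f.comp (rename Sum.inl) = g.comp (rename Sum.inl))
    (hx : ∀ i, f (xVar K n i) = g (xVar K n i)) (hu : ∀ i, f (uVar K n i) = g (uVar K n i)) :
    f = g := by
  refine MvPolynomial.algHom_ext ?_
  rintro (p | i | i)
  · simpa using DFunLike.congr_fun ha (X p)
  · exact hx i
  · exact hu i

variable [CharZero K]

theorem comp_actHom {T : Type*} [CommRing T] [Algebra K T] (f : S →ₐ[K] T)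
    (ι : FullRing K n →ₐ[K] S) (M N : Matrix (Fin 3) (Fin 3) S) :
    f.comp (actHom ι M N) = actHom (f.comp ι) (M.map f) (N.map f) := by
  refine fullRing_algHom_ext ?_ (fun i => ?_) fun i => ?_
  · rw [AlgHom.comp_assoc, actHom_comp_rename, actHom_comp_rename, comp_substHom, AlgHom.comp_assoc]
  · simp [actHom_xVar]
  · simp [actHom_uVar]

theorem actHom_one (ι : FullRing K n →ₐ[K] S) : actHom ι 1 1 = ι := by
  refine fullRing_algHom_ext ?_ (fun i => ?_) fun i => ?_
  · rw [actHom_comp_rename, substHom_one]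
  · simp [actHom_xVar, Matrix.one_apply]
  · simp [actHom_uVar, Matrix.one_apply]

theorem actHom_actHom (ι : FullRing K n →ₐ[K] S) (M N M' N' : Matrix (Fin 3) (Fin 3) S) :
    actHom (actHom ι M N) M' N' = actHom ι (M * M') (N' * N) := by
  refine fullRing_algHom_ext ?_ (fun i => ?_) fun i => ?_
  · rw [actHom_comp_rename, actHom_comp_rename, actHom_comp_rename, substHom_substHom]
  · simp only [actHom_xVar, Matrix.mul_apply, Finset.mul_sum, Finset.sum_mul]
    rw [Finset.sum_comm]
    exact Finset.sum_congr rfl fun j _ => Finset.sum_congr rfl fun k _ => by ring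
  · simp only [actHom_uVar, Matrix.mul_apply, Finset.mul_sum, Finset.sum_mul]
    rw [Finset.sum_comm]
    exact Finset.sum_congr rfl fun j _ => Finset.sum_congr rfl fun k _ => by ring

/-- The condition on `N` is what `M' = M z` gives for `N = M⁻¹`. Both sides obey the Leibniz rule
over `actHom`, so the variables suffice. -/
theorem derivation_actHom {δ : Derivation K S S} {ι : FullRing K n →ₐ[K] S}
    (hι : ∀ f, δ (ι f) = 0) {M N : Matrix (Fin 3) (Fin 3) S} {z : Matrix (Fin 3) (Fin 3) K}
    (hM : ∀ i j, δ (M i j) = (M * z.map (algebraMap K S)) i j)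
    (hN : ∀ i j, δ (N i j) = -(z.map (algebraMap K S) * N) i j) (f : FullRing K n) :
    δ (actHom ι M N f) = actHom ι M N (fullDer K n z f) := by
  have hx : ∀ i, fullDer K n z (xVar K n i) = -∑ j, z i j • xVar K n j := by
    intro i
    simp [xVar, fullDer, xuDer, mkDerivation_X]
  have hu : ∀ j, fullDer K n z (uVar K n j) = ∑ i, z i j • uVar K n i := by
    intro i
    simp [uVar, fullDer, xuDer, mkDerivation_X]
  induction f using MvPolynomial.induction_on with
  | C c => simp [← algebraMap_eq]
  | add f g hf hg => simp only [map_add, hf, hg]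
  | mul_X f s hf =>
    have hs : δ (actHom ι M N (X s)) = actHom ι M N (fullDer K n z (X s)) := by
      rcases s with p | i | i
      · have h1 := DFunLike.congr_fun (actHom_comp_rename ι M N)
        simp only [AlgHom.comp_apply] at h1
        rw [← rename_X, fullDer_rename_inl, h1, h1]
        exact derivation_substHom (fun f => hι _) hM p
      · change δ (actHom ι M N (xVar K n i)) = actHom ι M N (fullDer K n z (xVar K n i))
        simp only [hx, map_neg, map_sum, map_mul, actHom_xVar, Derivation.leibniz, hι, mul_zero,
          zero_add, hN, Matrix.mul_apply, Matrix.map_apply, smul_eq_mul, Finset.mul_sum, mul_neg,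
          Finset.sum_neg_distrib, Algebra.smul_def, AlgHom.commutes]
        rw [Finset.sum_comm]
        congr 1
        exact Finset.sum_congr rfl fun j _ => Finset.sum_congr rfl fun k _ => by ring
      · change δ (actHom ι M N (uVar K n i)) = actHom ι M N (fullDer K n z (uVar K n i))
        simp only [hu, map_sum, map_mul, actHom_uVar, Derivation.leibniz, hι, mul_zero,
          zero_add, hM, Matrix.mul_apply, Matrix.map_apply, smul_eq_mul, Finset.mul_sum,
          Algebra.smul_def, AlgHom.commutes]
        rw [Finset.sum_comm]
        exact Finset.sum_congr rfl fun j _ => Finset.sum_congr rfl fun k _ => by ring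
    simp only [map_mul, Derivation.leibniz, hf, hs, smul_eq_mul, map_add]

theorem slAct_eq_actHom (g : Matrix.SpecialLinearGroup (Fin 3) K) :
    slAct g = actHom (AlgHom.id K (FullRing K n)) (g.1.map (algebraMap K _))
      ((g⁻¹).1.map (algebraMap K _)) := by
  refine fullRing_algHom_ext ?_ (fun i => ?_) fun i => ?_
  · rw [actHom_comp_rename, AlgHom.id_comp]
    have h := comp_substHom (rename Sum.inl : CoordRing K n →ₐ[K] FullRing K n)
      (AlgHom.id K _) (g.1.map (algebraMap K _))
    rw [AlgHom.comp_id] at h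
    have hg : (g.1.map (algebraMap K (CoordRing K n))).map
        (rename Sum.inl : CoordRing K n →ₐ[K] FullRing K n) = g.1.map (algebraMap K _) := by
      ext i j : 1
      simp
    rw [← hg, ← h]
    refine MvPolynomial.algHom_ext fun p => ?_
    rw [AlgHom.comp_apply, AlgHom.comp_apply, rename_X, slAct, aeval_X, Sum.elim_inl, substHom,
      aeval_X, substCoeff]
    congr 4
    exact (map_id _).symm
  · rw [actHom_xVar, slAct, xVar, aeval_X]
    simp [Algebra.smul_def]
  · rw [actHom_uVar, slAct, uVar, aeval_X]
    simp [Algebra.smul_def]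

theorem slAct_mul (g h : Matrix.SpecialLinearGroup (Fin 3) K) (f : FullRing K n) :
    slAct (g * h) f = slAct g (slAct h f) := by
  have key : (slAct g).comp (slAct h) = (slAct (g * h) : FullRing K n →ₐ[K] FullRing K n) := by
    rw [slAct_eq_actHom h, comp_actHom, AlgHom.comp_id, slAct_eq_actHom g, slAct_eq_actHom (g * h)]
    have hc : ∀ (ψ : FullRing K n →ₐ[K] FullRing K n) (M : Matrix (Fin 3) (Fin 3) K),
        (M.map (algebraMap K (FullRing K n))).map ψ = M.map (algebraMap K _) := by
      intro ψ M
      ext i j : 1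
      exact ψ.commutes _
    rw [hc, hc, actHom_actHom, ← Matrix.map_mul (f := algebraMap K (FullRing K n)),
      ← Matrix.map_mul (f := algebraMap K (FullRing K n)), mul_inv_rev]
    rfl
  rw [← key, AlgHom.comp_apply]

end Action

/-! ### From `sl_3`-invariance to `SL_3`-invariance -/

section Invariant

variable {K : Type*} [Field K] {n : ℕ}

theorem specialLinearGroup_induction (P : Matrix.SpecialLinearGroup (Fin 3) K → Prop)
    (htransvec : ∀ (i j : Fin 3) (hij : i ≠ j) (c : K),
      P (Matrix.SpecialLinearGroup.transvection hij c))
    (hmul : ∀ A B, P A → P B → P (A * B)) (g : Matrix.SpecialLinearGroup (Fin 3) K) : P g := by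
  refine Matrix.SpecialLinearGroup.diagonal_transvection_induction' P g ?_ htransvec hmul
  intro i j hij c hc
  -- The classical factorization `w(c) w(-1)` of `diag(c, c⁻¹)`, where `w(c)` is a product of three
  -- transvections with parameters `c`, `-c⁻¹`, `c`.
  have h : Matrix.SpecialLinearGroup.diag2n hij c hc =
      Matrix.SpecialLinearGroup.transvection hij c *
      Matrix.SpecialLinearGroup.transvection hij.symm (-c⁻¹) *
      Matrix.SpecialLinearGroup.transvection hij c *
      Matrix.SpecialLinearGroup.transvection hij (-1) *
      Matrix.SpecialLinearGroup.transvection hij.symm 1 *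
      Matrix.SpecialLinearGroup.transvection hij (-1) := by
    apply Subtype.ext
    rw [Matrix.SpecialLinearGroup.diag2n_coe]
    simp only [Matrix.SpecialLinearGroup.coe_mul, Matrix.SpecialLinearGroup.transvection_coe,
      mul_add, add_mul, mul_one, one_mul, Matrix.single_mul_single_same,
      Matrix.single_mul_single_of_ne, hij, hij.symm, ne_eq, not_false_eq_true, add_zero]
    ext r s
    fin_cases r <;> fin_cases s <;> fin_cases i <;> fin_cases j <;>
      simp [hc] at hij ⊢
  rw [h]
  exact hmul _ _ (hmul _ _ (hmul _ _ (hmul _ _ (hmul _ _ (htransvec _ _ _ _) (htransvec _ _ _ _))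
    (htransvec _ _ _ _)) (htransvec _ _ _ _)) (htransvec _ _ _ _)) (htransvec _ _ _ _)

theorem map_one_add_single {S T F : Type*} [CommRing S] [CommRing T] [FunLike F S T]
    [RingHomClass F S T] (f : F) (r s : Fin 3) (x : S) :
    (1 + Matrix.single r s x).map f = 1 + Matrix.single r s (f x) := by
  rw [Matrix.map_add f (map_add f), Matrix.map_one f (map_zero f) (map_one f), Matrix.map_single]

variable [CharZero K]

/-- The parameter becomes a polynomial variable `t`. Since `E_{rs}² = 0`, the matrix `1 + t E_{rs}`
satisfies `M' = M E_{rs}`, so the transformed element has zero derivative and is constant in `t`. -/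
theorem slAct_transvection {f : FullRing K n} {r s : Fin 3} (hrs : r ≠ s)
    (hf : fullDer K n (Matrix.single r s 1) f = 0) (c : K) :
    slAct (Matrix.SpecialLinearGroup.transvection hrs c) f = f := by
  let R := FullRing K n
  let ι : R →ₐ[K] Polynomial R := Polynomial.CAlgHom
  let M : Matrix (Fin 3) (Fin 3) (Polynomial R) := 1 + Matrix.single r s Polynomial.X
  let N : Matrix (Fin 3) (Fin 3) (Polynomial R) := 1 + Matrix.single r s (-Polynomial.X)
  let δ : Derivation K (Polynomial R) (Polynomial R) := Polynomial.derivative'.restrictScalars K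
  have hδ : ∀ q, δ q = Polynomial.derivative q := fun q => rfl
  have h1 : δ (actHom ι M N f) = 0 := by
    rw [derivation_actHom (z := Matrix.single r s 1), hf, map_zero]
    · intro a
      exact Polynomial.derivative_C
    · intro i j
      have : M * (Matrix.single r s (1 : K)).map (algebraMap K (Polynomial R)) =
          Matrix.single r s 1 := by
        simp [M, add_mul, Matrix.map_single, Matrix.single_mul_single_of_ne, hrs.symm]
      rw [this, hδ]
      simp [M, Matrix.one_apply, Matrix.single_apply]
      split_ifs <;> simp
    · intro i j
      have : (Matrix.single r s (1 : K)).map (algebraMap K (Polynomial R)) * N =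
          Matrix.single r s 1 := by
        simp [N, mul_add, Matrix.map_single, Matrix.single_mul_single_of_ne, hrs.symm]
      rw [this, hδ]
      simp [N, Matrix.one_apply, Matrix.single_apply]
      split_ifs <;> simp
  have h2 := Polynomial.eq_C_of_natDegree_eq_zero
    (Polynomial.derivative_eq_zero.1 h1)
  -- Evaluation at `t`; the values at `c` and at `0` are the transformed and the original element.
  have h3 : ∀ t : K, actHom (AlgHom.id K R) (1 + Matrix.single r s (algebraMap K R t))
      (1 + Matrix.single r s (-algebraMap K R t)) f = (actHom ι M N f).coeff 0 := by
    intro t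
    let ev : Polynomial R →ₐ[K] R := (Polynomial.aeval (algebraMap K R t)).restrictScalars K
    have e1 : ev.comp ι = AlgHom.id K R := by
      ext1 a
      exact Polynomial.aeval_C _ _
    have e2 : M.map ev = 1 + Matrix.single r s (algebraMap K R t) := by
      rw [map_one_add_single ev]
      exact congrArg (1 + Matrix.single r s ·) (Polynomial.aeval_X _)
    have e3 : N.map ev = 1 + Matrix.single r s (-algebraMap K R t) := by
      rw [map_one_add_single ev, map_neg]
      exact congrArg (fun x => 1 + Matrix.single r s (-x)) (Polynomial.aeval_X _)
    have h := DFunLike.congr_fun (comp_actHom ev ι M N) f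
    rw [e1, e2, e3, AlgHom.comp_apply, h2] at h
    rw [← h]
    simp [ev]
  have h4 := (h3 c).trans (h3 0).symm
  rw [map_zero, neg_zero, Matrix.single_zero, add_zero, actHom_one, AlgHom.id_apply] at h4
  rw [slAct_eq_actHom, Matrix.SpecialLinearGroup.transvection_inv]
  refine Eq.trans ?_ h4
  rw [Matrix.SpecialLinearGroup.transvection_coe, Matrix.SpecialLinearGroup.transvection_coe,
    map_one_add_single (algebraMap K R), map_one_add_single (algebraMap K R), map_neg]

theorem slAct_eq_self {f : FullRing K n} (hf : ∀ z ∈ sl3 K, fullDer K n z f = 0)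
    (g : Matrix.SpecialLinearGroup (Fin 3) K) : slAct g f = f := by
  induction g using specialLinearGroup_induction with
  | htransvec i j hij c =>
    exact slAct_transvection hij (hf _ (mem_sl3.2 (Matrix.trace_single_eq_of_ne _ _ _ hij))) c
  | hmul A B hA hB => rw [slAct_mul, hB, hA]

end Invariant

end TernaryForms

end

theorem mainTheorem6 (K : Type*) [Field K] [CharZero K] (n m d₁ d₂ : ℕ)
    (a : TernaryForms.CoordRing K n)
    (ha_inv : a ∈ LieModule.maxTrivSubmodule K (TernaryForms.UT3 K) (TernaryForms.CoordRing K n))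
    (ha_hom : a.IsHomogeneous m)
    (ha_iso : TernaryForms.IsIsobaric a)
    (ha_ord : TernaryForms.HasOrder a d₁ d₂) :
    (∃ N : LieSubmodule K (TernaryForms.sl3 K) (TernaryForms.CoordRing K n),
      N.toSubmodule = TernaryForms.envelopingSpan a ∧
      LieModule.IsIrreducible K (TernaryForms.sl3 K) N ∧
      Nonempty (N ≃ₗ⁅K, TernaryForms.sl3 K⁆ TernaryForms.Gamma K d₁ d₂)) ∧
    (∃! B : TernaryForms.FormIdx d₁ → TernaryForms.FormIdx d₂ → TernaryForms.CoordRing K n,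
      TernaryForms.IsConcomitantFamily a B) ∧
    ∀ B : TernaryForms.FormIdx d₁ → TernaryForms.FormIdx d₂ → TernaryForms.CoordRing K n,
      TernaryForms.IsConcomitantFamily a B →
        Submodule.span K {b | ∃ p q, b = B p q} = TernaryForms.envelopingSpan a ∧
        (∀ z ∈ TernaryForms.sl3 K,
          TernaryForms.fullDer K n z (TernaryForms.casimir B) = 0) ∧
        TernaryForms.IsMixedConcomitant m d₁ d₂ (TernaryForms.casimir B) := by
  have ha := TernaryForms.isHighest_of_hasOrder ha_inv ha_iso ha_ord
  refine ⟨TernaryForms.exists_lieSubmodule_envelopingSpan ha ha_ord,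
    TernaryForms.existsUnique_isConcomitantFamily ha ha_ord, fun B hB => ?_⟩
  have hspan := hB.span_eq
  have hcas : ∀ z ∈ TernaryForms.sl3 K,
      TernaryForms.fullDer K n z (TernaryForms.casimir B) = 0 :=
    fun z hz => hB.fullDer_casimir ha hz
  -- The entries lie in `𝔘(DT_3) a`, and the derivations that generate it preserve the degree in
  -- `A`.
  have hhom : ∀ p q, (B p q).IsHomogeneous m := fun p q =>
    TernaryForms.envelopingSpan_le_homogeneousSubmodule ha_hom
      (hspan ▸ Submodule.subset_span ⟨p, q, rfl⟩)
  refine ⟨hspan, hcas, ?_, TernaryForms.slAct_eq_self hcas, ?_, ?_, ?_⟩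
  · exact TernaryForms.casimir_ne_zero (hB.init ▸ ha_ord.ne_zero)
  · exact TernaryForms.isWeightedHomogeneous_casimir (α := 1) (β := 0) (γ := 0) hhom (by simp)
      (by ext (_ | _ | _) <;> rfl)
  · exact TernaryForms.isWeightedHomogeneous_casimir (α := 0) (β := 1) (γ := 0)
      (fun p q => TernaryForms.isWeightedHomogeneous_zero_weight _) (by simp) rfl
  · exact TernaryForms.isWeightedHomogeneous_casimir (α := 0) (β := 0) (γ := 1)
      (fun p q => TernaryForms.isWeightedHomogeneous_zero_weight _) (by simp) rfl
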